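/- Let $d\ge 1$. Write $P(j)$ for the number of partitions of $j$. Let ${\sf k}$ be a field, $R={\sf k}[x_1,\dots,x_n]$ with $n\ge d$, and let $S$ be the divided power algebra ${\sf k}[y_1,\dots,y_n]_{DP}$, with monomial basis $y^{(e)}$ in degree $-|e|$ and with $R$ acting by contraction: $x^a\circ y^{(e)}=y^{(e-a)}$ if $a\le e$ and $0$ otherwise. The group $\mathfrak S_n$ permutes the variables; $R'_d$ and $S'_{-d}$ are the invariants in $R_d$ and $S_{-d}$. For $U\subseteq R'_d$ set $U^\perp=\{w\in S'_{-d}: u\circ w=0 \text{ for all } u\in U\}$; for $V\subseteq R$ let $(V)_{\mathfrak S_n}$ be the ideal generated by all $\sigma\cdot f$ with $f\in V$, $\sigma\in\mathfrak S_n$. $\mathrm{Gr}(r,W)$ is the set of $r$-dimensional subspaces of $W$, with the Zariski topology given by Plücker coordinates. When $\operatorname{char}{\sf k}=0$ or $\operatorname{char}{\sf k}>n$, let $\rho(f)=\frac1{n!}\sum_{\sigma\in\mathfrak S_n}\sigma\cdot f$. For a partition $\lambda=(\lambda_1\ge\dots\ge\lambda_p)$ of $d$ put $x^\lambda=x_1^{\lambda_1}\cdots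 x_p^{\lambda_p}$ and $M_\lambda=\rho(x^\lambda)$; the type of a monomial is the partition formed by its nonzero exponents. **The forms $f_\alpha$.** Fix a total order on the partitions of $d$. For $0\ne\alpha=(\alpha_\lambda)\in{\sf k}^{P(d)}$ let $h_\alpha=\sum_{\lambda\vdash d}\alpha_\lambda x^\lambda$ and let $\tau$ be the smallest partition with $\alpha_\tau\neq0$. For each $\lambda\vdash d$ with $\lambda\ne\tau$ and each partition $\gamma\subsetneq\lambda$ (proper sub-multiset of the parts, including the empty one) choose $b(\lambda,\gamma)=m-m'$ with $m\neq m'$ monomials of type $\lambda$ such that $g=\gcd(m,m')$ has type $\gamma$ and is coprime to $m/g$ and to $m'/g$, in such a way that no variable of $b(\lambda,\gamma)$ occurs in $h_\alpha$ and no two of these binomials share a variable. Set $f_\alpha=h_\alpha+\sum_{\lambda\ne\tau}\sum_{\gamma\subsetneq\lambda}b(\lambda,\gamma)$. **Theorem.** There is an $N$, depending only on $d$, such that for every field ${\sf k}$, every order and every $\alpha\neq 0$ there is a form $f_\alpha\in{\sf k}[x_1,\dots,x_N]$ which is a valid choice of $f_\alpha$ in ${\sf k}[x_1,\dots,x_n]$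 for all $n\ge N$. Moreover, let $1\le r\le P(d)$. There is a nonempty open subset $G_0$ of $\mathrm{Gr}(r,{\sf k}^{P(d)})$, independent of $n$, such that for each $n\ge d$ with $\operatorname{char}{\sf k}=0$ or $\operatorname{char}{\sf k}>n$ there is a nonempty open subset $G$ of $\mathrm{Gr}(r,R'_d)$ with the following two properties. (A) For every $U\in G$, the ideal $J=\operatorname{Ann}_R(U^\perp+S_{\ge -d+1})$ and $A=R/J$ satisfy: - $A$ is narrow, that is, graded artinian with top socle degree at most the initial degree of $J$; $\dim J_d=\dim R_d-(P(d)-r)$; and $J=(x_1,\dots,x_n)^d$ if $r=P(d)$. - If $r<P(d)$, then $A$ is $d$-extremely narrow: the top socle degree of $A$ and the initial degree of $J$ are both $d$, and there are a basis $F_1,\dots,F_a$ of $(J^{-1})_{-d}$, where $J^{-1}=\{g\in S: J\circ g=0\}$, and an $x\in R_1$ such that every $(\ell_1,\dots,\ell_a)\in R_1^a$ with $\sum_i\ell_i\circ F_i=0$ lies in $x\,{\sf k}^a$. Its socle polynomial is $\big(\dim R_{d-1}-(P(d)-r)n+\max\{P(d)-P(d-1)-r,0\}\big)z^{d-1}+(P(d)-r)z^d$.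 - $J$ is generated in degree $d$. - $A$ has the weak Lefschetz property; if $r<P(d)$, multiplication $A_{i-1}\to A_i$ by every $\ell\in R_1$ that is not a multiple of $x_1+\dots+x_n$ has maximal rank for all $i$. (B) Let $\alpha^1,\dots,\alpha^r\in{\sf k}^{P(d)}$ be such that $U=\mathrm{Span}\big(\sum_\lambda\alpha^1_\lambda M_\lambda,\dots,\sum_\lambda\alpha^r_\lambda M_\lambda\big)$ is in $\mathrm{Gr}(r,R'_d)$, let $f_{\alpha^1},\dots,f_{\alpha^r}\in R$ be any forms obtained by the construction above in $n$ variables, and let $V=\mathrm{Span}(f_{\alpha^1},\dots,f_{\alpha^r})$. Then 1. $V\in\mathrm{Gr}(r,R_d)$; 2. $U=\mathrm{Span}(\rho(f): f\in V)$; 3. if $U\in G$, then $\operatorname{Ann}_R(U^\perp+S_{\ge -d+1})=(V)_{\mathfrak S_n}$. The same equality holds whenever $\mathrm{Span}(\alpha^1,\dots,\alpha^r)\in G_0$, so that the generators up to symmetry can then be chosen independently of $n\ge N$. -/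

import Mathlib

noncomputable section

namespace SymIdeal

open MvPolynomial

/-! ### Grassmannians and their Zariski topology -/

/-- `Gr(r, W)`: the `r`-dimensional subspaces of the subspace `W` of `E`. -/
def Gr {k E : Type*} [Field k] [AddCommGroup E] [Module k E] (r : ℕ) (W : Submodule k E) :
    Set (Submodule k E) :=
  {U | U ≤ W ∧ Module.finrank k U = r}

/-- Zariski open subsets of `Gr(r, W)`. The Plücker coordinates of the span of linearly independent
`u₁, …, u_r` are the coordinates of `u₁ ∧ ⋯ ∧ u_r`, that is, the values `φ(u₁, …, u_r)` of
alternating forms `φ`. The set `G` is open if its complement in `Gr(r, W)` is the zero locus of a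
set `Q` of homogeneous polynomials in the Plücker coordinates. -/
def IsZariskiOpen {k E : Type*} [Field k] [AddCommGroup E] [Module k E] (r : ℕ)
    (W : Submodule k E) (G : Set (Submodule k E)) : Prop :=
  G ⊆ Gr r W ∧
    ∃ Q : Set (MvPolynomial (E [⋀^Fin r]→ₗ[k] k) k),
      (∀ q ∈ Q, ∃ m : ℕ, q.IsHomogeneous m) ∧
      ∀ u : Fin r → E, (∀ i, u i ∈ W) → LinearIndependent k u →
        (Submodule.span k (Set.range u) ∈ G ↔
          ∃ q ∈ Q, MvPolynomial.eval (fun φ : E [⋀^Fin r]→ₗ[k] k => φ u) q ≠ 0)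

/-! ### The ring `R`, its graded pieces, its invariants -/

section Ring

variable {k : Type*} [Field k] {n : ℕ}

/-- `R_d`, the forms of degree `d` in `R = k[x₁, …, x_n]`. -/
abbrev formsR (k : Type*) [Field k] (n d : ℕ) : Submodule k (MvPolynomial (Fin n) k) :=
  homogeneousSubmodule (Fin n) k d

/-- `R'_d`, the `𝔖_n`-invariant forms of degree `d`. -/
def invR (k : Type*) [Field k] (n d : ℕ) : Submodule k (MvPolynomial (Fin n) k) :=
  Subalgebra.toSubmodule (symmetricSubalgebra (Fin n) k) ⊓ formsR k n d

/-- The Reynolds operator `ρ(f) = (1/n!) ∑_σ σ · f`. -/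
def reynolds (k : Type*) [Field k] (n : ℕ) :
    MvPolynomial (Fin n) k →ₗ[k] MvPolynomial (Fin n) k :=
  ((n.factorial : k)⁻¹) • ∑ σ : Equiv.Perm (Fin n), (rename (R := k) σ).toLinearMap

/-- The symmetric ideal `(V)_{𝔖_n} = (σ · f : σ ∈ 𝔖_n, f ∈ V)`. -/
def symIdeal (V : Submodule k (MvPolynomial (Fin n) k)) : Ideal (MvPolynomial (Fin n) k) :=
  Ideal.span {g | ∃ σ : Equiv.Perm (Fin n), ∃ f ∈ V, g = rename σ f}

end Ring

/-! ### The divided power module `S` and contraction -/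

/-- The divided power algebra `S = k[y₁, …, y_n]_{DP}`, as a vector space with basis the monomials
`y₁^(e₁) ⋯ y_n^(e_n)`, of degree `-(e₁ + ⋯ + e_n)`. The basis vector is `Finsupp.single e 1`. -/
abbrev DP (k : Type*) [Field k] (n : ℕ) : Type _ := (Fin n →₀ ℕ) →₀ k

section Dual

variable {k : Type*} [Field k] {n : ℕ}

/-- Contraction of `S` by the monomial `x^a`: the coefficient of `y^(b)` in `x^a ∘ g` is the
coefficient of `y^(a+b)` in `g`. -/
def contractMonomial (k : Type*) [Field k] {n : ℕ} (a : Fin n →₀ ℕ) : Module.End k (DP k n) :=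
  Finsupp.lcomapDomain (fun b => a + b) (add_right_injective a)

/-- Contraction `f ∘ g`, as the algebra map `R → End_k(S)` that gives the `R`-module structure
of `S`. -/
def contract (k : Type*) [Field k] (n : ℕ) :
    MvPolynomial (Fin n) k →ₐ[k] Module.End k (DP k n) :=
  AddMonoidAlgebra.lift k (Module.End k (DP k n)) (Fin n →₀ ℕ)
    { toFun := fun a => contractMonomial k a.toAdd
      map_one' := by
        ext a b
        simp [contractMonomial, Finsupp.lcomapDomain]
      map_mul' := fun a a' => by
        ext b c
        simp [contractMonomial, Finsupp.lcomapDomain, add_assoc, add_left_comm] }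

/-- Contraction has the usual values on monomials. -/
theorem contract_monomial_single (a e : Fin n →₀ ℕ) :
    contract k n (monomial a 1) (Finsupp.single e 1) =
      if a ≤ e then Finsupp.single (e - a) 1 else 0 := by
  have h : contract k n (monomial a 1) = contractMonomial k a := by
    change AddMonoidAlgebra.lift k (Module.End k (DP k n)) (Fin n →₀ ℕ) _
      (AddMonoidAlgebra.single a 1) = _
    rw [AddMonoidAlgebra.lift_single, one_smul]
    rfl
  rw [h]
  ext b
  change (Finsupp.single e (1 : k)) (a + b) = _
  split_ifs with hae
  · rw [Finsupp.single_apply, Finsupp.single_apply]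
    congr 1
    rw [eq_comm, tsub_eq_iff_eq_add_of_le hae, add_comm b a, eq_comm, eq_comm (a := e)]
  · rw [Finsupp.single_apply, if_neg]
    · rfl
    · rintro rfl
      exact hae (self_le_add_right a b)

/-- `S_{-d}`. -/
def formsS (k : Type*) [Field k] (n d : ℕ) : Submodule k (DP k n) :=
  Finsupp.supported k k {e | e.degree = d}

/-- `S_{≥ -d+1}`, spanned by the monomials whose exponents sum to less than `d`. -/
def lowS (k : Type*) [Field k] (n d : ℕ) : Submodule k (DP k n) :=
  Finsupp.supported k k {e | e.degree < d}

/-- `S'_{-d}`, the elements of `S_{-d}` fixed by all permutations of the variables `y_i`. -/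
def invS (k : Type*) [Field k] (n d : ℕ) : Submodule k (DP k n) :=
  formsS k n d ⊓
    ⨅ σ : Equiv.Perm (Fin n),
      LinearMap.eqLocus (Finsupp.lmapDomain k k (Finsupp.mapDomain (M := ℕ) σ)) LinearMap.id

/-- `U^⊥ = {w ∈ S'_{-d} : u ∘ w = 0 for all u ∈ U}`. -/
def perp (d : ℕ) (U : Submodule k (MvPolynomial (Fin n) k)) : Submodule k (DP k n) :=
  invS k n d ⊓ ⨅ u ∈ U, LinearMap.ker (contract k n u)

/-- `Ann_R(X) = {f ∈ R : f ∘ g = 0 for all g ∈ X}`. -/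
def annR (X : Submodule k (DP k n)) : Ideal (MvPolynomial (Fin n) k) where
  carrier := {f | ∀ g ∈ X, contract k n f g = 0}
  zero_mem' := fun g _ => by simp
  add_mem' := fun {a b} ha hb g hg => by simp [ha g hg, hb g hg]
  smul_mem' := fun c f hf g hg => by simp [hf g hg]

/-- The Macaulay inverse system `I⁻¹ = {g ∈ S : f ∘ g = 0 for all f ∈ I}`. -/
def inverseSystem (I : Ideal (MvPolynomial (Fin n) k)) : Submodule k (DP k n) :=
  ⨅ f ∈ I, LinearMap.ker (contract k n f)

end Dual

/-! ### Graded quotients: socle, narrow and extremely narrow algebras, weak Lefschetz -/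

section Quotient

variable {k : Type*} [Field k] {n : ℕ}

/-- `I_i`. -/
def idealPart (I : Ideal (MvPolynomial (Fin n) k)) (i : ℕ) :
    Submodule k (MvPolynomial (Fin n) k) :=
  I.restrictScalars k ⊓ formsR k n i

/-- `A_i` for `A = R/I`. -/
def quotPart (I : Ideal (MvPolynomial (Fin n) k)) (i : ℕ) :
    Submodule k (MvPolynomial (Fin n) k ⧸ I) :=
  (formsR k n i).map (Ideal.Quotient.mkₐ k I).toLinearMap

/-- `Soc(A)_i = {a ∈ A_i : x_j a = 0 for all j}` for `A = R/I`. -/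
def soclePart (I : Ideal (MvPolynomial (Fin n) k)) (i : ℕ) :
    Submodule k (MvPolynomial (Fin n) k ⧸ I) :=
  quotPart I i ⊓
    ⨅ j : Fin n, LinearMap.ker (LinearMap.mulLeft k (Ideal.Quotient.mk I (X j)))

/-- `s` is the top socle degree `s(R/I)`. -/
def IsTopSocleDegree (I : Ideal (MvPolynomial (Fin n) k)) (s : ℕ) : Prop :=
  IsGreatest {i | soclePart I i ≠ ⊥} s

/-- `t` is the initial degree `t(I)`. -/
def IsInitialDegree (I : Ideal (MvPolynomial (Fin n) k)) (t : ℕ) : Prop :=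
  IsLeast {i | idealPart I i ≠ ⊥} t

/-- `R/I` is a graded artinian algebra with `s(R/I) ≤ t(I)`. -/
def IsNarrow (I : Ideal (MvPolynomial (Fin n) k)) : Prop :=
  (∀ f ∈ I, ∀ i, homogeneousComponent i f ∈ I) ∧
  IsArtinianRing (MvPolynomial (Fin n) k ⧸ I) ∧
  ∃ s t, IsTopSocleDegree I s ∧ IsInitialDegree I t ∧ s ≤ t

/-- `R/I` is a graded artinian algebra with `s(R/I) = t(I) = d`, and for some basis `F₁, …, F_a` of
`(I⁻¹)_{-d}` and some linear form `x`, every tuple `(ℓ₁, …, ℓ_a)` of linear forms with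
`∑ ℓ_i ∘ F_i = 0` is in `x k^a`. -/
def IsExtremelyNarrow (d : ℕ) (I : Ideal (MvPolynomial (Fin n) k)) : Prop :=
  (∀ f ∈ I, ∀ i, homogeneousComponent i f ∈ I) ∧
  IsArtinianRing (MvPolynomial (Fin n) k ⧸ I) ∧
  IsTopSocleDegree I d ∧ IsInitialDegree I d ∧
  ∃ (a : ℕ) (F : Module.Basis (Fin a) k ↥(inverseSystem I ⊓ formsS k n d)),
    ∃ x ∈ formsR k n 1, ∀ l : Fin a → MvPolynomial (Fin n) k,
      (∀ i, l i ∈ formsR k n 1) → ∑ i, contract k n (l i) (F i : DP k n) = 0 →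
      ∃ c : Fin a → k, ∀ i, l i = c i • x

/-- Multiplication by `l` has maximal rank as a map `A_i → A_{i+1}`, for all `i`. -/
def HasMaximalRank (I : Ideal (MvPolynomial (Fin n) k)) (l : MvPolynomial (Fin n) k) : Prop :=
  ∀ i : ℕ,
    (∀ a ∈ quotPart I i, Ideal.Quotient.mk I l * a = 0 → a = 0) ∨
    (∀ b ∈ quotPart I (i + 1), ∃ a ∈ quotPart I i, Ideal.Quotient.mk I l * a = b)

/-- The weak Lefschetz property of `R/I`: multiplication by the linear forms in a nonempty Zariski
open subset of the projective space `ℙ(R₁) = Gr(1, R₁)` has maximal rank. -/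
def HasWLP (I : Ideal (MvPolynomial (Fin n) k)) : Prop :=
  ∃ T : Set (Submodule k (MvPolynomial (Fin n) k)),
    IsZariskiOpen 1 (formsR k n 1) T ∧ T.Nonempty ∧
    ∀ l, Submodule.span k {l} ∈ T → HasMaximalRank I l

end Quotient

/-! ### Narrow algebras with invariant socle -/

section Psi

variable {k : Type*} [Field k] {n : ℕ}

/-- `P(d)`, the number of partitions of `d`. -/
def numPartitions (d : ℕ) : ℕ := Fintype.card (Nat.Partition d)

/-- `Ann_R(U^⊥ + S_{≥ -d+1})`. -/
def psi (d : ℕ) (U : Submodule k (MvPolynomial (Fin n) k)) : Ideal (MvPolynomial (Fin n) k) :=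
  annR (perp d U ⊔ lowS k n d)

/-- For `J = Ann_R(U^⊥ + S_{≥ -d+1})` and `A = R/J` (with `n ≥ d` and `dim U = r`):
* `A` is narrow, `dim J_d = dim R_d - (P(d) - r)`, and `J = 𝔪^d` if `r = P(d)`;
* if `r < P(d)`, then `A` is `d`-extremely narrow with socle polynomial
  `(dim R_{d-1} - (P(d) - r) n + max{P(d) - P(d-1) - r, 0}) z^{d-1} + (P(d) - r) z^d`;
* `J` is generated in degree `d`;
* `A` has the weak Lefschetz property and, if `r < P(d)`, every linear form that is not a multiple
  of `x₁ + ⋯ + x_n` acts with maximal rank. -/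
structure HasNarrowProperties (d r : ℕ) (U : Submodule k (MvPolynomial (Fin n) k)) : Prop where
  narrow : IsNarrow (psi d U)
  dim_eq : (Module.finrank k (idealPart (psi d U) d) : ℤ) =
    Module.finrank k (formsR k n d) - ((numPartitions d : ℤ) - r)
  eq_pow : r = numPartitions d →
    psi d U = Ideal.span (Set.range (X : Fin n → MvPolynomial (Fin n) k)) ^ d
  extremelyNarrow : r < numPartitions d → IsExtremelyNarrow d (psi d U)
  socle : r < numPartitions d → ∀ i : ℕ,
    (Module.finrank k (soclePart (psi d U) i) : ℤ) =
      if i = d - 1 then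
        Module.finrank k (formsR k n (d - 1)) - ((numPartitions d : ℤ) - r) * n +
          max ((numPartitions d : ℤ) - numPartitions (d - 1) - r) 0
      else if i = d then (numPartitions d : ℤ) - r
      else 0
  generated : psi d U = Ideal.span (idealPart (psi d U) d : Set (MvPolynomial (Fin n) k))
  wlp : HasWLP (psi d U)
  maximalRank : r < numPartitions d → ∀ l ∈ formsR k n 1,
    (∀ c : k, l ≠ c • ∑ i : Fin n, X i) → HasMaximalRank (psi d U) l

end Psi

/-! ### Monomials of a given type and the forms `f_α` -/

section Construction

variable {k : Type*} [Field k] {n : ℕ}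

/-- The exponent of `x^μ = x₁^{μ₁} ⋯ x_p^{μ_p}` for a partition `μ = (μ₁ ≥ ⋯ ≥ μ_p)`
(used when `p ≤ n`). -/
def partExponent (n : ℕ) {d : ℕ} (μ : Nat.Partition d) : Fin n →₀ ℕ :=
  Finsupp.equivFunOnFinite.symm fun i => (μ.parts.sort (· ≥ ·)).getD i 0

/-- The type of a monomial, as the multiset of its nonzero exponents. -/
def monType (e : Fin n →₀ ℕ) : Multiset ℕ := e.support.val.map e

/-- `h_α = ∑_{μ ⊢ d} α_μ x^μ`. -/
def hForm (n : ℕ) {d : ℕ} (α : Nat.Partition d → k) : MvPolynomial (Fin n) k :=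
  ∑ μ : Nat.Partition d, monomial (partExponent n μ) (α μ)

/-- `M_μ = ρ(x^μ)`. -/
def symM (k : Type*) [Field k] (n : ℕ) {d : ℕ} (μ : Nat.Partition d) : MvPolynomial (Fin n) k :=
  reynolds k n (monomial (partExponent n μ) 1)

/-- `b` is an admissible `μ`-binomial `m - m'` whose greatest common divisor `g = gcd(m, m')` has
type `γ`: the monomials `m ≠ m'` have type `μ`, and `g` is coprime to `m/g` and to `m'/g`.
Monomials are given by their exponents. -/
def IsAdmissibleBinomial {d : ℕ} (μ : Nat.Partition d) (γ : Multiset ℕ)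
    (b : MvPolynomial (Fin n) k) : Prop :=
  ∃ m m' : Fin n →₀ ℕ, b = monomial m 1 - monomial m' 1 ∧ m ≠ m' ∧
    monType m = μ.parts ∧ monType m' = μ.parts ∧ monType (m ⊓ m') = γ ∧
    Disjoint (m ⊓ m').support (m - m ⊓ m').support ∧
    Disjoint (m ⊓ m').support (m' - m ⊓ m').support

/-- `f` is one of the forms
`f_α = h_α + ∑_{μ ⊢ d, μ ≠ τ} ∑_{γ ⊊ μ} b(μ, γ)` in `n ≥ d` variables, where `τ` is smallest with
`α_τ ≠ 0` for the given order on partitions, `γ` runs over the proper subpartitions of `μ`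
(including the empty one), `b(μ, γ)` is an admissible `μ`-binomial whose greatest common divisor has
type `γ`, the variables in `b(μ, γ)` do not occur in `h_α`, and no two of the binomials share
a variable. -/
def IsFForm {d : ℕ} (ord : LinearOrder (Nat.Partition d)) (α : Nat.Partition d → k)
    (f : MvPolynomial (Fin n) k) : Prop :=
  d ≤ n ∧
  ∃ τ : Nat.Partition d, α τ ≠ 0 ∧ (∀ μ, α μ ≠ 0 → ord.le τ μ) ∧
  ∃ b : Nat.Partition d → Multiset ℕ → MvPolynomial (Fin n) k,
    (∀ μ, μ ≠ τ → ∀ γ, γ < μ.parts →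
      IsAdmissibleBinomial μ γ (b μ γ) ∧ Disjoint (b μ γ).vars (hForm n α).vars) ∧
    (∀ μ μ', μ ≠ τ → μ' ≠ τ → ∀ γ γ', γ < μ.parts → γ' < μ'.parts → (μ, γ) ≠ (μ', γ') →
      Disjoint (b μ γ).vars (b μ' γ').vars) ∧
    f = hForm n α +
      ∑ μ ∈ Finset.univ.filter (fun μ : Nat.Partition d => μ ≠ τ),
        ∑ γ ∈ Finset.Iio μ.parts, b μ γ

end Construction

end SymIdeal

end

open MvPolynomial SymIdeal

/-! The contraction pairing between `R_d` and `S_{-d}` is perfect, so the ideal J = Ann(U^⊥ + S_{≥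
-d+1}) is known degree by degree: zero below d, the orthogonal of Z = U^⊥ in degree d, everything
above d. Questions about A = R/J thereby become questions about Z. The socle in degree d has
dimension dim Z, and the socle in degree d-1 is the orthogonal of R_1∘Z (`finrank_soclePart_pred`).
A nonzero linear form ℓ has maximal rank once ℓ∘ is injective on Z (`hasMaximalRank_psi`). J is
generated in degree d once no nonzero F of degree -(d+1) has all x_i∘F in Z (`psi_le_span`).

All of this is governed by `syzygy_const`. Suppose ∑ x_i∘v_i = 0 with v_i in a space Z of
invariants. Applying the transposition (i j) and subtracting leaves (x_i - x_j)∘(v_i - v_j) = 0. An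
invariant killed by x_i - x_j is a multiple of the sum `allOnes` of all monomials
(`eq_smul_allOnes`). So if Z avoids `allOnes`, all v_i are equal: the only linear syzygies come from
s = x_1 + ⋯ + x_n. This yields extreme narrowness with x = s, maximal rank for ℓ not proportional to
s, the dimension of R_1∘Z and, applied to the Koszul relations among the x_i∘F, generation in degree
d.

Two generic conditions on U thus suffice (`genericOpen`): `allOnes` is not in U^⊥, and U^⊥ meets the
kernel of s∘ on invariants in the expected dimension. That kernel has dimension P(d) - P(d-1),
because s∘ is dual to multiplication by s on invariant forms, which is injective. Apart from the
socle formula, the second condition matters only for generation in two variables.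

For the generators, the key fact is `IsFForm.mem_invS`: whatever is orthogonal to the orbit of a
single f_α is invariant. Take γ equal to μ with one part p removed. Then b(μ, γ) = g(x_i^p - x_j^p),
and (i j) negates it and fixes the rest of f_α, so f_α - (i j)f_α = 2b. Orthogonality to all σb lets
the part p move to any free variable. Such moves generate all permutations, so the element is
constant on each type μ ≠ τ; the remaining term α_τ x^τ then forces constancy on type τ. On
invariants a form pairs like its average, and ρ(V) = U, so orthogonality to the orbit of V means
membership in U^⊥.

The set G_0 asks that the coordinate sum be nonzero on the span of the α's. Since every M_μ pairs to
1 with `allOnes`, this says that `allOnes` is not in U^⊥, whatever n is. -/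

noncomputable section

namespace SymIdeal

open MvPolynomial

/-! ### The perfect pairing between forms and divided powers -/

section Pairing

variable {k : Type*} [Field k] {n : ℕ}

/-- The contraction pairing `R × S → k`. -/
def pair (k : Type*) [Field k] (n : ℕ) : MvPolynomial (Fin n) k →ₗ[k] DP k n →ₗ[k] k :=
  LinearMap.compr₂ (contract k n).toLinearMap (Finsupp.lapply 0)

theorem pair_def (f : MvPolynomial (Fin n) k) (w : DP k n) : pair k n f w = contract k n f w 0 :=
  rfl

theorem contract_monomial_apply (a b : Fin n →₀ ℕ) (c : k) (w : DP k n) :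
    contract k n (monomial a c) w b = c * w (a + b) := by
  have h : contract k n (monomial a c) = c • contractMonomial k a := by
    change AddMonoidAlgebra.lift k (Module.End k (DP k n)) (Fin n →₀ ℕ) _
      (AddMonoidAlgebra.single a c) = _
    rw [AddMonoidAlgebra.lift_single]
    rfl
  rw [h]
  rfl

theorem contract_X_apply (i : Fin n) (w : DP k n) (b : Fin n →₀ ℕ) :
    contract k n (X i) w b = w (Finsupp.single i 1 + b) := by
  rw [X, contract_monomial_apply, one_mul]

theorem pair_monomial (a : Fin n →₀ ℕ) (c : k) (w : DP k n) :
    pair k n (monomial a c) w = c * w a := by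
  simp [pair_def, contract_monomial_apply]

theorem pair_mul (f g : MvPolynomial (Fin n) k) (w : DP k n) :
    pair k n (f * g) w = pair k n g (contract k n f w) := by
  rw [mul_comm, pair_def, map_mul]
  rfl

theorem contract_apply (f : MvPolynomial (Fin n) k) (w : DP k n) (b : Fin n →₀ ℕ) :
    contract k n f w b = pair k n (f * monomial b 1) w := by
  rw [pair_mul, pair_monomial, one_mul]

theorem pair_single (f : MvPolynomial (Fin n) k) (e : Fin n →₀ ℕ) :
    pair k n f (Finsupp.single e 1) = coeff e f := by
  induction f using MvPolynomial.induction_on' with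
  | monomial a c =>
    classical
    rw [pair_monomial, coeff_monomial, Finsupp.single_apply]
    simp [eq_comm]
  | add p q hp hq => simp [hp, hq]

theorem mem_formsS {d : ℕ} {w : DP k n} :
    w ∈ formsS k n d ↔ ∀ e, w e ≠ 0 → e.degree = d := by
  simp [formsS, Finsupp.mem_supported, Set.subset_def]

theorem mem_lowS {d : ℕ} {w : DP k n} :
    w ∈ lowS k n d ↔ ∀ e, w e ≠ 0 → e.degree < d := by
  simp [lowS, Finsupp.mem_supported, Set.subset_def]

theorem pair_eq_zero {f : MvPolynomial (Fin n) k} {w : DP k n}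
    (h : ∀ e, coeff e f ≠ 0 → w e = 0) : pair k n f w = 0 := by
  rw [f.as_sum, map_sum, LinearMap.sum_apply]
  refine Finset.sum_eq_zero fun e he => ?_
  rw [pair_monomial, h e (by simpa using he), mul_zero]

theorem degree_eq_of_coeff_ne_zero {d : ℕ} {f : MvPolynomial (Fin n) k} (hf : f ∈ formsR k n d)
    {e : Fin n →₀ ℕ} (he : coeff e f ≠ 0) : e.degree = d := by
  by_contra h
  exact he (IsHomogeneous.coeff_eq_zero hf h)

theorem pair_eq_zero_of_ne {i j : ℕ} (hij : i ≠ j) {f : MvPolynomial (Fin n) k} {w : DP k n}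
    (hf : f ∈ formsR k n i) (hw : w ∈ formsS k n j) : pair k n f w = 0 := by
  refine pair_eq_zero fun e he => ?_
  by_contra h
  exact hij ((degree_eq_of_coeff_ne_zero hf he).symm.trans (mem_formsS.1 hw e h))

theorem monomial_mem_formsR (e : Fin n →₀ ℕ) (c : k) : monomial e c ∈ formsR k n e.degree :=
  isHomogeneous_monomial c rfl

theorem single_mem_formsS (e : Fin n →₀ ℕ) (c : k) : Finsupp.single e c ∈ formsS k n e.degree := by
  classical
  refine mem_formsS.2 fun b hb => ?_
  rw [Finsupp.single_apply] at hb
  split_ifs at hb with h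
  · rw [h]
  · exact absurd rfl hb

theorem X_mem_formsR (i : Fin n) : (X i : MvPolynomial (Fin n) k) ∈ formsR k n 1 :=
  isHomogeneous_X k i

theorem contract_mem_formsS {i j : ℕ} {f : MvPolynomial (Fin n) k} {w : DP k n}
    (hf : f ∈ formsR k n i) (hw : w ∈ formsS k n (i + j)) : contract k n f w ∈ formsS k n j := by
  refine mem_formsS.2 fun b hb => ?_
  by_contra h
  refine hb ?_
  rw [contract_apply]
  exact pair_eq_zero_of_ne (i := i + b.degree) (by omega)
    (IsHomogeneous.mul hf (monomial_mem_formsR b 1)) hw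

theorem contract_X_mem_formsS {d : ℕ} (i : Fin n) {w : DP k n} (hw : w ∈ formsS k n (d + 1)) :
    contract k n (X i) w ∈ formsS k n d :=
  contract_mem_formsS (X_mem_formsR i) (by rwa [add_comm])

/-- In equal degrees the contraction is a scalar, sitting at the exponent 0. -/
theorem contract_eq_zero_iff {d : ℕ} {f : MvPolynomial (Fin n) k} {w : DP k n}
    (hf : f ∈ formsR k n d) (hw : w ∈ formsS k n d) :
    contract k n f w = 0 ↔ pair k n f w = 0 := by
  refine ⟨fun h => by rw [pair_def, h]; rfl, fun h => Finsupp.ext fun b => ?_⟩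
  by_cases hb : b = 0
  · subst hb
    exact h
  · rw [contract_apply]
    refine pair_eq_zero_of_ne (i := d + b.degree) ?_
      (IsHomogeneous.mul hf (monomial_mem_formsR b 1)) hw
    have : b.degree ≠ 0 := fun h => hb ((Finsupp.degree_eq_zero_iff b).1 h)
    omega

theorem eq_zero_of_pair_eq_zero {d : ℕ} {w : DP k n} (hw : w ∈ formsS k n d)
    (h : ∀ f ∈ formsR k n d, pair k n f w = 0) : w = 0 := by
  ext e
  by_contra he
  refine he ?_
  have := h (monomial e 1) (by rw [← mem_formsS.1 hw e he]; exact monomial_mem_formsR e 1)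
  rwa [pair_monomial, one_mul] at this

theorem eq_zero_of_pair_eq_zero' {d : ℕ} {f : MvPolynomial (Fin n) k} (hf : f ∈ formsR k n d)
    (h : ∀ w ∈ formsS k n d, pair k n f w = 0) : f = 0 := by
  ext e
  by_contra he
  refine he ?_
  have hd : e.degree = d := degree_eq_of_coeff_ne_zero hf he
  have := h (Finsupp.single e 1) (by rw [← hd]; exact single_mem_formsS e 1)
  rwa [pair_single] at this

/-- Functionals on `S_{-d}` are represented by forms of degree `d`. -/
theorem exists_form (d : ℕ) (φ : DP k n →ₗ[k] k) :
    ∃ f ∈ formsR k n d, ∀ w ∈ formsS k n d, pair k n f w = φ w := by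
  classical
  refine ⟨∑ e ∈ (Finsupp.finite_of_degree_eq (σ := Fin n) d).toFinset,
      monomial e (φ (Finsupp.single e 1)),
    Submodule.sum_mem _ fun e he => ?_, fun w hw => ?_⟩
  · rw [← show e.degree = d by simpa using he]
    exact monomial_mem_formsR e _
  · rw [map_sum, LinearMap.sum_apply]
    conv_rhs => rw [← Finsupp.sum_single w, Finsupp.sum, map_sum]
    symm
    refine Finset.sum_subset_zero_on_sdiff (fun e he => ?_) (fun e he => ?_) (fun e _ => ?_)
    · simpa using mem_formsS.1 hw e (by simpa using he)
    · rw [pair_monomial, show w e = 0 by simpa using (Finset.mem_sdiff.1 he).2, mul_zero]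
    · rw [pair_monomial, mul_comm, ← smul_eq_mul, ← map_smul, Finsupp.smul_single_one]

/-- Functionals on `R_d` are represented by elements of `S_{-d}`. -/
theorem exists_dual (d : ℕ) (ψ : MvPolynomial (Fin n) k →ₗ[k] k) :
    ∃ w ∈ formsS k n d, ∀ f ∈ formsR k n d, pair k n f w = ψ f := by
  classical
  refine ⟨∑ e ∈ (Finsupp.finite_of_degree_eq (σ := Fin n) d).toFinset,
      Finsupp.single e (ψ (monomial e 1)),
    Submodule.sum_mem _ fun e he => ?_, fun f hf => ?_⟩
  · rw [← show e.degree = d by simpa using he]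
    exact single_mem_formsS e _
  · rw [map_sum]
    conv_rhs => rw [f.as_sum, map_sum]
    symm
    refine Finset.sum_subset_zero_on_sdiff (fun e he => ?_) (fun e he => ?_) (fun e _ => ?_)
    · simpa using degree_eq_of_coeff_ne_zero hf (show coeff e f ≠ 0 by simpa using he)
    · rw [← Finsupp.smul_single_one, map_smul, pair_single,
        show coeff e f = 0 by simpa using (Finset.mem_sdiff.1 he).2, smul_zero]
    · rw [← Finsupp.smul_single_one, map_smul, pair_single, smul_eq_mul, mul_comm, ← smul_eq_mul,
        ← map_smul, smul_monomial, smul_eq_mul, mul_one]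

instance finite_formsR (d : ℕ) : Module.Finite k (formsR k n d) :=
  Module.Finite.of_fg (homogeneousSubmodule_fg (Fin n) k d)

instance finite_formsS (d : ℕ) : Module.Finite k (formsS k n d) := by
  have : Finite {e : Fin n →₀ ℕ | e.degree = d} :=
    (Finsupp.finite_of_degree_eq (σ := Fin n) d).to_subtype
  exact Module.Finite.equiv (Finsupp.supportedEquivFinsupp (M := k) (R := k) _).symm

/-- The forms of degree `d` that pair to zero with `Z`. -/
def annForms (d : ℕ) (Z : Submodule k (DP k n)) : Submodule k (MvPolynomial (Fin n) k) :=
  formsR k n d ⊓ ⨅ w ∈ Z, LinearMap.ker ((pair k n).flip w)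

theorem mem_annForms {d : ℕ} {Z : Submodule k (DP k n)} {f : MvPolynomial (Fin n) k} :
    f ∈ annForms d Z ↔ f ∈ formsR k n d ∧ ∀ w ∈ Z, pair k n f w = 0 := by
  simp [annForms]

/-- Every functional on `Z` extends to `S` and is then represented by a form, so the map from `R_d`
to the dual of `Z` is onto; its kernel is `annForms d Z`. -/
theorem finrank_annForms {d : ℕ} {Z : Submodule k (DP k n)} (hZ : Z ≤ formsS k n d) :
    Module.finrank k (annForms d Z) + Module.finrank k Z = Module.finrank k (formsR k n d) := by
  have : FiniteDimensional k Z := Submodule.finiteDimensional_of_le hZ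
  let L : formsR k n d →ₗ[k] Module.Dual k Z :=
    (LinearMap.lcomp k k Z.subtype).comp ((pair k n).domRestrict (formsR k n d))
  have hL : Function.Surjective L := by
    intro φ
    obtain ⟨φ', h'⟩ := LinearMap.exists_extend φ
    obtain ⟨f, hf, h⟩ := exists_form d φ'
    refine ⟨⟨f, hf⟩, LinearMap.ext fun w => ?_⟩
    rw [← h']
    exact h w (hZ w.2)
  have hker : (LinearMap.ker L).map (formsR k n d).subtype = annForms d Z := by
    ext f
    simp only [Submodule.mem_map, LinearMap.mem_ker, mem_annForms]
    constructor
    · rintro ⟨g, hg, rfl⟩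
      exact ⟨g.2, fun w hw => LinearMap.congr_fun hg ⟨w, hw⟩⟩
    · rintro ⟨hf, h⟩
      exact ⟨⟨f, hf⟩, LinearMap.ext fun w => h w w.2, rfl⟩
  rw [← hker, ← (Submodule.equivMapOfInjective _ (Submodule.subtype_injective _) _).finrank_eq,
    ← Subspace.dual_finrank_eq (K := k) (V := Z), ← LinearMap.finrank_range_add_finrank_ker L,
    LinearMap.range_eq_top.2 hL, finrank_top, add_comm]

/-- A form that is not in `D` is separated from `D` by an element of `S_{-d}`. -/
theorem exists_separating {d : ℕ} {D : Submodule k (MvPolynomial (Fin n) k)}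
    (hD : D ≤ formsR k n d) {f : MvPolynomial (Fin n) k} (hf : f ∈ formsR k n d) (hfD : f ∉ D) :
    ∃ w ∈ formsS k n d, (∀ g ∈ D, pair k n g w = 0) ∧ pair k n f w ≠ 0 := by
  obtain ⟨ψ, hψ, hψD⟩ := Submodule.exists_le_ker_of_notMem hfD
  obtain ⟨w, hw, h⟩ := exists_dual d ψ
  exact ⟨w, hw, fun g hg => by rw [h g (hD hg)]; exact hψD hg, by rwa [h f hf]⟩

theorem mem_of_annForms {d : ℕ} {Z : Submodule k (DP k n)} (hZ : Z ≤ formsS k n d) {w : DP k n}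
    (hw : w ∈ formsS k n d) (h : ∀ f ∈ annForms d Z, pair k n f w = 0) : w ∈ Z := by
  by_contra hwZ
  obtain ⟨φ, hφ, hφZ⟩ := Submodule.exists_le_ker_of_notMem hwZ
  obtain ⟨f, hf, hfφ⟩ := exists_form d φ
  refine hφ ?_
  rw [← hfφ w hw]
  exact h f (mem_annForms.2 ⟨hf, fun v hv => by rw [hfφ v (hZ hv)]; exact hφZ hv⟩)

end Pairing

/-! ### Membership in the ideal Ann(U^⊥ + S_{≥ -d+1}) -/

section Psi

variable {k : Type*} [Field k] {n : ℕ}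

theorem mem_annR_sup_lowS_iff {d : ℕ} {Z : Submodule k (DP k n)} (hZ : Z ≤ formsS k n d)
    {f : MvPolynomial (Fin n) k} :
    f ∈ annR (Z ⊔ lowS k n d) ↔
      (∀ e, e.degree < d → coeff e f = 0) ∧ ∀ w ∈ Z, pair k n f w = 0 := by
  constructor
  · refine fun h => ⟨fun e he => ?_, fun w hw => ?_⟩
    · rw [← pair_single, pair_def, h _ (Submodule.mem_sup_right (mem_lowS.2 fun b hb => ?_))]
      · rfl
      · rwa [mem_formsS.1 (single_mem_formsS e (1 : k)) b hb]
    · rw [pair_def, h _ (Submodule.mem_sup_left hw)]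
      rfl
  · rintro ⟨h₁, h₂⟩ g hg
    obtain ⟨w, hw, v, hv, rfl⟩ := Submodule.mem_sup.1 hg
    -- Since `f` starts in degree `d`, the monomials of `f * x^b` have degree at least `d + |b|`. So
    -- the contraction of `v` vanishes, and that of `w` can only have a coefficient at `b = 0`.
    have key : ∀ (b e : Fin n →₀ ℕ), coeff e (f * monomial b 1) ≠ 0 → d + b.degree ≤ e.degree := by
      intro b e he
      rw [coeff_mul_monomial'] at he
      split_ifs at he with hbe
      · have h3 : ¬ (e - b).degree < d := fun h => he (by rw [h₁ _ h, zero_mul])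
        have h4 : e.degree = (e - b).degree + b.degree := by
          rw [← map_add, tsub_add_cancel_of_le hbe]
        omega
      · exact absurd rfl he
    rw [map_add]
    convert add_zero (0 : DP k n)
    · ext b
      by_cases hb : b = 0
      · subst hb
        exact h₂ w hw
      · rw [contract_apply]
        refine pair_eq_zero fun e he => ?_
        by_contra hwe
        have h5 := mem_formsS.1 (hZ hw) e hwe
        have h6 := key b e he
        have : b.degree ≠ 0 := fun h => hb ((Finsupp.degree_eq_zero_iff b).1 h)
        omega
    · ext b
      rw [contract_apply]
      refine pair_eq_zero fun e he => ?_
      by_contra hwe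
      have h5 := mem_lowS.1 hv e hwe
      have h6 := key b e he
      omega

theorem perp_le (d : ℕ) (U : Submodule k (MvPolynomial (Fin n) k)) : perp d U ≤ formsS k n d :=
  inf_le_left.trans inf_le_left

theorem mem_psi_iff {d : ℕ} {U : Submodule k (MvPolynomial (Fin n) k)}
    {f : MvPolynomial (Fin n) k} :
    f ∈ psi d U ↔ (∀ e, e.degree < d → coeff e f = 0) ∧ ∀ w ∈ perp d U, pair k n f w = 0 :=
  mem_annR_sup_lowS_iff (perp_le d U)

end Psi

/-! ### Graded structure of the quotient, generation and maximal rank -/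

section Graded

variable {k : Type*} [Field k] {n : ℕ} {d : ℕ} {U : Submodule k (MvPolynomial (Fin n) k)}

theorem X_mul_mem_formsR {i : ℕ} (j : Fin n) {f : MvPolynomial (Fin n) k} (hf : f ∈ formsR k n i) :
    X j * f ∈ formsR k n (i + 1) := by
  rw [add_comm]
  exact IsHomogeneous.mul (isHomogeneous_X k j) hf

theorem homogeneousComponent_mem_psi {f : MvPolynomial (Fin n) k} (hf : f ∈ psi d U) (i : ℕ) :
    homogeneousComponent i f ∈ psi d U := by
  rw [mem_psi_iff] at hf ⊢
  refine ⟨fun e he => ?_, fun w hw => ?_⟩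
  · rw [coeff_homogeneousComponent, hf.1 e he, ite_self]
  · by_cases hid : i = d
    · subst hid
      rw [← hf.2 w hw, ← sub_eq_zero, ← LinearMap.sub_apply, ← map_sub]
      refine pair_eq_zero fun e he => ?_
      by_contra hwe
      refine he ?_
      rw [coeff_sub, coeff_homogeneousComponent, if_pos (mem_formsS.1 (perp_le _ U hw) e hwe),
        sub_self]
    · exact pair_eq_zero_of_ne hid (homogeneousComponent_mem i f) (perp_le d U hw)

theorem eq_zero_of_mem_psi {i : ℕ} (hi : i < d) {f : MvPolynomial (Fin n) k}
    (hf : f ∈ formsR k n i) (h : f ∈ psi d U) : f = 0 := by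
  ext e
  by_contra he
  exact he ((mem_psi_iff.1 h).1 e (by rwa [degree_eq_of_coeff_ne_zero hf he]))

theorem mem_psi_of_mem_formsR {f : MvPolynomial (Fin n) k} (hf : f ∈ formsR k n d) :
    f ∈ psi d U ↔ ∀ w ∈ perp d U, pair k n f w = 0 := by
  rw [mem_psi_iff, and_iff_right]
  intro e he
  by_contra h
  exact he.ne (degree_eq_of_coeff_ne_zero hf h)

theorem mem_psi_of_lt {i : ℕ} (hi : d < i) {f : MvPolynomial (Fin n) k} (hf : f ∈ formsR k n i) :
    f ∈ psi d U := by
  refine mem_psi_iff.2 ⟨fun e he => ?_, fun w hw =>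
    pair_eq_zero_of_ne hi.ne' hf (perp_le d U hw)⟩
  by_contra h
  exact (he.trans hi).ne (degree_eq_of_coeff_ne_zero hf h)

theorem idealPart_psi : idealPart (psi d U) d = annForms d (perp d U) := by
  ext f
  rw [idealPart, Submodule.mem_inf, mem_annForms, Submodule.restrictScalars_mem, and_comm]
  exact and_congr_right mem_psi_of_mem_formsR

theorem psi_le_pow : psi d U ≤ idealOfVars (Fin n) k ^ d := fun _ hf =>
  (mem_pow_idealOfVars_iff' d _).2 (mem_psi_iff.1 hf).1

theorem pow_succ_le_psi : idealOfVars (Fin n) k ^ (d + 1) ≤ psi d U := by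
  rw [pow_idealOfVars_eq_span, Ideal.span_le]
  rintro _ ⟨e, he, rfl⟩
  have he' : e.degree = d + 1 := he
  exact mem_psi_of_lt (by omega : d < e.degree) (monomial_mem_formsR e 1)

theorem psi_eq_pow (h : perp d U = ⊥) : psi d U = idealOfVars (Fin n) k ^ d := by
  refine psi_le_pow.antisymm fun f hf => ?_
  rw [mem_psi_iff, h]
  refine ⟨(mem_pow_idealOfVars_iff' d f).1 hf, fun w hw => ?_⟩
  rw [(Submodule.mem_bot k).1 hw, map_zero]

theorem isArtinianRing_quotient_psi : IsArtinianRing (MvPolynomial (Fin n) k ⧸ psi d U) := by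
  let L : (∀ i : Fin (d + 1), formsR k n i) →ₗ[k] MvPolynomial (Fin n) k ⧸ psi d U :=
    ((Ideal.Quotient.mkₐ k (psi d U)).toLinearMap).comp
      (∑ i : Fin (d + 1), (formsR k n (i : ℕ)).subtype.comp (LinearMap.proj i))
  have hL : Function.Surjective L := by
    intro a
    obtain ⟨f, rfl⟩ := Ideal.Quotient.mk_surjective a
    refine ⟨fun i => ⟨homogeneousComponent i f, homogeneousComponent_mem _ _⟩, ?_⟩
    refine (Ideal.Quotient.eq.2 ?_ :
      Ideal.Quotient.mk (psi d U) _ = Ideal.Quotient.mk (psi d U) _)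
    refine pow_succ_le_psi ((mem_pow_idealOfVars_iff' _ _).2 fun e he => ?_)
    rw [coeff_sub, sub_eq_zero, LinearMap.sum_apply, coeff_sum,
      Finset.sum_eq_single (⟨e.degree, he⟩ : Fin (d + 1))]
    · simp [coeff_homogeneousComponent]
    · intro i _ hi
      simp only [LinearMap.coe_comp, Function.comp_apply, LinearMap.proj_apply,
        Submodule.subtype_apply, coeff_homogeneousComponent]
      exact if_neg fun h => hi (Fin.ext h.symm)
    · simp
  have : Module.Finite k (MvPolynomial (Fin n) k ⧸ psi d U) := Module.Finite.of_surjective L hL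
  exact IsArtinianRing.of_finite k _

theorem quotPart_eq_bot {i : ℕ} (hi : d < i) : quotPart (psi d U) i = ⊥ := by
  refine eq_bot_iff.2 ?_
  rintro _ ⟨f, hf, rfl⟩
  exact (Submodule.mem_bot k).2 (Ideal.Quotient.eq_zero_iff_mem.2 (mem_psi_of_lt hi hf))

/-- The first hypothesis says by duality that `D` contains J_d. The second makes the ideal of `D`
everything in degree `d + 1`. Nothing of J lies below `d`, so no other generators are needed. -/
theorem psi_le_span {D : Submodule k (MvPolynomial (Fin n) k)} (hD : D ≤ formsR k n d)
    (h₁ : ∀ w ∈ formsS k n d, (∀ f ∈ D, pair k n f w = 0) → w ∈ perp d U)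
    (h₂ : ∀ F ∈ formsS k n (d + 1), (∀ i, contract k n (X i) F ∈ perp d U) → F = 0) :
    psi d U ≤ Ideal.span (D : Set (MvPolynomial (Fin n) k)) := by
  have hpow : idealOfVars (Fin n) k ^ (d + 1) ≤ Ideal.span (D : Set (MvPolynomial (Fin n) k)) := by
    rw [pow_idealOfVars_eq_span, Ideal.span_le]
    rintro _ ⟨e, he, rfl⟩
    have he' : e.degree = d + 1 := he
    have hm : monomial e (1 : k) ∈ formsR k n (d + 1) := by
      rw [← he']
      exact monomial_mem_formsR e 1
    by_contra hcon
    -- Orthogonality of `F` to the degree `d + 1` part of the ideal makes each `x_i ∘ F` orthogonal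
    -- to `D`.
    obtain ⟨F, hF, hFD, hFe⟩ := exists_separating
      (D := (Ideal.span (D : Set (MvPolynomial (Fin n) k))).restrictScalars k ⊓ formsR k n (d + 1))
      inf_le_right hm fun h => hcon h.1
    refine hFe ?_
    rw [h₂ F hF fun i => h₁ _ (contract_X_mem_formsS i hF) fun f hf => ?_, map_zero]
    rw [← pair_mul]
    exact hFD _ ⟨Ideal.mul_mem_left _ _ (Ideal.subset_span hf), X_mul_mem_formsR i (hD hf)⟩
  intro f hf
  rw [← sum_homogeneousComponent f]
  refine Ideal.sum_mem _ fun i _ => ?_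
  have hi := homogeneousComponent_mem_psi hf i
  rcases lt_trichotomy i d with h | rfl | h
  · rw [eq_zero_of_mem_psi h (homogeneousComponent_mem i f) hi]
    exact Ideal.zero_mem _
  · refine Ideal.subset_span ?_
    by_contra hcon
    obtain ⟨w, hw, hwD, hwf⟩ := exists_separating hD (homogeneousComponent_mem i f) hcon
    exact hwf ((mem_psi_iff.1 hi).2 w (h₁ w hw hwD))
  · refine hpow ((mem_pow_idealOfVars_iff' _ _).2 fun e he => ?_)
    rw [coeff_homogeneousComponent, if_neg (by omega)]

theorem psi_eq_span_idealPart
    (h₂ : ∀ F ∈ formsS k n (d + 1), (∀ i, contract k n (X i) F ∈ perp d U) → F = 0) :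
    psi d U = Ideal.span (idealPart (psi d U) d : Set (MvPolynomial (Fin n) k)) := by
  refine le_antisymm (psi_le_span inf_le_right (fun w hw h => ?_) h₂) (Ideal.span_le.2 inf_le_left)
  rw [idealPart_psi] at h
  exact mem_of_annForms (perp_le d U) hw h

/-- Below degree `d` the quotient agrees with the polynomial ring, a domain, and above `d` it
vanishes. The one critical map A_{d-1} → A_d is dual to contraction by `l` on U^⊥, so injectivity
there gives surjectivity. -/
theorem hasMaximalRank_psi {l : MvPolynomial (Fin n) k} (hl : l ∈ formsR k n 1) (hl0 : l ≠ 0)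
    (h : ∀ w ∈ perp d U, contract k n l w = 0 → w = 0) : HasMaximalRank (psi d U) l := by
  intro i
  rcases lt_trichotomy (i + 1) d with hi | rfl | hi
  · left
    rintro _ ⟨f, hf, rfl⟩ h0
    have h1 : Ideal.Quotient.mk (psi d U) (l * f) = 0 := h0
    have h2 := eq_zero_of_mem_psi (i := 1 + i) (by omega) (IsHomogeneous.mul hl hf)
      (Ideal.Quotient.eq_zero_iff_mem.1 h1)
    rw [(mul_eq_zero.1 h2).resolve_left hl0, map_zero]
  · right
    rintro _ ⟨g, hg, rfl⟩
    -- The degree `d` part of J + (l). An element orthogonal to both summands lies in U^⊥ and is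
    -- killed by `l`, so it is zero and `M` is all of R_d.
    let M : Submodule k (MvPolynomial (Fin n) k) :=
      annForms (i + 1) (perp (i + 1) U) ⊔ (formsR k n i).map (LinearMap.mulLeft k l)
    have hM : M ≤ formsR k n (i + 1) := by
      refine sup_le inf_le_left ?_
      rintro _ ⟨f, hf, rfl⟩
      rw [add_comm]
      exact IsHomogeneous.mul hl hf
    have hgM : g ∈ M := by
      by_contra hcon
      obtain ⟨w, hw, hwM, hwg⟩ := exists_separating hM hg hcon
      refine hwg ?_
      rw [h w (mem_of_annForms (perp_le _ U) hw fun f hf => hwM f (Submodule.mem_sup_left hf)),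
        map_zero]
      refine eq_zero_of_pair_eq_zero (contract_mem_formsS hl (by rwa [add_comm] at hw))
        fun f hf => ?_
      rw [← pair_mul]
      exact hwM _ (Submodule.mem_sup_right ⟨f, hf, rfl⟩)
    obtain ⟨a, ha, _, ⟨f, hf, rfl⟩, rfl⟩ := Submodule.mem_sup.1 hgM
    refine ⟨_, ⟨f, hf, rfl⟩, ?_⟩
    refine (Ideal.Quotient.eq.2 ?_ :
      Ideal.Quotient.mk (psi (i + 1) U) (l * f) = Ideal.Quotient.mk (psi (i + 1) U) _)
    rw [← idealPart_psi] at ha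
    simpa using (psi (i + 1) U).neg_mem ha.1
  · right
    intro b hb
    rw [quotPart_eq_bot hi, Submodule.mem_bot] at hb
    exact ⟨0, Submodule.zero_mem _, by rw [hb, mul_zero]⟩

theorem isInitialDegree_psi (hU : annForms d (perp d U) ≠ ⊥) : IsInitialDegree (psi d U) d := by
  refine ⟨by simpa [idealPart_psi] using hU, fun i hi => ?_⟩
  by_contra h
  refine hi (eq_bot_iff.2 fun f hf => ?_)
  exact eq_zero_of_mem_psi (not_le.1 h) hf.2 hf.1

/-! ### The socle in terms of U^⊥ -/

/-- Forms of degree `i` that represent socle elements of `R/I`. -/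
def socForms (I : Ideal (MvPolynomial (Fin n) k)) (i : ℕ) :
    Submodule k (MvPolynomial (Fin n) k) :=
  formsR k n i ⊓ ⨅ j : Fin n, (I.restrictScalars k).comap (LinearMap.mulLeft k (X j))

theorem mem_socForms {I : Ideal (MvPolynomial (Fin n) k)} {i : ℕ} {f : MvPolynomial (Fin n) k} :
    f ∈ socForms I i ↔ f ∈ formsR k n i ∧ ∀ j, X j * f ∈ I := by
  simp [socForms]

theorem soclePart_eq_map (I : Ideal (MvPolynomial (Fin n) k)) (i : ℕ) :
    soclePart I i = (socForms I i).map (Ideal.Quotient.mkₐ k I).toLinearMap := by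
  ext a
  simp only [soclePart, Submodule.mem_inf, Submodule.mem_iInf, LinearMap.mem_ker]
  constructor
  · rintro ⟨⟨f, hf, rfl⟩, h⟩
    exact ⟨f, mem_socForms.2 ⟨hf, fun j => Ideal.Quotient.eq_zero_iff_mem.1 (h j)⟩, rfl⟩
  · rintro ⟨f, hf, rfl⟩
    rw [SetLike.mem_coe, mem_socForms] at hf
    exact ⟨⟨f, hf.1, rfl⟩, fun j => Ideal.Quotient.eq_zero_iff_mem.2 (hf.2 j)⟩

theorem soclePart_of_lt {i : ℕ} (hi : d < i) : soclePart (psi d U) i = ⊥ := by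
  rw [soclePart, quotPart_eq_bot hi, bot_inf_eq]

theorem soclePart_of_succ_lt {i : ℕ} (hn : 0 < n) (hi : i + 1 < d) :
    soclePart (psi d U) i = ⊥ := by
  have h1 : socForms (psi d U) i = ⊥ := by
    refine (Submodule.eq_bot_iff _).2 fun f hf => ?_
    rw [mem_socForms] at hf
    have h := eq_zero_of_mem_psi hi (X_mul_mem_formsR ⟨0, hn⟩ hf.1) (hf.2 ⟨0, hn⟩)
    exact (mul_eq_zero.1 h).resolve_left (X_ne_zero _)
  rw [soclePart_eq_map, h1, Submodule.map_bot]

theorem finrank_map_add_finrank_inf_ker {E F : Type*} [AddCommGroup E] [Module k E]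
    [AddCommGroup F] [Module k F] (W : Submodule k E) [FiniteDimensional k W] (L : E →ₗ[k] F) :
    Module.finrank k (W.map L) + Module.finrank k (W ⊓ LinearMap.ker L : Submodule k E) =
      Module.finrank k W := by
  rw [← LinearMap.finrank_range_add_finrank_ker (L.domRestrict W), LinearMap.range_domRestrict,
    (Submodule.equivMapOfInjective _ W.subtype_injective (L.domRestrict W).ker).finrank_eq]
  have h : (L.domRestrict W).ker.map W.subtype = W ⊓ LinearMap.ker L := by
    rw [LinearMap.ker_domRestrict, Submodule.map_comap_subtype]
  rw [h]

/-- All of A_d is socle because J contains R_{d+1}, and A_d is dual to U^⊥. -/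
theorem finrank_soclePart_self :
    Module.finrank k (soclePart (psi d U) d) = Module.finrank k (perp d U) := by
  have h1 : socForms (psi d U) d = formsR k n d := by
    refine le_antisymm inf_le_left fun f hf => mem_socForms.2 ⟨hf, fun j => ?_⟩
    exact mem_psi_of_lt (Nat.lt_succ_self d) (X_mul_mem_formsR j hf)
  have h2 : socForms (psi d U) d ⊓ LinearMap.ker (Ideal.Quotient.mkₐ k (psi d U)).toLinearMap =
      annForms d (perp d U) := by
    rw [← idealPart_psi, h1, inf_comm]
    ext f
    exact and_congr_left fun _ => Ideal.Quotient.eq_zero_iff_mem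
  have h3 := finrank_annForms (perp_le d U)
  have h4 := finrank_map_add_finrank_inf_ker (formsR k n d)
    (Ideal.Quotient.mkₐ k (psi d U)).toLinearMap
  rw [soclePart_eq_map, h1]
  rw [h1] at h2
  rw [h2] at h4
  omega

/-- `R_1 ∘ Z`. -/
def derivs (Z : Submodule k (DP k n)) : Submodule k (DP k n) :=
  ⨆ j : Fin n, Z.map (contract k n (X j))

theorem derivs_le {i : ℕ} {Z : Submodule k (DP k n)} (hZ : Z ≤ formsS k n (i + 1)) :
    derivs Z ≤ formsS k n i := by
  refine iSup_le fun j => ?_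
  rintro _ ⟨w, hw, rfl⟩
  exact contract_X_mem_formsS j (hZ hw)

/-- The condition `x_j f ∈ J` for all `j` says that `f` is orthogonal to every `x_j ∘ w` with `w` in
U^⊥. In degree `d - 1` the ideal is zero, so passing to the quotient loses nothing. -/
theorem finrank_soclePart_pred {i : ℕ} (hi : i + 1 = d) :
    Module.finrank k (soclePart (psi d U) i) + Module.finrank k (derivs (perp d U)) =
      Module.finrank k (formsR k n i) := by
  subst hi
  have h1 : socForms (psi (i + 1) U) i = annForms i (derivs (perp (i + 1) U)) := by
    ext f
    rw [mem_socForms, mem_annForms]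
    refine and_congr_right fun hf => ?_
    have h : ∀ j, X j * f ∈ psi (i + 1) U ↔
        ∀ w ∈ perp (i + 1) U, pair k n f (contract k n (X j) w) = 0 := fun j => by
      rw [mem_psi_of_mem_formsR (X_mul_mem_formsR j hf)]
      simp_rw [pair_mul]
    simp_rw [h]
    constructor
    · intro h w hw
      have : derivs (perp (i + 1) U) ≤ LinearMap.ker (pair k n f) := by
        refine iSup_le fun j => ?_
        rintro _ ⟨w, hw, rfl⟩
        exact h j w hw
      exact this hw
    · exact fun h j w hw => h _ (Submodule.mem_iSup_of_mem j ⟨w, hw, rfl⟩)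
  rw [← finrank_annForms (derivs_le (perp_le _ U)), soclePart_eq_map, h1]
  congr 1
  let L := (Ideal.Quotient.mkₐ k (psi (i + 1) U)).toLinearMap.domRestrict
    (annForms i (derivs (perp (i + 1) U)))
  have hL : Function.Injective L := by
    rw [← LinearMap.ker_eq_bot, eq_bot_iff]
    intro f hf
    exact Subtype.ext (eq_zero_of_mem_psi (Nat.lt_succ_self i) (mem_annForms.1 f.2).1
      (Ideal.Quotient.eq_zero_iff_mem.1 hf))
  rw [← LinearMap.finrank_range_of_inj hL, LinearMap.range_domRestrict]

end Graded

/-! ### Symmetric group actions and the pairing on invariants -/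

section Symmetric

variable {k : Type*} [Field k] {n : ℕ}

/-- The action of a permutation of the variables on `S`. -/
def permS (k : Type*) [Field k] {n : ℕ} (σ : Equiv.Perm (Fin n)) : DP k n →ₗ[k] DP k n :=
  Finsupp.lmapDomain k k (Finsupp.mapDomain (M := ℕ) σ)

theorem mapDomain_perm_injective (σ : Equiv.Perm (Fin n)) :
    Function.Injective (Finsupp.mapDomain (M := ℕ) σ) :=
  Finsupp.mapDomain_injective σ.injective

theorem permS_mapDomain_apply (σ : Equiv.Perm (Fin n)) (w : DP k n) (e : Fin n →₀ ℕ) :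
    permS k σ w (Finsupp.mapDomain σ e) = w e :=
  Finsupp.mapDomain_apply (mapDomain_perm_injective σ) w e

theorem mapDomain_symm_mapDomain (σ : Equiv.Perm (Fin n)) (e : Fin n →₀ ℕ) :
    Finsupp.mapDomain σ (Finsupp.mapDomain σ.symm e) = e := by
  ext i
  rw [Finsupp.mapDomain_equiv_apply, Finsupp.mapDomain_equiv_apply]
  simp

theorem pair_rename (σ : Equiv.Perm (Fin n)) (f : MvPolynomial (Fin n) k) (w : DP k n) :
    pair k n (rename σ f) (permS k σ w) = pair k n f w := by
  induction f using MvPolynomial.induction_on' with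
  | monomial a c => rw [rename_monomial, pair_monomial, pair_monomial, permS_mapDomain_apply]
  | add p q hp hq => simp [hp, hq]

theorem contract_rename (σ : Equiv.Perm (Fin n)) (f : MvPolynomial (Fin n) k) (w : DP k n) :
    contract k n (rename σ f) (permS k σ w) = permS k σ (contract k n f w) := by
  ext b
  rw [← mapDomain_symm_mapDomain σ b, permS_mapDomain_apply, contract_apply, contract_apply,
    ← pair_rename σ (f * _), map_mul (rename σ), rename_monomial]

theorem mem_invS {d : ℕ} {w : DP k n} :
    w ∈ invS k n d ↔ w ∈ formsS k n d ∧ ∀ σ : Equiv.Perm (Fin n), permS k σ w = w := by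
  simp [invS, permS]

theorem mem_invR {d : ℕ} {f : MvPolynomial (Fin n) k} :
    f ∈ invR k n d ↔ f ∈ formsR k n d ∧ ∀ σ : Equiv.Perm (Fin n), rename σ f = f := by
  rw [invR, Submodule.mem_inf, and_comm]
  rfl

theorem invS_le (d : ℕ) : invS k n d ≤ formsS k n d := inf_le_left

theorem invR_le (d : ℕ) : invR k n d ≤ formsR k n d := inf_le_right

instance finite_invS (d : ℕ) : Module.Finite k (invS k n d) :=
  Submodule.finiteDimensional_of_le (invS_le d)

instance finite_invR (d : ℕ) : Module.Finite k (invR k n d) :=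
  Submodule.finiteDimensional_of_le (invR_le d)

theorem permS_mem_formsS {d : ℕ} (σ : Equiv.Perm (Fin n)) {w : DP k n} (hw : w ∈ formsS k n d) :
    permS k σ w ∈ formsS k n d := by
  refine mem_formsS.2 fun e he => ?_
  rw [← mapDomain_symm_mapDomain σ e, permS_mapDomain_apply] at he
  rw [← mem_formsS.1 hw _ he, Finsupp.degree_mapDomain]

theorem rename_mem_formsR {d : ℕ} (σ : Equiv.Perm (Fin n)) {f : MvPolynomial (Fin n) k}
    (hf : f ∈ formsR k n d) : rename σ f ∈ formsR k n d :=
  IsHomogeneous.rename_isHomogeneous hf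

theorem rename_rename_perm (σ τ : Equiv.Perm (Fin n)) (f : MvPolynomial (Fin n) k) :
    rename σ (rename τ f) = rename (σ * τ : Equiv.Perm (Fin n)) f := by
  rw [rename_rename]
  rfl

theorem permS_permS (σ τ : Equiv.Perm (Fin n)) (w : DP k n) :
    permS k σ (permS k τ w) = permS k (σ * τ) w := by
  ext e
  rw [← mapDomain_symm_mapDomain σ e, permS_mapDomain_apply,
    ← mapDomain_symm_mapDomain τ (Finsupp.mapDomain σ.symm e), permS_mapDomain_apply,
    ← Finsupp.mapDomain_comp (f := τ) (g := σ), ← Equiv.Perm.coe_mul, permS_mapDomain_apply]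

theorem reynolds_apply (f : MvPolynomial (Fin n) k) :
    reynolds k n f = (n.factorial : k)⁻¹ • ∑ σ : Equiv.Perm (Fin n), rename σ f := by
  simp [reynolds]

/-- The Reynolds operator on `S`. -/
def reynoldsS (k : Type*) [Field k] (n : ℕ) : DP k n →ₗ[k] DP k n :=
  ((n.factorial : k)⁻¹) • ∑ σ : Equiv.Perm (Fin n), permS k σ

theorem reynoldsS_apply (w : DP k n) :
    reynoldsS k n w = (n.factorial : k)⁻¹ • ∑ σ : Equiv.Perm (Fin n), permS k σ w := by
  simp [reynoldsS]

theorem reynolds_mem {d : ℕ} {f : MvPolynomial (Fin n) k} (hf : f ∈ formsR k n d) :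
    reynolds k n f ∈ invR k n d := by
  rw [reynolds_apply]
  refine mem_invR.2 ⟨Submodule.smul_mem _ _ (Submodule.sum_mem _ fun σ _ =>
    rename_mem_formsR σ hf), fun τ => ?_⟩
  rw [map_smul, map_sum]
  simp_rw [rename_rename_perm]
  congr 1
  exact Fintype.sum_equiv (Equiv.mulLeft τ) _ _ fun σ => rfl

theorem reynoldsS_mem {d : ℕ} {w : DP k n} (hw : w ∈ formsS k n d) :
    reynoldsS k n w ∈ invS k n d := by
  rw [reynoldsS_apply]
  refine mem_invS.2 ⟨Submodule.smul_mem _ _ (Submodule.sum_mem _ fun σ _ =>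
    permS_mem_formsS σ hw), fun τ => ?_⟩
  rw [map_smul, map_sum]
  simp_rw [permS_permS]
  congr 1
  exact Fintype.sum_equiv (Equiv.mulLeft τ) _ _ fun σ => rfl

theorem average_const (hF : (n.factorial : k) ≠ 0) (c : k) :
    (n.factorial : k)⁻¹ • ∑ _σ : Equiv.Perm (Fin n), c = c := by
  rw [Finset.sum_const, Finset.card_univ, Fintype.card_perm, Fintype.card_fin, nsmul_eq_mul,
    smul_eq_mul, inv_mul_cancel_left₀ hF]

theorem pair_rename_left {d : ℕ} (σ : Equiv.Perm (Fin n)) (f : MvPolynomial (Fin n) k) {w : DP k n}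
    (hw : w ∈ invS k n d) : pair k n (rename σ f) w = pair k n f w := by
  rw [← pair_rename σ f w, (mem_invS.1 hw).2 σ]

theorem pair_reynolds {d : ℕ} (hF : (n.factorial : k) ≠ 0) (f : MvPolynomial (Fin n) k) {w : DP k n}
    (hw : w ∈ invS k n d) : pair k n (reynolds k n f) w = pair k n f w := by
  rw [reynolds_apply, map_smul, LinearMap.smul_apply, map_sum, LinearMap.sum_apply]
  simp_rw [pair_rename_left _ f hw]
  exact average_const hF _

theorem pair_reynoldsS {d : ℕ} (hF : (n.factorial : k) ≠ 0) {f : MvPolynomial (Fin n) k}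
    (hf : f ∈ invR k n d) (w : DP k n) : pair k n f (reynoldsS k n w) = pair k n f w := by
  have h : ∀ σ : Equiv.Perm (Fin n), pair k n f (permS k σ w) = pair k n f w := fun σ => by
    rw [← pair_rename σ f w, (mem_invR.1 hf).2 σ]
  rw [reynoldsS_apply, map_smul, map_sum]
  simp_rw [h]
  exact average_const hF _

/-- Averaging a representing form does not change its values on invariants. Together with
`exists_invDual` this makes the pairing perfect on invariants; the average requires `n!` to be
invertible. -/
theorem exists_invForm (hF : (n.factorial : k) ≠ 0) (d : ℕ) (φ : DP k n →ₗ[k] k) :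
    ∃ f ∈ invR k n d, ∀ w ∈ invS k n d, pair k n f w = φ w := by
  obtain ⟨f, hf, h⟩ := exists_form d φ
  exact ⟨_, reynolds_mem hf, fun w hw => by rw [pair_reynolds hF f hw, h w (invS_le d hw)]⟩

theorem exists_invDual (hF : (n.factorial : k) ≠ 0) (d : ℕ) (ψ : MvPolynomial (Fin n) k →ₗ[k] k) :
    ∃ w ∈ invS k n d, ∀ f ∈ invR k n d, pair k n f w = ψ f := by
  obtain ⟨w, hw, h⟩ := exists_dual d ψ
  exact ⟨_, reynoldsS_mem hw, fun f hf => by rw [pair_reynoldsS hF hf, h f (invR_le d hf)]⟩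

theorem eq_zero_of_pair_invS (hF : (n.factorial : k) ≠ 0) {d : ℕ} {f : MvPolynomial (Fin n) k}
    (hf : f ∈ invR k n d) (h : ∀ w ∈ invS k n d, pair k n f w = 0) : f = 0 := by
  refine eq_zero_of_pair_eq_zero' (invR_le d hf) fun w hw => ?_
  rw [← pair_reynoldsS hF hf, h _ (reynoldsS_mem hw)]

theorem mem_perp {d : ℕ} {U : Submodule k (MvPolynomial (Fin n) k)} (hU : U ≤ formsR k n d)
    {w : DP k n} : w ∈ perp d U ↔ w ∈ invS k n d ∧ ∀ u ∈ U, pair k n u w = 0 := by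
  simp only [perp, Submodule.mem_inf, Submodule.mem_iInf, LinearMap.mem_ker]
  exact and_congr_right fun hw => forall₂_congr fun u hu =>
    contract_eq_zero_iff (hU hu) (invS_le d hw)

theorem perp_le_invS (d : ℕ) (U : Submodule k (MvPolynomial (Fin n) k)) : perp d U ≤ invS k n d :=
  inf_le_left

instance finite_perp (d : ℕ) (U : Submodule k (MvPolynomial (Fin n) k)) :
    Module.Finite k (perp d U) :=
  Submodule.finiteDimensional_of_le (perp_le_invS d U)

/-- The restriction `S → U*` of the contraction pairing. -/
def pairOn (U : Submodule k (MvPolynomial (Fin n) k)) : DP k n →ₗ[k] Module.Dual k U :=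
  (LinearMap.lcomp k k U.subtype).comp (pair k n).flip

theorem pairOn_apply (U : Submodule k (MvPolynomial (Fin n) k)) (w : DP k n) (u : U) :
    pairOn U w u = pair k n u w := rfl

theorem mem_ker_pairOn {U : Submodule k (MvPolynomial (Fin n) k)} {w : DP k n} :
    w ∈ LinearMap.ker (pairOn U) ↔ ∀ u ∈ U, pair k n u w = 0 :=
  ⟨fun h u hu => LinearMap.congr_fun h ⟨u, hu⟩, fun h => LinearMap.ext fun u => h u u.2⟩

theorem perp_eq {d : ℕ} {U : Submodule k (MvPolynomial (Fin n) k)} (hU : U ≤ formsR k n d) :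
    perp d U = invS k n d ⊓ LinearMap.ker (pairOn U) := by
  ext w
  rw [mem_perp hU, Submodule.mem_inf, mem_ker_pairOn]

theorem finrank_perp (hF : (n.factorial : k) ≠ 0) {d : ℕ}
    {U : Submodule k (MvPolynomial (Fin n) k)} (hU : U ≤ invR k n d) :
    Module.finrank k U + Module.finrank k (perp d U) = Module.finrank k (invS k n d) := by
  have : FiniteDimensional k U := Submodule.finiteDimensional_of_le hU
  rw [perp_eq (hU.trans (invR_le d)), ← finrank_map_add_finrank_inf_ker (invS k n d) (pairOn U)]
  have : (invS k n d).map (pairOn U) = ⊤ := by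
    refine eq_top_iff.2 fun φ _ => ?_
    obtain ⟨ψ, rfl⟩ := LinearMap.exists_extend φ
    obtain ⟨w, hw, h⟩ := exists_invDual hF d ψ
    exact ⟨w, hw, LinearMap.ext fun u => h u (hU u.2)⟩
  rw [this, finrank_top, Subspace.dual_finrank_eq]

/-! ### Linear syzygies on invariant elements -/

/-- The sum of the variables. -/
def sumX (k : Type*) [Field k] (n : ℕ) : MvPolynomial (Fin n) k := ∑ i, X i

theorem sumX_mem_formsR : sumX k n ∈ formsR k n 1 :=
  Submodule.sum_mem _ fun i _ => X_mem_formsR i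

theorem rename_sumX (σ : Equiv.Perm (Fin n)) : rename σ (sumX k n) = sumX k n := by
  simp only [sumX, map_sum, rename_X]
  exact Fintype.sum_equiv σ _ _ fun i => rfl

theorem sumX_ne_zero (hn : 0 < n) : sumX k n ≠ 0 := by
  classical
  intro h
  have h1 := congrArg (coeff (Finsupp.single ⟨0, hn⟩ 1)) h
  simp [sumX, coeff_sum, coeff_X, Finsupp.single_left_inj] at h1

/-- The invariants of degree `-d` killed by the sum of the variables. -/
def kerSum (k : Type*) [Field k] (n d : ℕ) : Submodule k (DP k n) :=
  invS k n d ⊓ LinearMap.ker (contract k n (sumX k n))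

/-- Contraction by the sum of the variables maps invariants onto invariants of one degree less,
being dual to multiplication by that sum on invariant forms, which is injective in a domain. -/
theorem finrank_kerSum (hF : (n.factorial : k) ≠ 0) (hn : 0 < n) (d : ℕ) :
    Module.finrank k (invS k n d) + Module.finrank k (kerSum k n (d + 1)) =
      Module.finrank k (invS k n (d + 1)) := by
  rw [kerSum, ← finrank_map_add_finrank_inf_ker (invS k n (d + 1)) (contract k n (sumX k n))]
  suffices h : (invS k n (d + 1)).map (contract k n (sumX k n)) = invS k n d by rw [h]
  have hmem : ∀ w ∈ invS k n (d + 1), contract k n (sumX k n) w ∈ invS k n d := fun w hw => by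
    rw [mem_invS] at hw
    refine mem_invS.2 ⟨contract_mem_formsS sumX_mem_formsR (by rw [add_comm]; exact hw.1),
      fun σ => ?_⟩
    rw [← contract_rename, rename_sumX, hw.2]
  refine le_antisymm ?_ fun v hv => ?_
  · rintro _ ⟨w, hw, rfl⟩
    exact hmem w hw
  · by_contra hcon
    obtain ⟨φ, hφ, hφM⟩ := Submodule.exists_le_ker_of_notMem hcon
    obtain ⟨f, hf, h⟩ := exists_invForm hF d φ
    -- `f` represents a functional that vanishes on the image, so `sumX * f` is orthogonal to all
    -- invariants of degree `-(d+1)`.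
    have h0 : sumX k n * f = 0 := by
      refine eq_zero_of_pair_invS hF (d := d + 1) (mem_invR.2 ⟨?_, fun σ => ?_⟩) fun w hw => ?_
      · rw [add_comm]
        exact IsHomogeneous.mul sumX_mem_formsR (invR_le d hf)
      · rw [map_mul, rename_sumX, (mem_invR.1 hf).2]
      · rw [pair_mul, h _ (hmem w hw)]
        exact hφM ⟨w, hw, rfl⟩
    rw [(mul_eq_zero.1 h0).resolve_left (sumX_ne_zero hn)] at h
    exact hφ (by rw [← h v hv, map_zero, LinearMap.zero_apply])

/-- The sum of all monomials of degree `-d`. -/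
def allOnes (k : Type*) [Field k] (n d : ℕ) : DP k n :=
  ∑ e ∈ (Finsupp.finite_of_degree_eq (σ := Fin n) d).toFinset, Finsupp.single e 1

theorem allOnes_apply (d : ℕ) (e : Fin n →₀ ℕ) :
    allOnes k n d e = if e.degree = d then 1 else 0 := by
  classical
  rw [allOnes, Finsupp.finsetSum_apply]
  simp [Finsupp.single_apply]

theorem allOnes_mem_invS (d : ℕ) : allOnes k n d ∈ invS k n d := by
  refine mem_invS.2 ⟨mem_formsS.2 fun e he => ?_, fun σ => ?_⟩
  · rw [allOnes_apply] at he
    by_contra h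
    exact he (if_neg h)
  · ext e
    rw [← mapDomain_symm_mapDomain σ e, permS_mapDomain_apply, allOnes_apply, allOnes_apply,
      Finsupp.degree_mapDomain σ]

/-- By symmetry one equality between derivatives gives all of them. Units of exponent can then be
shifted freely between variables, so all coefficients equal that of a pure power. -/
theorem eq_smul_allOnes {d : ℕ} {w : DP k n} (hw : w ∈ invS k n (d + 1)) {i j : Fin n}
    (hij : i ≠ j) (h : contract k n (X i) w = contract k n (X j) w) :
    ∃ c : k, w = c • allOnes k n (d + 1) := by
  have h1 : ∀ l, contract k n (X l) w = contract k n (X i) w := by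
    intro l
    by_cases hl : l = i
    · rw [hl]
    · have h2 := congrArg (permS k (Equiv.swap j l)) h
      rw [← contract_rename, ← contract_rename, rename_X, rename_X, (mem_invS.1 hw).2,
        Equiv.swap_apply_of_ne_of_ne hij (Ne.symm hl), Equiv.swap_apply_left] at h2
      exact h2.symm
  -- Induction on the degree `m` of `b`: one unit is moved from some `x_l` in `b` to `x_i` at each
  -- step.
  have h2 : ∀ (m t : ℕ) (b : Fin n →₀ ℕ), b.degree = m →
      w (Finsupp.single i t + b) = w (Finsupp.single i (t + m)) := by
    intro m
    induction m with
    | zero =>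
      intro t b hb
      rw [(Finsupp.degree_eq_zero_iff b).1 hb, add_zero, add_zero]
    | succ m ih =>
      intro t b hb
      have hb0 : b ≠ 0 := by
        rintro rfl
        simp at hb
      obtain ⟨l, hl⟩ := Finsupp.ne_iff.1 hb0
      have hb' : b = Finsupp.single l 1 + (b - Finsupp.single l 1) := by
        rw [add_tsub_cancel_of_le]
        exact Finsupp.single_le_iff.2 (Nat.one_le_iff_ne_zero.2 hl)
      have hdeg : (b - Finsupp.single l 1).degree = m := by
        have := congrArg Finsupp.degree hb'
        rw [map_add, Finsupp.degree_single] at this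
        omega
      rw [hb', add_left_comm, ← contract_X_apply, h1, contract_X_apply, ← add_assoc,
        ← Finsupp.single_add, ih _ _ hdeg]
      congr 2
      omega
  refine ⟨w (Finsupp.single i (d + 1)), Finsupp.ext fun e => ?_⟩
  rw [Finsupp.smul_apply, allOnes_apply]
  split_ifs with he
  · have := h2 _ 0 e he
    rw [Finsupp.single_zero, zero_add, zero_add] at this
    rw [this, smul_eq_mul, mul_one]
  · rw [smul_zero]
    by_contra hne
    exact he (mem_formsS.1 (invS_le _ hw) e hne)

/-- A syzygy of linear forms on a space of invariants without `allOnes` is constant. -/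
theorem syzygy_const {d : ℕ} {Z : Submodule k (DP k n)} (hZ : Z ≤ invS k n (d + 1))
    (hones : allOnes k n (d + 1) ∉ Z) {v : Fin n → DP k n} (hv : ∀ i, v i ∈ Z)
    (h : ∑ i, contract k n (X i) (v i) = 0) (i j : Fin n) : v i = v j := by
  by_cases hij : i = j
  · rw [hij]
  -- The transposition fixes each `v m` and permutes the `x_m`, which amounts to exchanging `v i`
  -- and `v j` in the syzygy.
  have h1 : ∑ m, contract k n (X m) (v (Equiv.swap i j m)) = 0 := by
    have h2 := congrArg (permS k (Equiv.swap i j)) h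
    rw [map_sum, map_zero] at h2
    rw [← h2]
    refine (Fintype.sum_equiv (Equiv.swap i j) _ _ fun m => ?_).symm
    rw [← contract_rename, rename_X, (mem_invS.1 (hZ (hv m))).2, Equiv.swap_apply_self]
  have h3 : ∑ m, contract k n (X m) (v m - v (Equiv.swap i j m)) = 0 := by
    simp_rw [map_sub]
    rw [Finset.sum_sub_distrib, h, h1, sub_zero]
  -- Only the terms at `i` and `j` survive, and they say that `x_i - x_j` kills `v i - v j`.
  rw [Fintype.sum_eq_add i j hij] at h3
  · rw [Equiv.swap_apply_left, Equiv.swap_apply_right, ← neg_sub (v i) (v j), map_neg,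
      add_neg_eq_zero] at h3
    have hmem : v i - v j ∈ Z := Z.sub_mem (hv i) (hv j)
    obtain ⟨c, hc⟩ := eq_smul_allOnes (hZ hmem) hij h3
    by_cases hc0 : c = 0
    · rw [hc0, zero_smul] at hc
      exact sub_eq_zero.1 hc
    · refine absurd ?_ hones
      rw [hc] at hmem
      exact (Z.smul_mem_iff hc0).1 hmem
  · rintro m ⟨hmi, hmj⟩
    rw [Equiv.swap_apply_of_ne_of_ne hmi hmj, sub_self, map_zero]

theorem exists_sum_smul_X {l : MvPolynomial (Fin n) k} (hl : l ∈ formsR k n 1) :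
    ∃ c : Fin n → k, ∑ i, c i • X i = l := by
  rw [formsR, homogeneousSubmodule_one_eq_span_X] at hl
  exact (Submodule.mem_span_range_iff_exists_fun k).1 hl

theorem contract_sum_smul_X (c : Fin n → k) (w : DP k n) :
    contract k n (∑ i, c i • X i) w = ∑ i, contract k n (X i) (c i • w) := by
  simp [map_sum, LinearMap.sum_apply]

/-- A kernel made of constant tuples is identified, by taking one entry, with the `w` whose constant
tuple is killed; rank-nullity does the rest. The injection `φ` lets the equality of entries be
checked in an ambient space. -/
theorem finrank_range_of_ker_diagonal {M E : Type*} [AddCommGroup M] [Module k M]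
    [FiniteDimensional k M] [AddCommGroup E] [Module k E] (L : (Fin n → M) →ₗ[k] E) (i₀ : Fin n)
    {φ : M → E} (hφ : Function.Injective φ) (h : ∀ v, L v = 0 → ∀ i j, φ (v i) = φ (v j))
    (K : Submodule k M) (hK : ∀ w, w ∈ K ↔ L (fun _ => w) = 0) :
    Module.finrank k (LinearMap.range L) + Module.finrank k K = n * Module.finrank k M := by
  have hconst : ∀ v, L v = 0 → v = fun _ => v i₀ := fun v hv => funext fun i => hφ (h v hv i i₀)
  let D : LinearMap.ker L →ₗ[k] M := (LinearMap.proj i₀).comp (LinearMap.ker L).subtype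
  have hD : Function.Injective D := by
    intro v w hvw
    refine Subtype.ext ?_
    rw [hconst v v.2, hconst w w.2]
    exact funext fun _ => hvw
  have hrange : LinearMap.range D = K := by
    ext w
    rw [hK]
    constructor
    · rintro ⟨v, rfl⟩
      have := v.2
      rw [LinearMap.mem_ker, hconst v v.2] at this
      exact this
    · exact fun hw => ⟨⟨fun _ => w, hw⟩, rfl⟩
  rw [← hrange, LinearMap.finrank_range_of_inj hD, LinearMap.finrank_range_add_finrank_ker,
    Module.finrank_pi_fintype, Finset.sum_const, Finset.card_univ, Fintype.card_fin, smul_eq_mul]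

/-- R_1∘Z is the image of `Z^n` under `v ↦ ∑ x_i ∘ v_i`. By `syzygy_const` the kernel consists of
constant tuples, with entry killed by the sum of the variables. -/
theorem finrank_derivs {d : ℕ} (hn : 0 < n) {Z : Submodule k (DP k n)} (hZ : Z ≤ invS k n (d + 1))
    (hones : allOnes k n (d + 1) ∉ Z) :
    Module.finrank k (derivs Z) +
      Module.finrank k (Z ⊓ LinearMap.ker (contract k n (sumX k n)) : Submodule k (DP k n)) =
      n * Module.finrank k Z := by
  have : FiniteDimensional k Z := Submodule.finiteDimensional_of_le hZ
  let L : (Fin n → Z) →ₗ[k] DP k n :=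
    ∑ i, ((contract k n (X i)).comp Z.subtype).comp (LinearMap.proj i)
  have hL : ∀ v, L v = ∑ i, contract k n (X i) (v i : DP k n) := fun v => by
    simp [L, LinearMap.sum_apply]
  have hrange : LinearMap.range L = derivs Z := by
    refine le_antisymm ?_ (iSup_le fun i => ?_)
    · rintro _ ⟨v, rfl⟩
      rw [hL]
      exact Submodule.sum_mem _ fun i _ => Submodule.mem_iSup_of_mem i ⟨_, (v i).2, rfl⟩
    · classical
      rintro _ ⟨w, hw, rfl⟩
      refine ⟨Pi.single i ⟨w, hw⟩, ?_⟩
      rw [hL, Finset.sum_eq_single i]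
      · rw [Pi.single_eq_same]
      · intro j _ hj
        rw [Pi.single_eq_of_ne hj, Submodule.coe_zero, map_zero]
      · simp
  have h1 := finrank_range_of_ker_diagonal L ⟨0, hn⟩ Z.subtype_injective
    (fun v hv => syzygy_const hZ hones (fun i => (v i).2) ((hL v).symm.trans hv))
    ((LinearMap.ker (contract k n (sumX k n))).comap Z.subtype) fun w => by
      rw [hL, Submodule.mem_comap, LinearMap.mem_ker, sumX, map_sum, LinearMap.sum_apply]
      rfl
  rw [hrange, (Submodule.equivMapOfInjective _ Z.subtype_injective _).finrank_eq,
    Submodule.map_comap_subtype] at h1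
  exact h1

/-- With `l = ∑ c_i x_i`, the relation is a syzygy with entries `c_i w`. These are all equal, so
either `w = 0` or all `c_i` agree. -/
theorem eq_zero_of_contract_linear {d : ℕ} {Z : Submodule k (DP k n)} (hZ : Z ≤ invS k n (d + 1))
    (hones : allOnes k n (d + 1) ∉ Z) {l : MvPolynomial (Fin n) k} (hl : l ∈ formsR k n 1)
    (hl' : ∀ c : k, l ≠ c • sumX k n) {w : DP k n} (hw : w ∈ Z) (h : contract k n l w = 0) :
    w = 0 := by
  obtain ⟨c, rfl⟩ := exists_sum_smul_X hl
  rw [contract_sum_smul_X] at h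
  have h1 := syzygy_const hZ hones (fun i => Z.smul_mem (c i) hw) h
  by_contra hw0
  rcases Nat.eq_zero_or_pos n with rfl | hn
  · exact hl' 0 (by simp)
  · refine hl' (c ⟨0, hn⟩) ?_
    rw [sumX, Finset.smul_sum]
    exact Finset.sum_congr rfl fun i _ => by rw [smul_left_injective k hw0 (h1 i ⟨0, hn⟩)]

/-- With `l_i = ∑_j c_{ij} x_j`, the relation becomes a syzygy with entries `∑_i c_{ij} F_i`. These
do not depend on `j`, so by independence of the `F_i` neither do the `c_{ij}`. -/
theorem eq_smul_sumX_of_syzygy {d a : ℕ} {Z : Submodule k (DP k n)} (hZ : Z ≤ invS k n (d + 1))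
    (hones : allOnes k n (d + 1) ∉ Z) {F : Fin a → DP k n} (hF : LinearIndependent k F)
    (hFZ : ∀ i, F i ∈ Z) {l : Fin a → MvPolynomial (Fin n) k} (hl : ∀ i, l i ∈ formsR k n 1)
    (h : ∑ i, contract k n (l i) (F i) = 0) : ∃ c : Fin a → k, ∀ i, l i = c i • sumX k n := by
  choose c hc using fun i => exists_sum_smul_X (hl i)
  simp_rw [← hc, contract_sum_smul_X] at h
  rw [Finset.sum_comm] at h
  simp_rw [← map_sum] at h
  have h1 := syzygy_const hZ hones
    (fun j => Z.sum_mem fun i _ => Z.smul_mem (c i j) (hFZ i)) h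
  rcases Nat.eq_zero_or_pos n with rfl | hn
  · exact ⟨0, fun i => by rw [← hc]; simp⟩
  · refine ⟨fun i => c i ⟨0, hn⟩, fun i => ?_⟩
    rw [← hc, sumX, Finset.smul_sum]
    refine Finset.sum_congr rfl fun j _ => ?_
    have h2 := h1 j ⟨0, hn⟩
    rw [← sub_eq_zero, ← Finset.sum_sub_distrib] at h2
    simp_rw [← sub_smul] at h2
    rw [sub_eq_zero.1 (Fintype.linearIndependent_iff.1 hF _ h2 i)]

theorem eq_zero_of_forall_contract_X {d : ℕ} {F : DP k n} (hF : F ∈ formsS k n (d + 1))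
    (h : ∀ i, contract k n (X i) F = 0) : F = 0 := by
  ext e
  by_contra he
  have hdeg := mem_formsS.1 hF e he
  have hb0 : e ≠ 0 := by
    rintro rfl
    simp at hdeg
  obtain ⟨l, hl⟩ := Finsupp.ne_iff.1 hb0
  refine he ?_
  rw [← add_tsub_cancel_of_le (Finsupp.single_le_iff.2 (Nat.one_le_iff_ne_zero.2 hl)),
    ← contract_X_apply, h l]
  rfl

/-- In at least two variables, no element has all its first derivatives in a space of invariants
without `allOnes`; in two variables, that space must also meet `kerSum` trivially. -/
theorem eq_zero_of_contract_X_mem {d : ℕ} {Z : Submodule k (DP k n)} (hZ : Z ≤ invS k n (d + 1))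
    (hones : allOnes k n (d + 1) ∉ Z) (hn : 2 ≤ n)
    (hn' : n = 2 → Z ⊓ LinearMap.ker (contract k n (sumX k n)) = ⊥) {F : DP k n}
    (hF : F ∈ formsS k n (d + 2)) (h : ∀ i, contract k n (X i) F ∈ Z) : F = 0 := by
  have comm : ∀ i j, contract k n (X i) (contract k n (X j) F) =
      contract k n (X j) (contract k n (X i) F) := fun i j => by
    rw [← Module.End.mul_apply, ← map_mul, mul_comm, map_mul]
    rfl
  -- The Koszul relation `x_j ∘ (x_i ∘ F) - x_i ∘ (x_j ∘ F) = 0` is a syzygy with entry `x_i ∘ F` at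
  -- `j`, entry `-(x_j ∘ F)` at `i` and zeros elsewhere. All entries agree, so a third index `m`
  -- forces `x_i ∘ F = 0`.
  have key : ∀ i j, i ≠ j → ∀ m, m ≠ i → contract k n (X i) F = 0 ∨
      m = j ∧ contract k n (X i) F = - contract k n (X j) F := by
    intro i j hij m hmi
    have h0 : ∑ m, contract k n (X m) ((Pi.single j (contract k n (X i) F) -
        Pi.single i (contract k n (X j) F) : Fin n → DP k n) m) = 0 := by
      rw [Fintype.sum_eq_add i j hij]
      · simp [Pi.single_eq_of_ne hij, Pi.single_eq_of_ne hij.symm, comm i j]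
      · rintro m ⟨h1, h2⟩
        simp [Pi.single_eq_of_ne h1, Pi.single_eq_of_ne h2]
    have h1 := syzygy_const hZ hones (fun m => ?_) h0
    · by_cases hmj : m = j
      · right
        refine ⟨hmj, ?_⟩
        have := h1 j i
        simpa [Pi.single_eq_of_ne hij, Pi.single_eq_of_ne hij.symm] using this
      · left
        have := h1 j m
        simpa [Pi.single_eq_of_ne hmi, Pi.single_eq_of_ne hmj, Pi.single_eq_of_ne hij.symm]
          using this
    · refine Z.sub_mem ?_ ?_
      · by_cases hm : m = j
        · subst hm
          simpa using h i
        · simp [Pi.single_eq_of_ne hm]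
      · by_cases hm : m = i
        · subst hm
          simpa using h j
        · simp [Pi.single_eq_of_ne hm]
  refine eq_zero_of_forall_contract_X hF fun i => ?_
  obtain ⟨j, hj⟩ : ∃ j, j ≠ i := by
    have : Nontrivial (Fin n) := Fin.nontrivial_iff_two_le.2 hn
    exact exists_ne i
  by_cases h2 : n = 2
  · rcases key i j hj.symm j hj with h3 | ⟨-, h3⟩
    · exact h3
    -- Without a third variable only `x_i ∘ F = -(x_j ∘ F)` is known. Then `(x_i + x_j) ∘ (x_i ∘ F)
    -- = x_i ∘ (x_i ∘ F + x_j ∘ F) = 0`.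
    · have h4 : contract k n (X i) F ∈ Z ⊓ LinearMap.ker (contract k n (sumX k n)) := by
        refine ⟨h i, ?_⟩
        have huniv : (Finset.univ : Finset (Fin n)) = {i, j} := by
          refine (Finset.eq_univ_of_card _ ?_).symm
          rw [Finset.card_pair hj.symm, Fintype.card_fin, h2]
        rw [SetLike.mem_coe, LinearMap.mem_ker, sumX, huniv, Finset.sum_pair hj.symm, map_add,
          LinearMap.add_apply, comm j i, ← map_add, h3]
        simp
      rw [hn' h2] at h4
      exact h4
  · obtain ⟨m, hm⟩ : ∃ m, m ∉ ({i, j} : Finset (Fin n)) := by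
      by_contra hcon
      push Not at hcon
      have h5 := Finset.card_le_two (a := i) (b := j)
      rw [Finset.eq_univ_iff_forall.2 hcon, Finset.card_univ, Fintype.card_fin] at h5
      omega
    simp only [Finset.mem_insert, Finset.mem_singleton, not_or] at hm
    exact (key i j hj.symm m hm.1).resolve_right fun h => hm.2 h.1

end Symmetric

/-! ### Types of monomials and orbits of exponents -/

section Types

variable {n : ℕ}

theorem monType_mapDomain {m : ℕ} {σ : Fin m → Fin n} (hσ : Function.Injective σ)
    (e : Fin m →₀ ℕ) : monType (Finsupp.mapDomain σ e) = monType e := by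
  classical
  rw [monType, monType, Finsupp.mapDomain_support_of_injective hσ,
    Finset.image_val_of_injOn hσ.injOn, Multiset.map_map]
  exact Multiset.map_congr rfl fun i _ => Finsupp.mapDomain_apply hσ e i

/-- Nonzero values are counted by the type, and the value zero takes the remaining variables out of
`n`. Bijections between the fibres then glue to a permutation, so equal type means equal orbit. -/
theorem card_fiber_eq {e e' : Fin n →₀ ℕ} (h : monType e = monType e') (c : ℕ) :
    Fintype.card {i // e i = c} = Fintype.card {i // e' i = c} := by
  classical
  have key : ∀ e : Fin n →₀ ℕ, Fintype.card {i // e i = c} =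
      if c = 0 then n - (monType e).card else (monType e).count c := by
    intro e
    rw [Fintype.card_subtype]
    split_ifs with hc
    · have h1 : Finset.univ.filter (fun i => e i = c) = e.supportᶜ := by
        ext i
        simp [hc]
      rw [h1, Finset.card_compl, Fintype.card_fin, monType, Multiset.card_map]
      rfl
    · rw [monType, Multiset.count_map, Finset.card_def]
      congr 1
      have h1 : Finset.univ.filter (fun i => e i = c) = e.support.filter (fun i => c = e i) := by
        ext i
        simp only [Finset.mem_filter, Finset.mem_univ, true_and, Finsupp.mem_support_iff]
        constructor
        · rintro rfl
          exact ⟨hc, rfl⟩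
        · rintro ⟨-, h⟩
          exact h.symm
      rw [h1]
      rfl
  rw [key, key, h]

theorem exists_perm_of_monType_eq {e e' : Fin n →₀ ℕ} (h : monType e = monType e') :
    ∃ σ : Equiv.Perm (Fin n), Finsupp.mapDomain σ e = e' := by
  let σ : Equiv.Perm (Fin n) :=
    Equiv.ofFiberEquiv (f := e) (g := e') fun c => Fintype.equivOfCardEq (card_fiber_eq h c)
  refine ⟨σ, Finsupp.ext fun i => ?_⟩
  rw [Finsupp.mapDomain_equiv_apply]
  have := Equiv.ofFiberEquiv_map (f := e) (g := e')
    (fun c => Fintype.equivOfCardEq (card_fiber_eq h c)) (σ.symm i)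
  rw [← this]
  exact congrArg e' (σ.apply_symm_apply i)

theorem monType_sum (e : Fin n →₀ ℕ) : (monType e).sum = e.degree := rfl

theorem pos_of_mem_monType {e : Fin n →₀ ℕ} {p : ℕ} (hp : p ∈ monType e) : 0 < p := by
  obtain ⟨i, hi, rfl⟩ := Multiset.mem_map.1 hp
  exact Nat.pos_of_ne_zero (Finsupp.mem_support_iff.1 hi)

theorem exists_partition {d : ℕ} {e : Fin n →₀ ℕ} (he : e.degree = d) :
    ∃ μ : Nat.Partition d, μ.parts = monType e :=
  ⟨⟨monType e, pos_of_mem_monType, he⟩, rfl⟩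

theorem monType_add {e e' : Fin n →₀ ℕ} (h : Disjoint e.support e'.support) :
    monType (e + e') = monType e + monType e' := by
  classical
  rw [monType, monType, monType, Finsupp.support_add_eq h, ← Finset.disjUnion_eq_union _ _ h,
    Finset.disjUnion_val, Multiset.map_add]
  congr 1
  · refine Multiset.map_congr rfl fun i hi => ?_
    have : e' i = 0 := Finsupp.notMem_support_iff.1 (Finset.disjoint_left.1 h hi)
    simp [this]
  · refine Multiset.map_congr rfl fun i hi => ?_
    have : e i = 0 := Finsupp.notMem_support_iff.1 (Finset.disjoint_right.1 h hi)
    simp [this]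

theorem monType_single (i : Fin n) {p : ℕ} (hp : p ≠ 0) :
    monType (Finsupp.single i p) = {p} := by
  rw [monType, Finsupp.support_single i hp]
  simp

theorem monType_add_single {e : Fin n →₀ ℕ} {i : Fin n} (hi : e i = 0) {p : ℕ} (hp : p ≠ 0) :
    monType (e + Finsupp.single i p) = p ::ₘ monType e := by
  rw [monType_add, monType_single i hp, add_comm, Multiset.singleton_add]
  rw [Finsupp.support_single i hp, Finset.disjoint_singleton_right]
  simpa using hi

theorem exists_eq_single {e : Fin n →₀ ℕ} {p : ℕ} (h : monType e = {p}) :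
    ∃ i, e = Finsupp.single i p := by
  obtain ⟨i, hi, rfl⟩ := Multiset.map_eq_singleton.1 h
  refine ⟨i, Finsupp.eq_single_iff.2 ⟨fun j hj => ?_, rfl⟩⟩
  have : j ∈ e.support.val := hj
  rw [hi] at this
  simpa using this

/-- The exponent vector with the entries of a list. -/
def listExp (l : List ℕ) : Fin l.length →₀ ℕ := Finsupp.equivFunOnFinite.symm l.get

theorem monType_listExp {l : List ℕ} (hl : ∀ p ∈ l, p ≠ 0) : monType (listExp l) = l := by
  have : (listExp l).support = Finset.univ := by
    refine Finset.eq_univ_iff_forall.2 fun i => Finsupp.mem_support_iff.2 ?_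
    exact hl _ (List.get_mem l i)
  rw [monType, this]
  change Multiset.map l.get Finset.univ.val = l
  rw [Fin.univ_val_map, List.ofFn_get]

theorem card_le_sum_of_pos {s : Multiset ℕ} (hs : ∀ p ∈ s, 0 < p) : s.card ≤ s.sum := by
  simpa using Multiset.card_nsmul_le_sum (a := 1) hs

theorem length_sort_parts_le {d : ℕ} (μ : Nat.Partition d) :
    (μ.parts.sort (· ≥ ·)).length ≤ d := by
  rw [Multiset.length_sort]
  exact (card_le_sum_of_pos fun p hp => μ.parts_pos hp).trans μ.parts_sum.le

theorem partExponent_eq {d : ℕ} (μ : Nat.Partition d) (h : d ≤ n) :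
    partExponent n μ = Finsupp.mapDomain (Fin.castLE ((length_sort_parts_le μ).trans h))
      (listExp (μ.parts.sort (· ≥ ·))) := by
  ext i
  change (μ.parts.sort (· ≥ ·)).getD i 0 = _
  by_cases hi : (i : ℕ) < (μ.parts.sort (· ≥ ·)).length
  · have : i = Fin.castLE ((length_sort_parts_le μ).trans h) ⟨i, hi⟩ := rfl
    rw [this, Finsupp.mapDomain_apply (Fin.castLE_injective _)]
    exact List.getD_eq_getElem _ _ hi
  · rw [List.getD_eq_default _ _ (not_lt.1 hi), Finsupp.mapDomain_of_notMem_range]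
    rintro ⟨j, rfl⟩
    exact hi j.2

theorem monType_partExponent {d : ℕ} (h : d ≤ n) (μ : Nat.Partition d) :
    monType (partExponent n μ) = μ.parts := by
  rw [partExponent_eq μ h, monType_mapDomain (Fin.castLE_injective _), monType_listExp,
    Multiset.sort_eq]
  intro p hp
  exact (μ.parts_pos ((Multiset.mem_sort _).1 hp)).ne'

theorem degree_partExponent {d : ℕ} (h : d ≤ n) (μ : Nat.Partition d) :
    (partExponent n μ).degree = d := by
  rw [← monType_sum, monType_partExponent h, μ.parts_sum]

theorem parts_injective (d : ℕ) : Function.Injective (Nat.Partition.parts (n := d)) :=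
  fun _ _ h => Nat.Partition.ext h

theorem partExponent_injective {d : ℕ} (h : d ≤ n) :
    Function.Injective fun μ : Nat.Partition d => partExponent n μ := fun μ ν hμν =>
  parts_injective d (by
    rw [← monType_partExponent h, ← monType_partExponent h]
    exact congrArg _ hμν)

theorem mapDomain_swap_of_eq {e : Fin n →₀ ℕ} {a b : Fin n} (h : e a = e b) :
    Finsupp.mapDomain (Equiv.swap a b) e = e := by
  ext i
  rw [Finsupp.mapDomain_equiv_apply, Equiv.symm_swap]
  rcases eq_or_ne i a with rfl | ha
  · rw [Equiv.swap_apply_left, h]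
  · rcases eq_or_ne i b with rfl | hb
    · rw [Equiv.swap_apply_right, h]
    · rw [Equiv.swap_apply_of_ne_of_ne ha hb]

theorem exists_perm_of_monType_eq_of_eq_zero {g h : Fin n →₀ ℕ} (hgh : monType g = monType h)
    {i j u v : Fin n} (hij : i ≠ j) (huv : u ≠ v) (hi : g i = 0) (hj : g j = 0) (hu : h u = 0)
    (hv : h v = 0) :
    ∃ σ : Equiv.Perm (Fin n), Finsupp.mapDomain σ g = h ∧ σ i = u ∧ σ j = v := by
  -- Exchanging two places where `h` vanishes fixes `h`, so the image of `i` can be corrected to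
  -- `u`. The later correction at `j` leaves this one intact because `i ≠ j` and `u ≠ v`.
  have step : ∀ (σ : Equiv.Perm (Fin n)) (i u : Fin n), Finsupp.mapDomain σ g = h → g i = 0 →
      h u = 0 → Finsupp.mapDomain (Equiv.swap (σ i) u * σ : Equiv.Perm (Fin n)) g = h := by
    intro σ i u hσ hi hu
    have h1 : h (σ i) = 0 := by rw [← hσ, Finsupp.mapDomain_apply σ.injective, hi]
    rw [Equiv.Perm.coe_mul, Finsupp.mapDomain_comp, hσ, mapDomain_swap_of_eq (h1.trans hu.symm)]
  obtain ⟨σ, hσ⟩ := exists_perm_of_monType_eq hgh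
  have h1 := step σ i u hσ hi hu
  refine ⟨_, step _ j v h1 hj hv, ?_, ?_⟩
  · have h2 : (Equiv.swap (σ i) u * σ) i = u := by simp
    rw [Equiv.Perm.mul_apply, h2, Equiv.swap_apply_of_ne_of_ne _ huv]
    intro h3
    exact hij ((Equiv.swap (σ i) u * σ).injective (h2.trans h3))
  · simp

end Types

/-! ### The dimension of the space of invariants -/

section InvariantsOfS

variable {k : Type*} [Field k] {n : ℕ}

theorem apply_mapDomain_of_mem_invS {d : ℕ} {w : DP k n} (hw : w ∈ invS k n d)
    (σ : Equiv.Perm (Fin n)) (e : Fin n →₀ ℕ) : w (Finsupp.mapDomain σ e) = w e := by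
  conv_lhs => rw [← (mem_invS.1 hw).2 σ]
  exact permS_mapDomain_apply σ w e

theorem mem_invS_of_apply_mapDomain {d : ℕ} {w : DP k n} (hw : w ∈ formsS k n d)
    (h : ∀ (σ : Equiv.Perm (Fin n)) e, e.degree = d → w (Finsupp.mapDomain σ e) = w e) :
    w ∈ invS k n d := by
  refine mem_invS.2 ⟨hw, fun σ => Finsupp.ext fun e => ?_⟩
  rw [← mapDomain_symm_mapDomain σ e, permS_mapDomain_apply]
  by_cases he : e.degree = d
  · exact (h σ _ (by rw [Finsupp.degree_mapDomain, he])).symm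
  · have h0 : ∀ b : Fin n →₀ ℕ, b.degree ≠ d → w b = 0 := fun b hb => by
      by_contra hb0
      exact hb (mem_formsS.1 hw b hb0)
    rw [h0, h0]
    · rwa [mapDomain_symm_mapDomain]
    · rwa [Finsupp.degree_mapDomain]

/-- An invariant is determined by its coefficients at the exponents of the x^μ, which can be
arbitrary; every partition of `d` is a type because `d ≤ n`. -/
theorem finrank_invS {d : ℕ} (h : d ≤ n) :
    Module.finrank k (invS k n d) = numPartitions d := by
  classical
  let ev : DP k n →ₗ[k] (Nat.Partition d → k) :=
    LinearMap.pi fun μ => Finsupp.lapply (partExponent n μ)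
  rw [← finrank_map_add_finrank_inf_ker (invS k n d) ev]
  have h1 : (invS k n d).map ev = ⊤ := by
    refine eq_top_iff.2 fun α _ => ?_
    let w : DP k n := ∑ e ∈ (Finsupp.finite_of_degree_eq (σ := Fin n) d).toFinset,
      Finsupp.single e (Function.extend Nat.Partition.parts α 0 (monType e))
    have hw : ∀ e : Fin n →₀ ℕ, w e =
        if e.degree = d then Function.extend Nat.Partition.parts α 0 (monType e) else 0 := by
      intro e
      rw [Finsupp.finsetSum_apply]
      simp [Finsupp.single_apply]
    refine ⟨w, mem_invS_of_apply_mapDomain (mem_formsS.2 fun e he => ?_) fun σ e he => ?_, ?_⟩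
    · rw [hw] at he
      by_contra hne
      exact he (if_neg hne)
    · rw [hw, hw, Finsupp.degree_mapDomain σ, monType_mapDomain σ.injective]
    · funext μ
      change w (partExponent n μ) = α μ
      rw [hw, if_pos (degree_partExponent h μ), monType_partExponent h,
        (parts_injective d).extend_apply]
  have h2 : invS k n d ⊓ LinearMap.ker ev = ⊥ := by
    refine (Submodule.eq_bot_iff _).2 fun w ⟨hw, hw0⟩ => Finsupp.ext fun e => ?_
    by_contra he
    obtain ⟨μ, hμ⟩ := exists_partition (mem_formsS.1 (invS_le _ hw) e he)
    rw [← monType_partExponent h] at hμ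
    obtain ⟨σ, rfl⟩ := exists_perm_of_monType_eq hμ
    rw [apply_mapDomain_of_mem_invS hw] at he
    exact he (congrFun hw0 μ)
  rw [h1, h2, finrank_top, finrank_bot, add_zero, Module.finrank_fintype_fun_eq_card]
  rfl

end InvariantsOfS

/-! ### Admissible binomials and moving a part to a free variable -/

section Binomials

variable {k : Type*} [Field k] {n d : ℕ}

/-- Coprimality makes the type of `m` the sum of the types of `g` and `m/g`. So `m/g` has type `{p}`
and is a pure power; the same holds for `m'/g`. -/
theorem IsAdmissibleBinomial.exists_of_erase {μ : Nat.Partition d} {p : ℕ} (hp : p ∈ μ.parts)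
    {b : MvPolynomial (Fin n) k} (hb : IsAdmissibleBinomial μ (μ.parts.erase p) b) :
    ∃ (g : Fin n →₀ ℕ) (i j : Fin n), i ≠ j ∧ g i = 0 ∧ g j = 0 ∧
      monType g = μ.parts.erase p ∧
      b = monomial (g + Finsupp.single i p) 1 - monomial (g + Finsupp.single j p) 1 := by
  obtain ⟨m, m', rfl, hne, hm, hm', hg, hd, hd'⟩ := hb
  have hp0 : p ≠ 0 := (μ.parts_pos hp).ne'
  have key : ∀ m₀ : Fin n →₀ ℕ, m ⊓ m' ≤ m₀ → monType m₀ = μ.parts →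
      Disjoint (m ⊓ m').support (m₀ - m ⊓ m').support →
      ∃ i, m₀ = m ⊓ m' + Finsupp.single i p ∧ (m ⊓ m') i = 0 := by
    intro m₀ hle h0 hd0
    have h1 := monType_add hd0
    rw [add_tsub_cancel_of_le hle, h0, hg, ← Multiset.cons_erase hp, Multiset.erase_cons_head,
      ← Multiset.singleton_add, add_comm] at h1
    obtain ⟨i, hi⟩ := exists_eq_single (add_left_cancel h1).symm
    refine ⟨i, by rw [← hi, add_tsub_cancel_of_le hle], ?_⟩
    rw [hi, Finsupp.support_single i hp0, Finset.disjoint_singleton_right] at hd0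
    exact Finsupp.notMem_support_iff.1 hd0
  obtain ⟨i, hi, hi0⟩ := key m inf_le_left hm hd
  obtain ⟨j, hj, hj0⟩ := key m' inf_le_right hm' hd'
  refine ⟨m ⊓ m', i, j, ?_, hi0, hj0, hg, by rw [← hi, ← hj]⟩
  rintro rfl
  exact hne (hi.trans hj.symm)

theorem mem_vars_binomial {m m' : Fin n →₀ ℕ} (h : m ≠ m') {i : Fin n}
    (hi : m i ≠ 0 ∨ m' i ≠ 0) :
    i ∈ (monomial m 1 - monomial m' 1 : MvPolynomial (Fin n) k).vars := by
  classical
  rw [mem_vars_iff_mem_support]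
  rcases hi with hi | hi
  · refine ⟨m, ?_, Finsupp.mem_support_iff.2 hi⟩
    rw [mem_support_iff, coeff_sub, coeff_monomial, coeff_monomial, if_pos rfl, if_neg h.symm]
    simp
  · refine ⟨m', ?_, Finsupp.mem_support_iff.2 hi⟩
    rw [mem_support_iff, coeff_sub, coeff_monomial, coeff_monomial, if_pos rfl, if_neg h]
    simp

theorem rename_swap_eq_self {q : MvPolynomial (Fin n) k} {i j : Fin n} (hi : i ∉ q.vars)
    (hj : j ∉ q.vars) : rename (Equiv.swap i j) q = q := by
  have h : (rename (R := k) (Equiv.swap i j)).toRingHom q = RingHom.id _ q := by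
    refine hom_congr_vars (by ext; simp) ?_ rfl
    intro a ha _
    have h1 : a ≠ i := fun h => hi (h ▸ ha)
    have h2 : a ≠ j := fun h => hj (h ▸ ha)
    simp [Equiv.swap_apply_of_ne_of_ne h1 h2]
  exact h

/-- `w` takes the same value on all monomials of type `μ`. -/
def ConstOnType (μ : Multiset ℕ) (w : DP k n) : Prop :=
  ∀ e, monType e = μ → ∀ σ : Equiv.Perm (Fin n), w (Finsupp.mapDomain σ e) = w e

/-- Moving a part to a free place is a transposition of a used and an unused variable. With a spare
variable these give all transpositions, hence all permutations. -/
theorem constOnType_of_move {μ : Multiset ℕ} {w : DP k n}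
    (hspare : ∀ e : Fin n →₀ ℕ, monType e = μ → ∃ x, e x = 0)
    (hmove : ∀ (h : Fin n →₀ ℕ) (p : ℕ) (u v : Fin n), p ≠ 0 → u ≠ v → h u = 0 → h v = 0 →
      p ::ₘ monType h = μ → w (h + Finsupp.single u p) = w (h + Finsupp.single v p)) :
    ConstOnType μ w := by
  have h1 : ∀ (e : Fin n →₀ ℕ) (u v : Fin n), monType e = μ → e u ≠ 0 → e v = 0 →
      w (Finsupp.mapDomain (Equiv.swap u v) e) = w e := by
    intro e u v he hu hv
    have huv : u ≠ v := by
      rintro rfl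
      exact hu hv
    have hsplit : e = e.erase u + Finsupp.single u (e u) := (Finsupp.erase_add_single u e).symm
    have hu' : e.erase u u = 0 := Finsupp.erase_same
    have hv' : e.erase u v = 0 := by rw [Finsupp.erase_ne huv.symm, hv]
    have ht : e u ::ₘ monType (e.erase u) = μ := by
      rw [← monType_add_single hu' hu, ← hsplit, he]
    conv_lhs => rw [hsplit, Finsupp.mapDomain_add, mapDomain_swap_of_eq (hu'.trans hv'.symm),
      Finsupp.mapDomain_single, Equiv.swap_apply_left]
    rw [← hmove (e.erase u) (e u) u v hu huv hu' hv' ht, ← hsplit]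
  have h2 : ∀ (e : Fin n →₀ ℕ) (u v : Fin n), monType e = μ →
      w (Finsupp.mapDomain (Equiv.swap u v) e) = w e := by
    intro e u v he
    by_cases huv : e u = e v
    · rw [mapDomain_swap_of_eq huv]
    by_cases hu : e u = 0
    · rw [Equiv.swap_comm]
      exact h1 e v u he (fun h => huv (hu.trans h.symm)) hu
    by_cases hv : e v = 0
    · exact h1 e u v he hu hv
    obtain ⟨x, hx⟩ := hspare e he
    have hxu : x ≠ u := by
      rintro rfl
      exact hu hx
    have hxv : x ≠ v := by
      rintro rfl
      exact hv hx
    have huv' : u ≠ v := by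
      rintro rfl
      exact huv rfl
    -- When both places are used, three moves through the spare place `x` realise the transposition:
    -- `(u v) = (x u)(u v)(v x)`.
    have e1 := h1 e v x he hv hx
    have e2 := h1 (Finsupp.mapDomain (Equiv.swap v x) e) u v
      (by rw [monType_mapDomain (Equiv.injective _), he])
      (by rw [Finsupp.mapDomain_equiv_apply, Equiv.symm_swap,
        Equiv.swap_apply_of_ne_of_ne huv' hxu.symm]; exact hu)
      (by rw [Finsupp.mapDomain_equiv_apply, Equiv.symm_swap, Equiv.swap_apply_left, hx])
    have e3 := h1 (Finsupp.mapDomain (Equiv.swap u v) (Finsupp.mapDomain (Equiv.swap v x) e)) x u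
      (by rw [monType_mapDomain (Equiv.injective _), monType_mapDomain (Equiv.injective _), he])
      (by rw [Finsupp.mapDomain_equiv_apply, Equiv.symm_swap, Finsupp.mapDomain_equiv_apply,
        Equiv.symm_swap, Equiv.swap_apply_of_ne_of_ne hxu hxv, Equiv.swap_apply_right]; exact hv)
      (by rw [Finsupp.mapDomain_equiv_apply, Equiv.symm_swap, Finsupp.mapDomain_equiv_apply,
        Equiv.symm_swap, Equiv.swap_apply_left, Equiv.swap_apply_left, hx])
    rw [← e1, ← e2, ← e3, ← Finsupp.mapDomain_comp, ← Finsupp.mapDomain_comp]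
    congr 2
    funext y
    simp only [Function.comp_apply, Equiv.swap_apply_def]
    split_ifs <;> simp_all
  intro e he σ
  induction σ using Equiv.Perm.swap_induction_on with
  | one => rw [Equiv.Perm.coe_one, Finsupp.mapDomain_id]
  | swap_mul σ x y _ ih =>
    rw [Equiv.Perm.coe_mul, Finsupp.mapDomain_comp, h2 _ _ _
      (by rw [monType_mapDomain σ.injective, he]), ih]

theorem ConstOnType.apply_eq {μ : Multiset ℕ} {w : DP k n} (h : ConstOnType μ w)
    {e e' : Fin n →₀ ℕ} (he : monType e = μ) (he' : monType e' = μ) : w e = w e' := by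
  obtain ⟨σ, rfl⟩ := exists_perm_of_monType_eq (he.trans he'.symm)
  exact (h e he σ).symm

theorem IsAdmissibleBinomial.pair_rename_eq_zero {μ : Nat.Partition d} {γ : Multiset ℕ}
    {b : MvPolynomial (Fin n) k} (hb : IsAdmissibleBinomial μ γ b) {w : DP k n}
    (hw : ConstOnType μ.parts w) (σ : Equiv.Perm (Fin n)) : pair k n (rename σ b) w = 0 := by
  obtain ⟨m, m', rfl, -, hm, hm', -⟩ := hb
  rw [map_sub, rename_monomial, rename_monomial, map_sub, LinearMap.sub_apply, pair_monomial,
    pair_monomial, hw m hm, hw m' hm', hw.apply_eq hm hm', sub_self]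

theorem IsAdmissibleBinomial.mem_formsR {μ : Nat.Partition d} {γ : Multiset ℕ}
    {b : MvPolynomial (Fin n) k} (hb : IsAdmissibleBinomial μ γ b) : b ∈ formsR k n d := by
  obtain ⟨m, m', rfl, -, hm, hm', -⟩ := hb
  have h : ∀ m : Fin n →₀ ℕ, monType m = μ.parts → (monomial m 1 : MvPolynomial (Fin n) k) ∈
      formsR k n d := fun m hm => by
    rw [← μ.parts_sum, ← hm, monType_sum]
    exact monomial_mem_formsR m 1
  exact Submodule.sub_mem _ (h m hm) (h m' hm')

theorem reynolds_rename (σ : Equiv.Perm (Fin n)) (f : MvPolynomial (Fin n) k) :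
    reynolds k n (rename σ f) = reynolds k n f := by
  rw [reynolds_apply, reynolds_apply]
  simp_rw [rename_rename_perm]
  congr 1
  exact Fintype.sum_equiv (Equiv.mulRight σ) _ _ fun τ => rfl

/-- Both monomials have the same type, so they lie in one orbit and have the same average. -/
theorem IsAdmissibleBinomial.reynolds_eq_zero {μ : Nat.Partition d} {γ : Multiset ℕ}
    {b : MvPolynomial (Fin n) k} (hb : IsAdmissibleBinomial μ γ b) : reynolds k n b = 0 := by
  obtain ⟨m, m', rfl, -, hm, hm', -⟩ := hb
  obtain ⟨σ, rfl⟩ := exists_perm_of_monType_eq (hm.trans hm'.symm)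
  rw [map_sub, ← rename_monomial, reynolds_rename, sub_self]

end Binomials

/-! ### Orthogonality to the orbit of a form f_α -/

section FForms

variable {k : Type*} [Field k] {n d : ℕ} {ord : LinearOrder (Nat.Partition d)}
  {α : Nat.Partition d → k} {f : MvPolynomial (Fin n) k}

theorem IsFForm.mem_formsR (hf : IsFForm ord α f) : f ∈ formsR k n d := by
  obtain ⟨hdn, τ, -, -, b, hb, -, rfl⟩ := hf
  refine Submodule.add_mem _ (Submodule.sum_mem _ fun μ _ => ?_)
    (Submodule.sum_mem _ fun μ hμ => Submodule.sum_mem _ fun γ hγ =>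
      (hb μ (Finset.mem_filter.1 hμ).2 γ (Finset.mem_Iio.1 hγ)).1.mem_formsR)
  have h := monomial_mem_formsR (partExponent n μ) (α μ)
  rwa [degree_partExponent hdn] at h

theorem reynolds_hForm (α : Nat.Partition d → k) :
    reynolds k n (hForm n α) = ∑ μ, α μ • symM k n μ := by
  rw [hForm, map_sum]
  refine Finset.sum_congr rfl fun μ _ => ?_
  rw [symM, ← map_smul, smul_monomial, smul_eq_mul, mul_one]

theorem IsFForm.reynolds_eq (hf : IsFForm ord α f) :
    reynolds k n f = ∑ μ, α μ • symM k n μ := by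
  obtain ⟨hdn, τ, -, -, b, hb, -, rfl⟩ := hf
  rw [map_add, reynolds_hForm, map_sum]
  refine add_eq_left.2 (Finset.sum_eq_zero fun μ hμ => ?_)
  rw [map_sum]
  exact Finset.sum_eq_zero fun γ hγ =>
    (hb μ (Finset.mem_filter.1 hμ).2 γ (Finset.mem_Iio.1 hγ)).1.reynolds_eq_zero

theorem exists_mem_vars_hForm (hd : 0 < d) (hdn : d ≤ n) {τ : Nat.Partition d} (hτ : α τ ≠ 0) :
    ∃ x, x ∈ (hForm n α).vars := by
  classical
  have h1 : partExponent n τ ∈ (hForm n α).support := by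
    rw [mem_support_iff, hForm, coeff_sum, Finset.sum_eq_single τ]
    · rwa [coeff_monomial, if_pos rfl]
    · intro μ _ hμ
      rw [coeff_monomial, if_neg fun h => hμ (partExponent_injective hdn h)]
    · simp
  have h2 : partExponent n τ ≠ 0 := by
    intro h
    have := degree_partExponent hdn τ
    rw [h, map_zero] at this
    omega
  obtain ⟨x, hx⟩ := Finsupp.ne_iff.1 h2
  exact ⟨x, (mem_vars_iff_mem_support x).2 ⟨_, h1, Finsupp.mem_support_iff.2 hx⟩⟩

theorem exists_mem_parts (hd : 0 < d) (μ : Nat.Partition d) : ∃ p, p ∈ μ.parts := by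
  refine Multiset.exists_mem_of_ne_zero fun h => ?_
  have := μ.parts_sum
  rw [h, Multiset.sum_zero] at this
  omega

/-- A form `f_α` needs at least three variables if there are at least two partitions. -/
theorem IsFForm.three_le (hf : IsFForm ord α f) (hd : 0 < d) (hP : 1 < numPartitions d) :
    3 ≤ n := by
  obtain ⟨hdn, τ, hτ, -, b, hb, -, -⟩ := hf
  obtain ⟨μ, hμ⟩ := Fintype.exists_ne_of_one_lt_card hP τ
  obtain ⟨p, hp⟩ := exists_mem_parts hd μ
  have hp0 : p ≠ 0 := (μ.parts_pos hp).ne'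
  -- This binomial involves two distinct variables `i` and `j`, and the nonzero `h_α` involves a
  -- third one.
  obtain ⟨h1, h2⟩ := hb μ hμ _ (Multiset.erase_lt.2 hp)
  obtain ⟨g, i, j, hij, hi, hj, -, hbe⟩ := h1.exists_of_erase hp
  obtain ⟨x, hx⟩ := exists_mem_vars_hForm hd hdn hτ
  have hne : g + Finsupp.single i p ≠ g + Finsupp.single j p := fun h =>
    hij (Finsupp.single_left_injective hp0 (add_left_cancel h))
  have hi' : i ∈ (b μ (μ.parts.erase p)).vars := by
    rw [hbe]
    exact mem_vars_binomial hne (Or.inl (by simp [hp0]))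
  have hj' : j ∈ (b μ (μ.parts.erase p)).vars := by
    rw [hbe]
    exact mem_vars_binomial hne (Or.inr (by simp [hp0]))
  have hxi : x ≠ i := fun h => Finset.disjoint_left.1 h2 hi' (h ▸ hx)
  have hxj : x ≠ j := fun h => Finset.disjoint_left.1 h2 hj' (h ▸ hx)
  have := Finset.card_le_univ ({x, i, j} : Finset (Fin n))
  rwa [Finset.card_eq_three.2 ⟨x, i, j, hxi, hxj, hij, rfl⟩, Fintype.card_fin] at this

/-- The effect of a permutation that negates one summand and fixes all the others. -/
theorem sub_rename_eq_two_smul {ι κ : Type*} [DecidableEq ι] [DecidableEq κ]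
    {σ : Equiv.Perm (Fin n)} {q : MvPolynomial (Fin n) k} {s : Finset ι} {t : ι → Finset κ}
    {b : ι → κ → MvPolynomial (Fin n) k} {x : ι} {y : κ} (hx : x ∈ s) (hy : y ∈ t x)
    (hq : rename σ q = q) (hb : rename σ (b x y) = -b x y)
    (hb' : ∀ x' ∈ s, ∀ y' ∈ t x', (x, y) ≠ (x', y') → rename σ (b x' y') = b x' y') :
    (q + ∑ x ∈ s, ∑ y ∈ t x, b x y) - rename σ (q + ∑ x ∈ s, ∑ y ∈ t x, b x y) =
      (2 : k) • b x y := by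
  rw [map_add, add_sub_add_comm, hq, sub_self, zero_add, map_sum, ← Finset.sum_sub_distrib,
    Finset.sum_eq_single_of_mem x hx, map_sum, ← Finset.sum_sub_distrib,
    Finset.sum_eq_single_of_mem y hy, hb, sub_neg_eq_add, two_smul]
  · intro y' hy' hne
    rw [hb' x hx y' hy' fun h => hne (Prod.ext_iff.1 h).2.symm, sub_self]
  · intro x' hx' hne
    rw [map_sum, ← Finset.sum_sub_distrib]
    refine Finset.sum_eq_zero fun y' hy' => ?_
    rw [hb' x' hx' y' hy' fun h => hne (Prod.ext_iff.1 h).1.symm, sub_self]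

/-- The relations on an element of `S_{-d}` orthogonal to the orbit of a form `f_α` that come from
one of its binomials. -/
theorem exists_move {τ μ : Nat.Partition d}
    {b : Nat.Partition d → Multiset ℕ → MvPolynomial (Fin n) k}
    (hb : ∀ μ, μ ≠ τ → ∀ γ, γ < μ.parts →
      IsAdmissibleBinomial μ γ (b μ γ) ∧ Disjoint (b μ γ).vars (hForm n α).vars)
    (hbb : ∀ μ μ', μ ≠ τ → μ' ≠ τ → ∀ γ γ', γ < μ.parts → γ' < μ'.parts → (μ, γ) ≠ (μ', γ') →
      Disjoint (b μ γ).vars (b μ' γ').vars)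
    (h2 : 2 ≤ n → (2 : k) ≠ 0) {w : DP k n}
    (h : ∀ σ : Equiv.Perm (Fin n), pair k n (rename σ (hForm n α +
      ∑ μ ∈ Finset.univ.filter (fun μ : Nat.Partition d => μ ≠ τ),
        ∑ γ ∈ Finset.Iio μ.parts, b μ γ)) w = 0)
    (hμ : μ ≠ τ) {p : ℕ} (hp : p ∈ μ.parts) :
    ∃ (g : Fin n →₀ ℕ) (i j : Fin n), i ≠ j ∧ g i = 0 ∧ g j = 0 ∧
      p ::ₘ monType g = μ.parts ∧ ∀ σ : Equiv.Perm (Fin n),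
        w (Finsupp.mapDomain σ g + Finsupp.single (σ i) p) =
          w (Finsupp.mapDomain σ g + Finsupp.single (σ j) p) := by
  have hp0 : p ≠ 0 := (μ.parts_pos hp).ne'
  have hlt : μ.parts.erase p < μ.parts := Multiset.erase_lt.2 hp
  obtain ⟨hadm, hdis⟩ := hb μ hμ _ hlt
  obtain ⟨g, i, j, hij, hi, hj, hg, hbe⟩ := hadm.exists_of_erase hp
  refine ⟨g, i, j, hij, hi, hj, by rw [hg, Multiset.cons_erase hp], fun σ => ?_⟩
  have hne : g + Finsupp.single i p ≠ g + Finsupp.single j p := fun h =>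
    hij (Finsupp.single_left_injective hp0 (add_left_cancel h))
  have hi' : i ∈ (b μ (μ.parts.erase p)).vars := by
    rw [hbe]
    exact mem_vars_binomial hne (Or.inl (by simp [hp0]))
  have hj' : j ∈ (b μ (μ.parts.erase p)).vars := by
    rw [hbe]
    exact mem_vars_binomial hne (Or.inr (by simp [hp0]))
  have hswap : rename (Equiv.swap i j) (b μ (μ.parts.erase p)) = -b μ (μ.parts.erase p) := by
    rw [hbe, map_sub, rename_monomial, rename_monomial, Finsupp.mapDomain_add,
      Finsupp.mapDomain_add, mapDomain_swap_of_eq (hi.trans hj.symm), Finsupp.mapDomain_single,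
      Finsupp.mapDomain_single, Equiv.swap_apply_left, Equiv.swap_apply_right, neg_sub]
  have hfix : ∀ q : MvPolynomial (Fin n) k, Disjoint (b μ (μ.parts.erase p)).vars q.vars →
      rename (Equiv.swap i j) q = q := fun q hq =>
    rename_swap_eq_self (Finset.disjoint_left.1 hq hi') (Finset.disjoint_left.1 hq hj')
  have hdiff := sub_rename_eq_two_smul
    (s := Finset.univ.filter (fun μ : Nat.Partition d => μ ≠ τ))
    (t := fun μ => Finset.Iio μ.parts) (Finset.mem_filter.2 ⟨Finset.mem_univ _, hμ⟩)
    (Finset.mem_Iio.2 hlt) (hfix _ hdis) hswap fun μ' hμ' γ' hγ' hne' => hfix _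
      (hbb μ μ' hμ (Finset.mem_filter.1 hμ').2 _ _ hlt (Finset.mem_Iio.1 hγ') hne')
  have hn2 : 2 ≤ n := by
    have : Nontrivial (Fin n) := ⟨i, j, hij⟩
    exact Fin.nontrivial_iff_two_le.1 this
  -- Both `σ f` and `σ (i j) f` are orthogonal to `w`, so `w` is orthogonal to `2 σ b`, and 2 is
  -- invertible.
  have h3 := congrArg (fun q => pair k n (rename σ q) w) hdiff
  simp only [map_sub, LinearMap.sub_apply, rename_rename_perm, h, sub_zero, map_smul,
    LinearMap.smul_apply] at h3
  have h4 := (smul_eq_zero.1 h3.symm).resolve_left (h2 hn2)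
  rw [hbe, map_sub, map_sub, LinearMap.sub_apply, rename_monomial, rename_monomial,
    pair_monomial, pair_monomial, one_mul, one_mul, sub_eq_zero, Finsupp.mapDomain_add,
    Finsupp.mapDomain_add, Finsupp.mapDomain_single, Finsupp.mapDomain_single] at h4
  exact h4

/-- An element of `S_{-d}` that is orthogonal to the orbit of a form `f_α` is invariant. -/
theorem IsFForm.mem_invS (hf : IsFForm ord α f) (hd : 0 < d) (h2 : 2 ≤ n → (2 : k) ≠ 0)
    {w : DP k n} (hw : w ∈ formsS k n d)
    (h : ∀ σ : Equiv.Perm (Fin n), pair k n (rename σ f) w = 0) : w ∈ invS k n d := by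
  classical
  obtain ⟨hdn, τ, hτ, -, b, hb, hbb, rfl⟩ := hf
  have hconst : ∀ μ : Nat.Partition d, μ ≠ τ → ConstOnType μ.parts w := by
    intro μ hμ
    have hbin := fun p hp => exists_move hb hbb h2 h hμ (p := p) hp
    refine constOnType_of_move (fun e he => ?_) fun g' p u v hp huv hu hv ht => ?_
    -- The binomial itself supplies the spare place: `g + p e_i` has type `μ` and vanishes at `j`,
    -- and all monomials of type `μ` are in its orbit.
    · by_contra hcon
      push Not at hcon
      obtain ⟨p, hp⟩ := exists_mem_parts hd μ
      obtain ⟨g, i, j, hij, hi, hj, hg, -⟩ := hbin p hp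
      rw [← monType_add_single hi (μ.parts_pos hp).ne', ← he] at hg
      obtain ⟨σ, hσ⟩ := exists_perm_of_monType_eq hg.symm
      refine hcon (σ.symm j) ?_
      rw [← Finsupp.mapDomain_apply σ.injective e (σ.symm j), hσ, Equiv.apply_symm_apply,
        Finsupp.add_apply, hj, Finsupp.single_eq_of_ne hij.symm, add_zero]
    · obtain ⟨g, i, j, hij, hi, hj, hg, hσ⟩ :=
        hbin p (ht ▸ Multiset.mem_cons_self _ _)
      rw [← ht] at hg
      obtain ⟨σ, rfl, rfl, rfl⟩ := exists_perm_of_monType_eq_of_eq_zero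
        ((Multiset.cons_inj_right p).1 hg) hij huv hi hj hu hv
      exact hσ σ
  -- The binomials now pair to zero with `w`, and the terms of `h_α` of type other than `τ`
  -- contribute the same amount for every `σ`. Hence the term of type `τ` does not depend on `σ`
  -- either.
  have hsum : ∀ σ : Equiv.Perm (Fin n),
      α τ * w (Finsupp.mapDomain σ (partExponent n τ)) +
        ∑ μ ∈ Finset.univ.erase τ, α μ * w (partExponent n μ) = 0 := by
    intro σ
    rw [← h σ, map_add, map_add, LinearMap.add_apply, map_sum, map_sum, LinearMap.sum_apply,
      Finset.sum_eq_zero (s := Finset.univ.filter _), add_zero, hForm, map_sum, map_sum,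
      LinearMap.sum_apply, ← Finset.add_sum_erase _ _ (Finset.mem_univ τ)]
    · rw [rename_monomial, pair_monomial]
      congr 1
      refine Finset.sum_congr rfl fun μ hμ => ?_
      rw [rename_monomial, pair_monomial,
        hconst μ (Finset.ne_of_mem_erase hμ) _ (monType_partExponent hdn μ)]
    · intro μ hμ
      rw [map_sum, map_sum, LinearMap.sum_apply]
      refine Finset.sum_eq_zero fun γ hγ => ?_
      have hμ' := (Finset.mem_filter.1 hμ).2
      exact (hb μ hμ' γ (Finset.mem_Iio.1 hγ)).1.pair_rename_eq_zero (hconst μ hμ') σ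
  have hτc : ∀ σ : Equiv.Perm (Fin n),
      w (Finsupp.mapDomain σ (partExponent n τ)) = w (partExponent n τ) := by
    intro σ
    have h1 := hsum σ
    have h3 := hsum 1
    rw [Equiv.Perm.coe_one, Finsupp.mapDomain_id] at h3
    exact mul_left_cancel₀ hτ (add_right_cancel (h1.trans h3.symm))
  refine mem_invS_of_apply_mapDomain hw fun σ e he => ?_
  obtain ⟨μ, hμ⟩ := exists_partition he
  by_cases hμτ : μ = τ
  · subst hμτ
    rw [← monType_partExponent hdn] at hμ
    obtain ⟨ρ, rfl⟩ := exists_perm_of_monType_eq hμ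
    rw [← Finsupp.mapDomain_comp, ← Equiv.Perm.coe_mul, hτc, hτc]
  · exact hconst μ hμτ e hμ.symm σ

end FForms

/-! ### Zariski open sets defined by separating functionals -/

section Grassmannian

variable {k E : Type*} [Field k] [AddCommGroup E] [Module k E] {r : ℕ}

/-- The tuple `κ` of functionals is jointly injective on `U`. -/
def Separates (κ : Fin r → Module.Dual k E) (U : Submodule k E) : Prop :=
  ∀ x ∈ U, (∀ j, κ j x = 0) → x = 0

/-- The `r`-dimensional subspaces of `W` on which some tuple in `K` is jointly injective. -/
def sepOpen (W : Submodule k E) (K : Set (Fin r → Module.Dual k E)) : Set (Submodule k E) :=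
  {U | U ∈ Gr r W ∧ ∃ κ ∈ K, Separates κ U}

/-- The Plücker coordinate `det (κ_j (u_i))`. -/
def detForm (κ : Fin r → Module.Dual k E) : E [⋀^Fin r]→ₗ[k] k :=
  Matrix.detRowAlternating.compLinearMap (LinearMap.pi κ)

theorem detForm_apply (κ : Fin r → Module.Dual k E) (u : Fin r → E) :
    detForm κ u = (Matrix.of fun i j => κ j (u i)).det := rfl

/-- Joint injectivity on a span is invertibility of the matrix of values, that is, nonvanishing of
one Plücker coordinate. This makes each `sepOpen` a union of basic open sets. -/
theorem separates_span_iff {κ : Fin r → Module.Dual k E} {u : Fin r → E}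
    (hu : LinearIndependent k u) :
    Separates κ (Submodule.span k (Set.range u)) ↔ detForm κ u ≠ 0 := by
  rw [detForm_apply, Ne, ← Matrix.exists_vecMul_eq_zero_iff]
  have key : ∀ (c : Fin r → k) (j : Fin r),
      κ j (∑ i, c i • u i) = Matrix.vecMul c (Matrix.of fun i j => κ j (u i)) j := fun c j => by
    simp [Matrix.vecMul, dotProduct]
  constructor
  · rintro h ⟨c, hc, h0⟩
    refine hc (funext fun i => Fintype.linearIndependent_iff.1 hu c ?_ i)
    refine h _ ((Submodule.mem_span_range_iff_exists_fun k).2 ⟨c, rfl⟩) fun j => ?_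
    rw [key, h0]
    rfl
  · intro h x hx hx0
    obtain ⟨c, rfl⟩ := (Submodule.mem_span_range_iff_exists_fun k).1 hx
    have hc : c = 0 := by
      by_contra hc
      exact h ⟨c, hc, funext fun j => by rw [← key, hx0 j]; rfl⟩
    simp [hc]

theorem isZariskiOpen_sepOpen (W : Submodule k E) (K : Set (Fin r → Module.Dual k E)) :
    IsZariskiOpen r W (sepOpen W K) := by
  refine ⟨fun U hU => hU.1, (fun κ => X (detForm κ)) '' K, ?_, fun u huW hu => ?_⟩
  · rintro _ ⟨κ, -, rfl⟩
    exact ⟨1, isHomogeneous_X _ _⟩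
  · have hGr : Submodule.span k (Set.range u) ∈ Gr r W :=
      ⟨Submodule.span_le.2 (Set.range_subset_iff.2 huW), by
        rw [finrank_span_eq_card hu, Fintype.card_fin]⟩
    simp only [sepOpen, Set.mem_ofPred_eq, hGr, true_and, separates_span_iff hu,
      Set.exists_mem_image, eval_X]

theorem IsZariskiOpen.inter {W : Submodule k E} {G G' : Set (Submodule k E)}
    (hG : IsZariskiOpen r W G) (hG' : IsZariskiOpen r W G') : IsZariskiOpen r W (G ∩ G') := by
  obtain ⟨hsub, Q, hQ, h⟩ := hG
  obtain ⟨-, Q', hQ', h'⟩ := hG'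
  refine ⟨Set.inter_subset_left.trans hsub, Set.image2 (fun q q' => q * q') Q Q', ?_,
    fun u huW hu => ?_⟩
  · rintro _ ⟨q, hq, q', hq', rfl⟩
    obtain ⟨m, hm⟩ := hQ q hq
    obtain ⟨m', hm'⟩ := hQ' q' hq'
    exact ⟨m + m', hm.mul hm'⟩
  · rw [Set.mem_inter_iff, h u huW hu, h' u huW hu]
    constructor
    · rintro ⟨⟨q, hq, h0⟩, q', hq', h0'⟩
      exact ⟨_, ⟨q, hq, q', hq', rfl⟩, by rw [map_mul]; exact mul_ne_zero h0 h0'⟩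
    · rintro ⟨_, ⟨q, hq, q', hq', rfl⟩, h0⟩
      rw [map_mul] at h0
      exact ⟨⟨q, hq, left_ne_zero_of_mul h0⟩, q', hq', right_ne_zero_of_mul h0⟩

/-- The matrix of values is the identity, and determinant 1 gives both linear independence of `u`
and separation. All nonemptiness proofs go through such dual families. -/
theorem mem_Gr_and_separates {W : Submodule k E} {κ : Fin r → Module.Dual k E} {u : Fin r → E}
    (hu : ∀ i, u i ∈ W) (h : ∀ i j, κ j (u i) = if i = j then 1 else 0) :
    Submodule.span k (Set.range u) ∈ Gr r W ∧ Separates κ (Submodule.span k (Set.range u)) := by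
  have hdet : detForm κ u = 1 := by
    rw [detForm_apply]
    convert Matrix.det_one (n := Fin r) (R := k)
    ext i j
    rw [Matrix.of_apply, h, Matrix.one_apply]
  have hli : LinearIndependent k u := by
    by_contra hcon
    have := (detForm κ).map_linearDependent u hcon
    rw [hdet] at this
    exact one_ne_zero this
  exact ⟨⟨Submodule.span_le.2 (Set.range_subset_iff.2 hu), by
      rw [finrank_span_eq_card hli, Fintype.card_fin]⟩,
    (separates_span_iff hli).2 (by rw [hdet]; exact one_ne_zero)⟩

theorem Separates.bijective {W U : Submodule k E} {κ : Fin r → Module.Dual k E}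
    [FiniteDimensional k U] (hU : U ∈ Gr r W) (h : Separates κ U) :
    Function.Bijective ((LinearMap.pi κ).domRestrict U) := by
  have hinj : Function.Injective ((LinearMap.pi κ).domRestrict U) := by
    rw [← LinearMap.ker_eq_bot, LinearMap.ker_eq_bot']
    intro x hx
    exact Subtype.ext (h x x.2 fun j => congrFun hx j)
  refine ⟨hinj, (LinearMap.injective_iff_surjective_of_finrank_eq_finrank ?_).1 hinj⟩
  rw [hU.2, Module.finrank_fintype_fun_eq_card, Fintype.card_fin]

/-- Restricted to the `r`-dimensional `U`, the `r` separating functionals form a basis of the dual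
of `U`; this is independence, and `Separates.exists_sum` is spanning. -/
theorem Separates.eq_zero_of_sum {W U : Submodule k E} {κ : Fin r → Module.Dual k E}
    [FiniteDimensional k U] (hU : U ∈ Gr r W) (h : Separates κ U) {c : Fin r → k}
    (hc : ∀ x ∈ U, ∑ j, c j * κ j x = 0) : c = 0 := by
  funext j
  obtain ⟨x, hx⟩ := (h.bijective hU).2 (Pi.single j 1)
  have h1 : ∀ i, κ i x = Pi.single (M := fun _ => k) j 1 i := fun i => congrFun hx i
  have h2 := hc x x.2
  simp_rw [h1] at h2
  simpa [Pi.single_apply] using h2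

theorem Separates.exists_sum {W U : Submodule k E} {κ : Fin r → Module.Dual k E}
    [FiniteDimensional k U] (hU : U ∈ Gr r W) (h : Separates κ U) (θ : Module.Dual k U) :
    ∃ c : Fin r → k, ∀ x : U, θ x = ∑ j, c j * κ j x := by
  let e := LinearEquiv.ofBijective _ (h.bijective hU)
  refine ⟨fun j => θ (e.symm (Pi.single j 1)), fun x => ?_⟩
  have hx : x = ∑ j, κ j x • e.symm (Pi.single j 1) := by
    apply e.injective
    rw [map_sum]
    simp_rw [map_smul, LinearEquiv.apply_symm_apply]
    funext i
    change κ i x = _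
    simp [Finset.sum_apply, Pi.single_apply]
  conv_lhs => rw [hx, map_sum]
  exact Finset.sum_congr rfl fun j _ => by rw [map_smul, smul_eq_mul, mul_comm]

theorem finiteDimensional_of_mem_Gr {W U : Submodule k E} (hr : 1 ≤ r) (hU : U ∈ Gr r W) :
    FiniteDimensional k U :=
  Module.finite_of_finrank_pos (by rw [hU.2]; exact hr)

theorem finrank_span_singleton_le (x : E) : Module.finrank k (Submodule.span k {x}) ≤ 1 := by
  simpa using finrank_span_le_card (R := k) ({x} : Set E)

theorem exists_submodule_between {N C : Submodule k E} [FiniteDimensional k C] (hNC : N ≤ C)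
    (hN : Module.finrank k N ≤ r) (hC : r ≤ Module.finrank k C) :
    ∃ M, N ≤ M ∧ M ≤ C ∧ Module.finrank k M = r := by
  induction r, hN using Nat.le_induction with
  | base => exact ⟨N, le_rfl, hNC, rfl⟩
  | succ r hr ih =>
    obtain ⟨M, hNM, hMC, hM⟩ := ih (by omega)
    have hlt : M < C := lt_of_le_of_ne hMC fun h => by
      rw [h] at hM
      omega
    obtain ⟨x, hxC, hxM⟩ := SetLike.exists_of_lt hlt
    have hle : M ⊔ Submodule.span k {x} ≤ C :=
      sup_le hMC ((Submodule.span_singleton_le_iff_mem _ _).2 hxC)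
    have hfd : FiniteDimensional k M := Submodule.finiteDimensional_of_le hMC
    have hfd' : FiniteDimensional k (M ⊔ Submodule.span k {x} : Submodule k E) :=
      Submodule.finiteDimensional_of_le hle
    refine ⟨_, hNM.trans le_sup_left, hle, le_antisymm ?_ ?_⟩
    · refine (Submodule.finrank_add_le_finrank_add_finrank _ _).trans ?_
      rw [hM]
      exact Nat.add_le_add_left (finrank_span_singleton_le x) r
    · rw [← hM]
      refine Submodule.finrank_lt_finrank_of_lt (lt_of_le_of_ne le_sup_left fun h => hxM ?_)
      rw [h]
      exact Submodule.mem_sup_right (Submodule.mem_span_singleton_self x)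

theorem exists_functional {ι : Type*} {v : ι → E} (hv : LinearIndependent k v) (a : ι → k) :
    ∃ φ : E →ₗ[k] k, ∀ i, φ (v i) = a i := by
  obtain ⟨L, hL⟩ := LinearMap.exists_leftInverse_of_injective (Finsupp.linearCombination k v)
    (LinearMap.ker_eq_bot.2 hv)
  refine ⟨(Finsupp.linearCombination k a).comp L, fun i => ?_⟩
  have h := LinearMap.congr_fun hL (Finsupp.single i 1)
  simp only [LinearMap.comp_apply, Finsupp.linearCombination_single, one_smul,
    LinearMap.id_apply] at h
  simp [h]

theorem exists_basis_family {M : Submodule k E} [FiniteDimensional k M]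
    (hM : Module.finrank k M = r) :
    ∃ w : Fin r → E, LinearIndependent k w ∧ Submodule.span k (Set.range w) = M := by
  subst hM
  let b := Module.finBasis k M
  refine ⟨fun i => b i, b.linearIndependent.map' M.subtype M.ker_subtype, ?_⟩
  have : Set.range (fun i => (b i : E)) = M.subtype '' Set.range b := by
    rw [← Set.range_comp]
    rfl
  rw [this, Submodule.span_image, b.span_eq, Submodule.map_subtype_top]

end Grassmannian

/-! ### The open set G_0, independent of the number of variables -/

section SumOpen

variable {k : Type*} [Field k] {r : ℕ}

/-- The sum of the coordinates. -/
def coordSum (k ι : Type*) [Field k] [Fintype ι] : Module.Dual k (ι → k) :=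
  ∑ i, LinearMap.proj i

theorem coordSum_apply {ι : Type*} [Fintype ι] (x : ι → k) : coordSum k ι x = ∑ i, x i := by
  simp [coordSum]

theorem coordSum_ne_zero {ι : Type*} [Fintype ι] [Nonempty ι] : coordSum k ι ≠ 0 := by
  classical
  intro h
  obtain ⟨i⟩ := ‹Nonempty ι›
  have := LinearMap.congr_fun h (Pi.single i 1)
  rw [coordSum_apply, Finset.sum_pi_single'] at this
  simp at this

/-- The `r`-dimensional subspaces on which the sum of the coordinates does not vanish. -/
def sumOpen (k ι : Type*) [Field k] [Fintype ι] (r : ℕ) : Set (Submodule k (ι → k)) :=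
  sepOpen (r := r) ⊤ {κ | coordSum k ι ∈ Submodule.span k (Set.range κ)}

/-- The coordinate sum is a combination of functionals that are independent on the span. If it
vanished there, all coefficients would be zero and the sum would be the zero functional. -/
theorem exists_sum_ne_zero_of_mem_sumOpen {ι : Type*} [Fintype ι] [Nonempty ι]
    {α : Fin r → ι → k} (h : Submodule.span k (Set.range α) ∈ sumOpen k ι r) :
    ∃ i, ∑ x, α i x ≠ 0 := by
  obtain ⟨hGr, κ, hκ, hsep⟩ := h
  obtain ⟨c, hc⟩ := (Submodule.mem_span_range_iff_exists_fun k).1 hκ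
  by_contra hcon
  push Not at hcon
  have hle : Submodule.span k (Set.range α) ≤ LinearMap.ker (coordSum k ι) := by
    refine Submodule.span_le.2 (Set.range_subset_iff.2 fun i => ?_)
    rw [SetLike.mem_coe, LinearMap.mem_ker, coordSum_apply, hcon]
  have hc0 := hsep.eq_zero_of_sum hGr (c := c) fun x hx => by
    have h1 : coordSum k ι x = 0 := hle hx
    rw [← hc, LinearMap.sum_apply] at h1
    exact h1
  rw [hc0] at hc
  refine coordSum_ne_zero (k := k) (ι := ι) ?_
  rw [← hc]
  simp

/-- The coordinate sum extends to an independent family of `r` functionals, and the span of a dual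
family of vectors is a point of the set. -/
theorem sumOpen_nonempty {ι : Type*} [Fintype ι] [Nonempty ι] (hr : 1 ≤ r)
    (hr' : r ≤ Fintype.card ι) : (sumOpen k ι r).Nonempty := by
  have h1 : Module.finrank k (Submodule.span k {coordSum k ι}) ≤ r :=
    (finrank_span_singleton_le _).trans hr
  have h2 : r ≤ Module.finrank k (⊤ : Submodule k (Module.Dual k (ι → k))) := by
    rwa [finrank_top, Subspace.dual_finrank_eq, Module.finrank_fintype_fun_eq_card]
  obtain ⟨M, hM, -, hMr⟩ := exists_submodule_between (le_top : Submodule.span k _ ≤ _) h1 h2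
  obtain ⟨κ, hκ, hκM⟩ := exists_basis_family hMr
  have h3 : ∀ i : Fin r, ∃ x : ι → k, ∀ j, κ j x = if i = j then 1 else 0 := fun i => by
    obtain ⟨φ, hφ⟩ := exists_functional hκ fun j => if i = j then (1 : k) else 0
    exact ⟨(Module.evalEquiv k (ι → k)).symm φ, fun j => by
      rw [Module.apply_evalEquiv_symm_apply, hφ]⟩
  choose u hu using h3
  obtain ⟨hGr, hsep⟩ := mem_Gr_and_separates (W := ⊤) (fun i => Submodule.mem_top) hu
  refine ⟨_, hGr, κ, ?_, hsep⟩
  rw [Set.mem_ofPred_eq, hκM]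
  exact hM (Submodule.mem_span_singleton_self _)

end SumOpen

/-! ### The open set G of spaces in general position -/

section InvariantOpen

variable {k : Type*} [Field k] {n r d : ℕ}

/-- Functionals on `R` given by elements of `S'_{-d}` whose span contains `allOnes`. -/
def onesTuples (k : Type*) [Field k] (n r d : ℕ) :
    Set (Fin r → Module.Dual k (MvPolynomial (Fin n) k)) :=
  {κ | ∃ w : Fin r → DP k n, (∀ j, w j ∈ invS k n d) ∧ (∀ j, κ j = (pair k n).flip (w j)) ∧
    allOnes k n d ∈ Submodule.span k (Set.range w)}

/-- Functionals on `R` given by elements of `S'_{-d}` whose span contains or is contained in the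
kernel of the sum of the variables. -/
def kerTuples (k : Type*) [Field k] (n r d : ℕ) :
    Set (Fin r → Module.Dual k (MvPolynomial (Fin n) k)) :=
  {κ | ∃ w : Fin r → DP k n, (∀ j, w j ∈ invS k n d) ∧ (∀ j, κ j = (pair k n).flip (w j)) ∧
    ((∀ j, w j ∈ kerSum k n d) ∨ kerSum k n d ≤ Submodule.span k (Set.range w))}

/-- The open subset of `Gr(r, R'_d)` of the spaces in general position. -/
def genericOpen (k : Type*) [Field k] (n r d : ℕ) : Set (Submodule k (MvPolynomial (Fin n) k)) :=
  sepOpen (invR k n d) (onesTuples k n r d) ∩ sepOpen (invR k n d) (kerTuples k n r d)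

theorem isZariskiOpen_genericOpen : IsZariskiOpen r (invR k n d) (genericOpen k n r d) :=
  (isZariskiOpen_sepOpen _ _).inter (isZariskiOpen_sepOpen _ _)

theorem allOnes_ne_zero (hn : 0 < n) : allOnes k n d ≠ 0 := by
  intro h
  have := DFunLike.congr_fun h (Finsupp.single ⟨0, hn⟩ d)
  rw [allOnes_apply, if_pos (Finsupp.degree_single _ _)] at this
  exact one_ne_zero this

theorem allOnes_notMem_perp (hn : 0 < n) (hr : 1 ≤ r) {U : Submodule k (MvPolynomial (Fin n) k)}
    (hU : U ∈ genericOpen k n r d) : allOnes k n d ∉ perp d U := by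
  obtain ⟨⟨hGr, κ, ⟨w, -, hκ, hw⟩, hsep⟩, -⟩ := hU
  have := finiteDimensional_of_mem_Gr hr hGr
  obtain ⟨c, hc⟩ := (Submodule.mem_span_range_iff_exists_fun k).1 hw
  intro hmem
  rw [mem_perp (hGr.1.trans (invR_le d))] at hmem
  have hc0 := hsep.eq_zero_of_sum hGr (c := c) fun x hx => by
    have h1 := hmem.2 x hx
    rw [← hc, map_sum] at h1
    simpa [hκ] using h1
  rw [hc0] at hc
  refine allOnes_ne_zero (k := k) (d := d) hn ?_
  rw [← hc]
  simp

/-- The space in question is the kernel of `kerSum → U*`. If the separating elements lie in `kerSum`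
this map is onto; if `kerSum` lies in their span it is injective. These are the two values of the
maximum. -/
theorem finrank_perp_inf_ker (hr : 1 ≤ r) {U : Submodule k (MvPolynomial (Fin n) k)}
    (hU : U ∈ genericOpen k n r d) :
    (Module.finrank k (perp d U ⊓ LinearMap.ker (contract k n (sumX k n)) : Submodule k (DP k n))
      : ℤ) = max ((Module.finrank k (kerSum k n d) : ℤ) - r) 0 := by
  obtain ⟨-, hGr, κ, ⟨w, -, hκ, hw⟩, hsep⟩ := hU
  have := finiteDimensional_of_mem_Gr hr hGr
  have hfd : FiniteDimensional k (kerSum k n d) := Submodule.finiteDimensional_of_le inf_le_left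
  have h1 : perp d U ⊓ LinearMap.ker (contract k n (sumX k n)) =
      kerSum k n d ⊓ LinearMap.ker (pairOn U) := by
    rw [perp_eq (hGr.1.trans (invR_le d)), kerSum, inf_right_comm]
  have h2 := finrank_map_add_finrank_inf_ker (kerSum k n d) (pairOn U)
  have h3 : Module.finrank k (Module.Dual k U) = r := by rw [Subspace.dual_finrank_eq, hGr.2]
  rw [h1]
  rcases hw with hw | hw
  · have h4 : (kerSum k n d).map (pairOn U) = ⊤ := by
      refine eq_top_iff.2 fun θ _ => ?_
      obtain ⟨c, hc⟩ := hsep.exists_sum hGr θ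
      refine ⟨∑ j, c j • w j, Submodule.sum_mem _ fun j _ => Submodule.smul_mem _ _ (hw j),
        LinearMap.ext fun x => ?_⟩
      rw [hc, pairOn_apply, map_sum]
      simp [hκ]
    rw [h4, finrank_top, h3] at h2
    omega
  · have h4 : kerSum k n d ⊓ LinearMap.ker (pairOn U) = ⊥ := by
      refine (Submodule.eq_bot_iff _).2 fun v ⟨hv, hv0⟩ => ?_
      obtain ⟨c, rfl⟩ := (Submodule.mem_span_range_iff_exists_fun k).1 (hw hv)
      have hc0 := hsep.eq_zero_of_sum hGr (c := c) fun x hx => by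
        have h5 := mem_ker_pairOn.1 hv0 x hx
        rw [map_sum] at h5
        simpa [hκ] using h5
      simp [hc0]
    rw [h4, finrank_bot, add_zero] at h2
    have h5 := Submodule.finrank_le ((kerSum k n d).map (pairOn U))
    rw [h4, finrank_bot]
    omega

/-- Contracting `allOnes` by the sum of the variables gives `n` as coefficient at each monomial of
degree `-d`. -/
theorem allOnes_notMem_kerSum (hn : (n : k) ≠ 0) : allOnes k n (d + 1) ∉ kerSum k n (d + 1) := by
  intro h
  have hn0 : 0 < n := Nat.pos_of_ne_zero fun h => hn (by simp [h])
  have h1 : contract k n (sumX k n) (allOnes k n (d + 1)) (Finsupp.single ⟨0, hn0⟩ d) = 0 := by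
    rw [show contract k n (sumX k n) (allOnes k n (d + 1)) = 0 from h.2]
    rfl
  refine hn ?_
  rw [← h1, sumX, map_sum, LinearMap.sum_apply, Finsupp.finsetSum_apply]
  simp_rw [contract_X_apply, allOnes_apply]
  simp [add_comm]

theorem exists_dual_forms (hF : (n.factorial : k) ≠ 0) {ι : Type*} {v : ι → DP k n}
    (hv : LinearIndependent k v) (hvd : ∀ x, v x ∈ invS k n d) (a : Fin r → ι → k) :
    ∃ u : Fin r → MvPolynomial (Fin n) k, (∀ i, u i ∈ invR k n d) ∧
      ∀ i x, pair k n (u i) (v x) = a i x := by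
  choose φ hφ using fun i => exists_functional hv (a i)
  choose u hu hu' using fun i => exists_invForm hF d (φ i)
  exact ⟨u, hu, fun i x => by rw [hu' i _ (hvd x), hφ]⟩

theorem genericOpen_nonempty (hF : (n.factorial : k) ≠ 0) (hn : (n : k) ≠ 0) (hr : 1 ≤ r)
    (hr' : r ≤ Module.finrank k (invS k n (d + 1))) : (genericOpen k n r (d + 1)).Nonempty := by
  have hones := allOnes_notMem_kerSum (d := d) hn
  have hfd : FiniteDimensional k (kerSum k n (d + 1)) :=
    Submodule.finiteDimensional_of_le inf_le_left
  by_cases hκ : r ≤ Module.finrank k (kerSum k n (d + 1))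
  · obtain ⟨b, hb, hbK⟩ := exists_basis_family (M := kerSum k n (d + 1)) rfl
    have hbmem : ∀ m, b m ∈ kerSum k n (d + 1) := fun m => by
      rw [← hbK]
      exact Submodule.subset_span ⟨m, rfl⟩
    have hv : LinearIndependent k (Fin.cons (allOnes k n (d + 1)) b : Fin _ → DP k n) :=
      linearIndependent_finCons.2 ⟨hb, by rwa [hbK]⟩
    have hvd : ∀ x, (Fin.cons (allOnes k n (d + 1)) b : Fin _ → DP k n) x ∈ invS k n (d + 1) := by
      intro x
      refine Fin.cases ?_ (fun m => ?_) x
      · exact allOnes_mem_invS _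
      · exact (hbmem m).1
    -- The `u i` are dual to the first `r` elements of `b`, and pair with `allOnes` as they do with
    -- the first of these. One space then meets both open conditions: by `w`, and by `w'` in which
    -- `allOnes` replaces that first element.
    obtain ⟨u, hu, hua⟩ := exists_dual_forms (r := r) hF hv hvd fun i =>
      Fin.cons (if i = ⟨0, hr⟩ then 1 else 0) fun m => if Fin.castLE hκ i = m then 1 else 0
    have hu0 : ∀ i, pair k n (u i) (allOnes k n (d + 1)) = if i = ⟨0, hr⟩ then 1 else 0 :=
      fun i => by simpa using hua i 0
    have hub : ∀ i j, pair k n (u i) (b (Fin.castLE hκ j)) = if i = j then 1 else 0 :=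
      fun i j => by simpa using hua i (Fin.succ (Fin.castLE hκ j))
    let w : Fin r → DP k n := fun j => b (Fin.castLE hκ j)
    let w' : Fin r → DP k n := Function.update w ⟨0, hr⟩ (allOnes k n (d + 1))
    obtain ⟨hGr, hsep⟩ := mem_Gr_and_separates (κ := fun j => (pair k n).flip (w j)) hu hub
    have hw' : ∀ i j, pair k n (u i) (w' j) = if i = j then 1 else 0 := by
      intro i j
      by_cases hj : j = ⟨0, hr⟩
      · rw [hj]
        simp only [w', Function.update_self]
        exact hu0 i
      · simp only [w', Function.update_of_ne hj]
        exact hub i j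
    obtain ⟨-, hsep'⟩ := mem_Gr_and_separates (κ := fun j => (pair k n).flip (w' j)) hu hw'
    refine ⟨_, ⟨hGr, _, ⟨w', fun j => ?_, fun j => rfl, ?_⟩, hsep'⟩,
      hGr, _, ⟨w, fun j => (hbmem _).1, fun j => rfl, Or.inl fun j => hbmem _⟩, hsep⟩
    · by_cases hj : j = ⟨0, hr⟩
      · rw [hj]
        simp only [w', Function.update_self]
        exact allOnes_mem_invS _
      · simp only [w', Function.update_of_ne hj]
        exact (hbmem _).1
    · exact Submodule.subset_span ⟨⟨0, hr⟩, by simp only [w', Function.update_self]⟩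
  -- Now `r` exceeds the dimension of `kerSum`, so a single `r`-dimensional space of invariants
  -- contains both `kerSum` and `allOnes`, and one family `w` serves both conditions.
  · have hle : kerSum k n (d + 1) ⊔ Submodule.span k {allOnes k n (d + 1)} ≤ invS k n (d + 1) :=
      sup_le inf_le_left ((Submodule.span_singleton_le_iff_mem _ _).2 (allOnes_mem_invS _))
    have hrank : Module.finrank k (kerSum k n (d + 1) ⊔
        Submodule.span k {allOnes k n (d + 1)} : Submodule k (DP k n)) ≤ r := by
      refine (Submodule.finrank_add_le_finrank_add_finrank _ _).trans ?_
      have := finrank_span_singleton_le (k := k) (allOnes k n (d + 1))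
      omega
    obtain ⟨M, hM, hMd, hMr⟩ := exists_submodule_between hle hrank hr'
    have hfdM : FiniteDimensional k M := Submodule.finiteDimensional_of_le hMd
    obtain ⟨w, hw, hwM⟩ := exists_basis_family hMr
    have hwd : ∀ j, w j ∈ invS k n (d + 1) := fun j => hMd (by
      rw [← hwM]
      exact Submodule.subset_span ⟨j, rfl⟩)
    obtain ⟨u, hu, hua⟩ := exists_dual_forms (r := r) hF hw hwd fun i j => if i = j then 1 else 0
    obtain ⟨hGr, hsep⟩ := mem_Gr_and_separates (κ := fun j => (pair k n).flip (w j)) hu hua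
    refine ⟨_, ⟨hGr, _, ⟨w, hwd, fun j => rfl, ?_⟩, hsep⟩, hGr, _,
      ⟨w, hwd, fun j => rfl, Or.inr ?_⟩, hsep⟩
    · rw [hwM]
      exact hM (Submodule.mem_sup_right (Submodule.mem_span_singleton_self _))
    · rw [hwM]
      exact le_sup_left.trans hM

end InvariantOpen

/-! ### Properties of the algebras for U in general position -/

section Narrow

variable {k : Type*} [Field k] {n r d : ℕ}

theorem factorial_cast_ne_zero (h : ringChar k = 0 ∨ n < ringChar k) :
    (n.factorial : k) ≠ 0 := by
  rw [Ne, ringChar.spec]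
  rcases h with h | h
  · rw [h, zero_dvd_iff]
    exact n.factorial_ne_zero
  · have hp := (CharP.char_is_prime_or_zero k (ringChar k)).resolve_right (by omega)
    rw [hp.dvd_factorial]
    omega

theorem natCast_ne_zero_of_factorial (hF : (n.factorial : k) ≠ 0) {m : ℕ} (hm : 0 < m)
    (hmn : m ≤ n) : (m : k) ≠ 0 := by
  intro h
  obtain ⟨c, hc⟩ := Nat.dvd_factorial hm hmn
  rw [hc, Nat.cast_mul, h, zero_mul] at hF
  exact hF rfl

theorem numPartitions_one : numPartitions 1 = 1 := Fintype.card_unique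

/-- Used only in two variables, to make the intersection of U^⊥ with `kerSum` trivial. -/
theorem numPartitions_two_le : numPartitions 2 ≤ 2 := by
  have h : ∀ μ : Nat.Partition 2, μ.parts = {2} ∨ μ.parts = {1, 1} := by
    intro μ
    have hsum := μ.parts_sum
    have hcard := card_le_sum_of_pos fun p hp => μ.parts_pos (i := p) hp
    have h0 : μ.parts.card ≠ 0 := fun h => by
      rw [Multiset.card_eq_zero.1 h] at hsum
      simp at hsum
    rcases (show μ.parts.card = 1 ∨ μ.parts.card = 2 by omega) with h1 | h2
    · obtain ⟨a, ha⟩ := Multiset.card_eq_one.1 h1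
      rw [ha, Multiset.sum_singleton] at hsum
      exact Or.inl (by rw [ha, hsum])
    · obtain ⟨a, b, hab⟩ := Multiset.card_eq_two.1 h2
      have ha := μ.parts_pos (i := a) (by simp [hab])
      have hb := μ.parts_pos (i := b) (by simp [hab])
      rw [hab, Multiset.sum_pair] at hsum
      exact Or.inr (by rw [hab, show a = 1 by omega, show b = 1 by omega])
  refine (Fintype.card_le_of_injective (fun μ : Nat.Partition 2 => decide (μ.parts = {2}))
    fun μ ν hμν => parts_injective 2 ?_).trans_eq Fintype.card_bool
  have hiff : μ.parts = {2} ↔ ν.parts = {2} := by simpa using hμν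
  rcases h μ with h1 | h1
  · rw [h1, hiff.1 h1]
  · rcases h ν with h2 | h2
    · rw [h2, hiff.2 h2]
    · rw [h1, h2]

theorem two_le_of_one_lt_numPartitions (hd : 0 < d) (h : 1 < numPartitions d) : 2 ≤ d := by
  rcases Nat.lt_or_ge d 2 with h1 | h1
  · obtain rfl : d = 1 := by omega
    rw [numPartitions_one] at h
    omega
  · exact h1

theorem finrank_perp_of_mem_Gr (hF : (n.factorial : k) ≠ 0) (hdn : d ≤ n)
    {U : Submodule k (MvPolynomial (Fin n) k)} (hU : U ∈ Gr r (invR k n d)) :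
    r + Module.finrank k (perp d U) = numPartitions d := by
  rw [← finrank_invS (k := k) hdn, ← finrank_perp hF hU.1, hU.2]

theorem perp_eq_bot (hF : (n.factorial : k) ≠ 0) (hdn : d ≤ n)
    {U : Submodule k (MvPolynomial (Fin n) k)} (hU : U ∈ Gr r (invR k n d))
    (hr : r = numPartitions d) : perp d U = ⊥ := by
  have := finrank_perp_of_mem_Gr hF hdn hU
  exact Submodule.finrank_eq_zero.1 (by omega)

theorem eq_zero_of_derivatives_mem_perp (hd : 0 < d) (hF : (n.factorial : k) ≠ 0) (hdn : d ≤ n)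
    (hr : 1 ≤ r) {U : Submodule k (MvPolynomial (Fin n) k)} (hU : U ∈ Gr r (invR k n d))
    (hones : allOnes k n d ∉ perp d U)
    (hn' : n = 2 → r < numPartitions d →
      perp d U ⊓ LinearMap.ker (contract k n (sumX k n)) = ⊥)
    {F : DP k n} (hFd : F ∈ formsS k n (d + 1)) (h : ∀ i, contract k n (X i) F ∈ perp d U) :
    F = 0 := by
  have hP := finrank_perp_of_mem_Gr hF hdn hU
  rcases (show r ≤ numPartitions d by omega).eq_or_lt with hrP | hrP
  · rw [perp_eq_bot hF hdn hU hrP] at h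
    exact eq_zero_of_forall_contract_X hFd h
  · obtain ⟨e, rfl⟩ : ∃ e, d = e + 1 := ⟨d - 1, by omega⟩
    have := two_le_of_one_lt_numPartitions hd (by omega)
    exact eq_zero_of_contract_X_mem (perp_le_invS _ U) hones (by omega) (fun h => hn' h hrP) hFd h

theorem formsR_ne_bot (hn : 0 < n) (i : ℕ) : formsR k n i ≠ ⊥ := by
  intro h
  have h1 : (X ⟨0, hn⟩ : MvPolynomial (Fin n) k) ^ i ∈ formsR k n i :=
    isHomogeneous_X_pow _ _
  rw [h, Submodule.mem_bot] at h1
  exact pow_ne_zero i (X_ne_zero _) h1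

/-- The linear forms that are not multiples of the sum of the variables contain a nonempty open
set, so maximal rank for all of them gives the weak Lefschetz property. -/
theorem hasWLP_of_hasMaximalRank {I : Ideal (MvPolynomial (Fin n) k)} (hn : 2 ≤ n)
    (h : ∀ l ∈ formsR k n 1, (∀ c : k, l ≠ c • sumX k n) → HasMaximalRank I l) : HasWLP I := by
  classical
  let i₀ : Fin n := ⟨0, by omega⟩
  let i₁ : Fin n := ⟨1, by omega⟩
  have h01 : i₀ ≠ i₁ := by simp [i₀, i₁, Fin.ext_iff]
  -- The difference of two coefficients vanishes on all multiples of the sum of the variables.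
  let K : Set (Fin 1 → Module.Dual k (MvPolynomial (Fin n) k)) :=
    {fun _ => lcoeff k (Finsupp.single i₀ 1) - lcoeff k (Finsupp.single i₁ 1)}
  refine ⟨sepOpen (formsR k n 1) K, isZariskiOpen_sepOpen _ _, ?_, fun l hl => ?_⟩
  · obtain ⟨hGr, hsep⟩ := mem_Gr_and_separates (W := formsR k n 1) (u := fun _ : Fin 1 => X i₀)
      (κ := fun _ : Fin 1 => lcoeff k (Finsupp.single i₀ 1) - lcoeff k (Finsupp.single i₁ 1))
      (fun _ => X_mem_formsR i₀) fun i j => by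
        simp [Subsingleton.elim i j, coeff_X, Finsupp.single_left_inj, h01]
    exact ⟨_, hGr, _, rfl, hsep⟩
  · obtain ⟨hGr, κ, rfl, hsep⟩ := hl
    have hl1 := Submodule.mem_span_singleton_self (R := k) l
    refine h l (hGr.1 hl1) fun c hc => ?_
    have h0 : l = 0 := by
      refine hsep l hl1 fun _ => ?_
      rw [hc]
      simp [sumX, coeff_X, Finsupp.single_left_inj]
    have h1 := hGr.2
    rw [h0, Submodule.span_zero_singleton, finrank_bot] at h1
    omega

/-- Every nonzero linear form has maximal rank here. The case stands apart because there may be only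
one variable, where all linear forms are multiples of the sum. -/
theorem hasWLP_of_perp_eq_bot {U : Submodule k (MvPolynomial (Fin n) k)} (hn : 0 < n)
    (hU : perp d U = ⊥) : HasWLP (psi d U) := by
  let K : Set (Fin 1 → Module.Dual k (MvPolynomial (Fin n) k)) := Set.univ
  refine ⟨sepOpen (formsR k n 1) K, isZariskiOpen_sepOpen _ _, ?_, fun l hl => ?_⟩
  · obtain ⟨hGr, hsep⟩ := mem_Gr_and_separates (W := formsR k n 1)
      (u := fun _ : Fin 1 => X ⟨0, hn⟩)
      (κ := fun _ : Fin 1 => lcoeff k (Finsupp.single ⟨0, hn⟩ 1))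
      (fun _ => X_mem_formsR _) fun i j => by simp [Subsingleton.elim i j]
    exact ⟨_, hGr, _, Set.mem_univ _, hsep⟩
  · have hGr := hl.1
    have hl1 := Submodule.mem_span_singleton_self (R := k) l
    refine hasMaximalRank_psi (hGr.1 hl1) (fun h0 => ?_) fun w hw _ => ?_
    · have h1 := hGr.2
      rw [h0, Submodule.span_zero_singleton, finrank_bot] at h1
      omega
    · rw [hU] at hw
      exact hw

theorem inverseSystem_inf_le {U : Submodule k (MvPolynomial (Fin n) k)} :
    inverseSystem (psi d U) ⊓ formsS k n d ≤ perp d U := by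
  rintro w ⟨hw, hwd⟩
  refine mem_of_annForms (perp_le d U) hwd fun f hf => ?_
  rw [← idealPart_psi] at hf
  simp only [inverseSystem, SetLike.mem_coe, Submodule.mem_iInf, LinearMap.mem_ker] at hw
  rw [pair_def, hw f hf.1]
  rfl

theorem exists_fin_basis_of_le {E : Type*} [AddCommGroup E] [Module k E] {M C : Submodule k E}
    [FiniteDimensional k C] (h : M ≤ C) :
    ∃ (a : ℕ) (F : Module.Basis (Fin a) k M), LinearIndependent k fun i => (F i : E) := by
  have : FiniteDimensional k M := Submodule.finiteDimensional_of_le h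
  exact ⟨_, Module.finBasis k M,
    (Module.finBasis k M).linearIndependent.map' M.subtype M.ker_subtype⟩

theorem isExtremelyNarrow_psi {U : Submodule k (MvPolynomial (Fin n) k)}
    (hones : allOnes k n (d + 1) ∉ perp (d + 1) U) (hs : IsTopSocleDegree (psi (d + 1) U) (d + 1))
    (ht : IsInitialDegree (psi (d + 1) U) (d + 1)) : IsExtremelyNarrow (d + 1) (psi (d + 1) U) := by
  obtain ⟨a, F, hF⟩ := exists_fin_basis_of_le
    (inf_le_right : inverseSystem (psi (d + 1) U) ⊓ formsS k n (d + 1) ≤ formsS k n (d + 1))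
  have hFZ : ∀ i, (F i : DP k n) ∈ perp (d + 1) U := fun i => inverseSystem_inf_le (F i).2
  have key : ∀ l : Fin a → MvPolynomial (Fin n) k, (∀ i, l i ∈ formsR k n 1) →
      ∑ i, contract k n (l i) (F i : DP k n) = 0 → ∃ c : Fin a → k, ∀ i, l i = c i • sumX k n :=
    fun l hl h => eq_smul_sumX_of_syzygy (perp_le_invS _ U) hones hF hFZ hl h
  exact ⟨fun f hf i => homogeneousComponent_mem_psi hf i, isArtinianRing_quotient_psi, hs, ht,
    a, F, sumX k n, sumX_mem_formsR, key⟩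

theorem hasNarrowProperties_of_mem_genericOpen (hF : (n.factorial : k) ≠ 0) (hdn : d + 1 ≤ n)
    (hr : 1 ≤ r) {U : Submodule k (MvPolynomial (Fin n) k)}
    (hU : U ∈ genericOpen k n r (d + 1)) : HasNarrowProperties (d + 1) r U := by
  have hn : 0 < n := by omega
  have hGr : U ∈ Gr r (invR k n (d + 1)) := hU.1.1
  have hUle : U ≤ formsR k n (d + 1) := hGr.1.trans (invR_le _)
  have hones := allOnes_notMem_perp hn hr hU
  have hP := finrank_perp_of_mem_Gr hF hdn hGr
  have hK := finrank_kerSum hF hn d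
  rw [finrank_invS hdn, finrank_invS (by omega : d ≤ n)] at hK
  have hinf := finrank_perp_inf_ker hr hU
  have hann := finrank_annForms (perp_le (d + 1) U)
  -- Here the degree is 2 and `r = 1`. The kernel of the sum has dimension P(2) - P(1) ≤ 1, so the
  -- expected dimension of the intersection is zero.
  have hn2 : n = 2 → r < numPartitions (d + 1) →
      perp (d + 1) U ⊓ LinearMap.ker (contract k n (sumX k n)) = ⊥ := by
    intro hn2 hrP
    have := two_le_of_one_lt_numPartitions d.add_one_pos (by omega)
    obtain rfl : d = 1 := by omega
    have : FiniteDimensional k ↥(perp (1 + 1) U ⊓ LinearMap.ker (contract k n (sumX k n))) :=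
      Submodule.finiteDimensional_of_le inf_le_left
    refine Submodule.finrank_eq_zero.1 ?_
    have h1 := numPartitions_one
    have h2 : numPartitions (1 + 1) ≤ 2 := numPartitions_two_le
    omega
  have hinit : IsInitialDegree (psi (d + 1) U) (d + 1) := by
    refine isInitialDegree_psi fun h => ?_
    have hle : U ≤ annForms (d + 1) (perp (d + 1) U) := fun u hu =>
      mem_annForms.2 ⟨hUle hu, fun w hw => ((mem_perp hUle).1 hw).2 u hu⟩
    have h1 := hGr.2
    rw [h, le_bot_iff] at hle
    rw [hle, finrank_bot] at h1
    omega
  have hsoc := finrank_soclePart_self (d := d + 1) (U := U)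
  have htop : r < numPartitions (d + 1) → IsTopSocleDegree (psi (d + 1) U) (d + 1) := by
    refine fun hrP => ⟨fun h => ?_, fun i hi => ?_⟩
    · rw [h, finrank_bot] at hsoc
      omega
    · by_contra h
      exact hi (soclePart_of_lt (not_le.1 h))
  have hmax : r < numPartitions (d + 1) → ∀ l ∈ formsR k n 1,
      (∀ c : k, l ≠ c • sumX k n) → HasMaximalRank (psi (d + 1) U) l := fun _ l hl hl' =>
    hasMaximalRank_psi hl (fun h => hl' 0 (by rw [h, zero_smul])) fun w hw h =>
      eq_zero_of_contract_linear (perp_le_invS _ U) hones hl hl' hw h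
  refine
    { narrow := ⟨fun f hf i => homogeneousComponent_mem_psi hf i, isArtinianRing_quotient_psi, ?_⟩
      dim_eq := ?_
      eq_pow := fun h => psi_eq_pow (perp_eq_bot hF hdn hGr h)
      extremelyNarrow := fun h => isExtremelyNarrow_psi hones (htop h) hinit
      socle := fun hrP i => ?_
      generated := psi_eq_span_idealPart fun F hFd h =>
        eq_zero_of_derivatives_mem_perp d.add_one_pos hF hdn hr hGr hones hn2 hFd h
      wlp := ?_
      maximalRank := hmax }
  · rcases (show r ≤ numPartitions (d + 1) by omega).eq_or_lt with hrP | hrP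
    · have hbot := perp_eq_bot hF hdn hGr hrP
      -- If U^⊥ is zero, the ideal is the power of the maximal ideal with exponent `d + 1`, and the
      -- socle is all of R_d.
      refine ⟨d, d + 1, ⟨fun h => ?_, fun i hi => ?_⟩, hinit, Nat.le_succ d⟩
      · have h1 := finrank_soclePart_pred (U := U) (i := d) rfl
        rw [h, hbot, derivs] at h1
        have h2 : ⨆ j : Fin n, (⊥ : Submodule k (DP k n)).map (contract k n (X j)) = ⊥ := by
          simp only [Submodule.map_bot, iSup_bot]
        rw [h2, finrank_bot, finrank_bot] at h1
        exact formsR_ne_bot hn d (Submodule.finrank_eq_zero.1 h1.symm)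
      · by_contra h
        rcases (Nat.succ_le_of_lt (not_le.1 h)).eq_or_lt with h1 | h1
        · rw [hbot, finrank_bot] at hsoc
          have hfd : FiniteDimensional k (soclePart (psi (d + 1) U) (d + 1)) := by
            rw [soclePart_eq_map]
            have : FiniteDimensional k (socForms (psi (d + 1) U) (d + 1)) :=
              Submodule.finiteDimensional_of_le inf_le_left
            infer_instance
          refine hi ?_
          rw [← h1]
          exact Submodule.finrank_eq_zero.1 hsoc
        · exact hi (soclePart_of_lt h1)
    · exact ⟨d + 1, d + 1, htop hrP, hinit, le_rfl⟩
  · rw [idealPart_psi]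
    omega
  · rw [Nat.add_sub_cancel]
    split_ifs with h1 h2
    · subst h1
      -- The socle in degree `i` has dimension dim R_i - dim R_1∘U^⊥, and dim R_1∘U^⊥ is `n` dim U^⊥
      -- minus the dimension of the part of U^⊥ killed by the sum of the variables.
      have h3 := finrank_soclePart_pred (U := U) (i := i) rfl
      have h4 := finrank_derivs hn (perp_le_invS _ U) hones
      have h5 : (Module.finrank k (perp (i + 1) U) : ℤ) = numPartitions (i + 1) - r := by omega
      have h6 : ((Module.finrank k (kerSum k n (i + 1)) : ℤ)) =
          numPartitions (i + 1) - numPartitions i := by omega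
      rw [h6] at hinf
      rw [← h5, ← hinf]
      zify at h3 h4
      linarith
    · subst h2
      omega
    · rcases Nat.lt_or_ge i d with h3 | h3
      · rw [soclePart_of_succ_lt hn (by omega), finrank_bot]
        rfl
      · rw [soclePart_of_lt (by omega), finrank_bot]
        rfl
  · rcases (show r ≤ numPartitions (d + 1) by omega).eq_or_lt with hrP | hrP
    · exact hasWLP_of_perp_eq_bot hn (perp_eq_bot hF hdn hGr hrP)
    · have := two_le_of_one_lt_numPartitions d.add_one_pos (by omega)
      exact hasWLP_of_hasMaximalRank (by omega) (hmax hrP)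

end Narrow

/-! ### Generators up to symmetry -/

section Generators

variable {k : Type*} [Field k] {n r d : ℕ} {ord : LinearOrder (Nat.Partition d)}
  {α : Fin r → Nat.Partition d → k} {f : Fin r → MvPolynomial (Fin n) k}
  {U V : Submodule k (MvPolynomial (Fin n) k)}

theorem map_reynolds_span (hf : ∀ i, IsFForm ord (α i) (f i))
    (hU : U = Submodule.span k (Set.range fun i => ∑ μ, α i μ • symM k n μ))
    (hV : V = Submodule.span k (Set.range f)) : V.map (reynolds k n) = U := by
  rw [hU, hV, Submodule.map_span, ← Set.range_comp]
  congr 2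
  funext i
  exact (hf i).reynolds_eq

/-- The averages of the `f i` are the given spanning vectors of `U`. There are `r = dim U` of them,
so they are independent, and hence so are the `f i`. -/
theorem span_fForms_mem_Gr (hf : ∀ i, IsFForm ord (α i) (f i))
    (hU : U = Submodule.span k (Set.range fun i => ∑ μ, α i μ • symM k n μ))
    (hGr : U ∈ Gr r (invR k n d)) (hV : V = Submodule.span k (Set.range f)) :
    V ∈ Gr r (formsR k n d) := by
  have h1 : LinearIndependent k fun i => ∑ μ, α i μ • symM k n μ := by
    rw [linearIndependent_iff_card_eq_finrank_span, Fintype.card_fin, Set.finrank, ← hU, hGr.2]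
  have h2 : LinearIndependent k f := by
    refine LinearIndependent.of_comp (reynolds k n) ?_
    convert h1 using 1
    funext i
    exact (hf i).reynolds_eq
  rw [hV]
  exact ⟨Submodule.span_le.2 (Set.range_subset_iff.2 fun i => (hf i).mem_formsR), by
    rw [finrank_span_eq_card h2, Fintype.card_fin]⟩

/-- An invariant pairs with every element of an orbit as with the average, and the averages of `V`
form `U`. So, once elements orthogonal to the orbit of `V` are known to be invariant, they are
exactly U^⊥, and duality gives the ideal. -/
theorem psi_eq_symIdeal (hd : 0 < d) (hF : (n.factorial : k) ≠ 0) (hr : 1 ≤ r)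
    (hf : ∀ i, IsFForm ord (α i) (f i))
    (hU : U = Submodule.span k (Set.range fun i => ∑ μ, α i μ • symM k n μ))
    (hGr : U ∈ Gr r (invR k n d)) (hV : V = Submodule.span k (Set.range f))
    (hgen : ∀ F ∈ formsS k n (d + 1), (∀ i, contract k n (X i) F ∈ perp d U) → F = 0) :
    psi d U = symIdeal V := by
  have hVGr := span_fForms_mem_Gr hf hU hGr hV
  have hUle : U ≤ formsR k n d := hGr.1.trans (invR_le d)
  have hmap := map_reynolds_span hf hU hV
  refine le_antisymm ?_ ?_
  · refine (psi_le_span (D := Submodule.span k {g | ∃ σ : Equiv.Perm (Fin n), ∃ f ∈ V,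
      g = rename σ f}) (Submodule.span_le.2 ?_) (fun w hw h => ?_) hgen).trans
        (Ideal.span_le.2 ?_)
    · rintro _ ⟨σ, g, hg, rfl⟩
      exact rename_mem_formsR σ (hVGr.1 hg)
    · have h1 : ∀ (σ : Equiv.Perm (Fin n)), ∀ g ∈ V, pair k n (rename σ g) w = 0 :=
        fun σ g hg => h _ (Submodule.subset_span ⟨σ, g, hg, rfl⟩)
      have hfV : ∀ i, f i ∈ V := fun i => by
        rw [hV]
        exact Submodule.subset_span ⟨i, rfl⟩
      -- A single one of the forms already forces invariance.
      have hwinv : w ∈ invS k n d := (hf ⟨0, hr⟩).mem_invS hd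
        (fun h2 => by exact_mod_cast natCast_ne_zero_of_factorial hF two_pos h2) hw
        fun σ => h1 σ _ (hfV _)
      refine (mem_perp hUle).2 ⟨hwinv, ?_⟩
      rw [← hmap]
      rintro _ ⟨g, hg, rfl⟩
      rw [pair_reynolds hF g hwinv]
      simpa using h1 1 g hg
    · change _ ≤ (symIdeal V).restrictScalars k
      exact Submodule.span_le.2 fun g hg => Ideal.subset_span hg
  · refine Ideal.span_le.2 ?_
    rintro _ ⟨σ, g, hg, rfl⟩
    refine (mem_psi_of_mem_formsR (rename_mem_formsR σ (hVGr.1 hg))).2 fun w hw => ?_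
    have hw' := (mem_perp hUle).1 hw
    rw [pair_rename_left σ g hw'.1, ← pair_reynolds hF g hw'.1]
    refine hw'.2 _ ?_
    rw [← hmap]
    exact ⟨g, hg, rfl⟩

/-- This turns the condition on coordinate sums that defines `sumOpen` into `allOnes` not being in
U^⊥, for every `n` at once. -/
theorem pair_symM_allOnes (hF : (n.factorial : k) ≠ 0) (hdn : d ≤ n) (μ : Nat.Partition d) :
    pair k n (symM k n μ) (allOnes k n d) = 1 := by
  rw [symM, pair_reynolds hF _ (allOnes_mem_invS d), pair_monomial, allOnes_apply,
    if_pos (degree_partExponent hdn μ), one_mul]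

theorem allOnes_notMem_perp_of_sum_ne_zero (hF : (n.factorial : k) ≠ 0) (hdn : d ≤ n)
    (hU : U = Submodule.span k (Set.range fun i => ∑ μ, α i μ • symM k n μ))
    (hGr : U ∈ Gr r (invR k n d)) {i : Fin r} (hi : ∑ μ, α i μ ≠ 0) :
    allOnes k n d ∉ perp d U := by
  intro h
  refine hi ?_
  have h1 := ((mem_perp (hGr.1.trans (invR_le d))).1 h).2 (∑ μ, α i μ • symM k n μ) (by
    rw [hU]
    exact Submodule.subset_span ⟨i, rfl⟩)
  rw [map_sum, LinearMap.sum_apply] at h1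
  rw [← h1]
  refine Finset.sum_congr rfl fun μ _ => ?_
  rw [map_smul, LinearMap.smul_apply, pair_symM_allOnes hF hdn, smul_eq_mul, mul_one]

end Generators

/-! ### Existence of the forms f_α in a bounded number of variables -/

section Existence

variable {n d : ℕ}

/-- The exponent with the entries of `l` at the places `o, o + 1, …`. -/
def place (n o : ℕ) (l : List ℕ) : Fin n →₀ ℕ :=
  Finsupp.equivFunOnFinite.symm fun i => if o ≤ i then l.getD (i - o) 0 else 0

theorem place_apply (o : ℕ) (l : List ℕ) (i : Fin n) :
    place n o l i = if o ≤ i then l.getD (i - o) 0 else 0 := rfl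

theorem bounds_of_place_ne_zero {o : ℕ} {l : List ℕ} {i : Fin n} (h : place n o l i ≠ 0) :
    o ≤ i ∧ (i : ℕ) < o + l.length := by
  rw [place_apply] at h
  split_ifs at h with h1
  · refine ⟨h1, ?_⟩
    by_contra h2
    exact h (List.getD_eq_default _ _ (by omega))
  · exact absurd rfl h

theorem place_eq {o : ℕ} {l : List ℕ} (h : o + l.length ≤ n) :
    place n o l = Finsupp.mapDomain (Fin.castLE h ∘ Fin.natAdd o) (listExp l) := by
  have hinj : Function.Injective (Fin.castLE h ∘ Fin.natAdd o) :=
    (Fin.castLE_injective h).comp (Fin.natAdd_injective _ o)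
  ext i
  by_cases hi : o ≤ (i : ℕ) ∧ (i : ℕ) < o + l.length
  · have hi' : (i : ℕ) - o < l.length := by omega
    have h1 : i = (Fin.castLE h ∘ Fin.natAdd o) ⟨i - o, hi'⟩ := by
      ext
      simp only [Function.comp_apply, Fin.val_castLE, Fin.val_natAdd]
      omega
    conv_rhs => rw [h1, Finsupp.mapDomain_apply hinj]
    rw [place_apply, if_pos hi.1]
    exact List.getD_eq_getElem _ _ hi'
  · rw [Finsupp.mapDomain_of_notMem_range]
    · by_contra h1
      exact hi (bounds_of_place_ne_zero h1)
    · rintro ⟨j, rfl⟩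
      refine hi ?_
      simp only [Function.comp_apply, Fin.val_castLE, Fin.val_natAdd]
      omega

theorem monType_place {o : ℕ} {l : List ℕ} (h : o + l.length ≤ n) (hl : ∀ p ∈ l, p ≠ 0) :
    monType (place n o l) = l := by
  rw [place_eq h, monType_mapDomain ((Fin.castLE_injective h).comp (Fin.natAdd_injective _ o)),
    monType_listExp hl]

theorem mapDomain_castLE_place {N o : ℕ} {l : List ℕ} (h : o + l.length ≤ N) (hN : N ≤ n) :
    Finsupp.mapDomain (Fin.castLE hN) (place N o l) = place n o l := by
  rw [place_eq h, place_eq (h.trans hN), ← Finsupp.mapDomain_comp]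
  rfl

variable {k : Type*} [Field k]

/-- A binomial of type `μ` with greatest common divisor of type `γ`, in the variables with index
in `[B, B + 3d)`. -/
def blockBinomial (k : Type*) [Field k] (n d B : ℕ) (μ γ : Multiset ℕ) :
    MvPolynomial (Fin n) k :=
  monomial (place n B γ.toList + place n (B + d) (μ - γ).toList) 1 -
    monomial (place n B γ.toList + place n (B + 2 * d) (μ - γ).toList) 1

theorem card_le_of_le_parts {μ : Nat.Partition d} {γ : Multiset ℕ} (h : γ ≤ μ.parts) :
    γ.card ≤ d :=
  (Multiset.card_le_card h).trans
    ((card_le_sum_of_pos fun _ hp => μ.parts_pos hp).trans μ.parts_sum.le)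

/-- The block splits into three runs of `d` variables: the common factor of type `γ`, then two
disjoint copies of a monomial of type `μ - γ`. A subpartition of `μ` has at most `d` parts, so each
fits. -/
theorem isAdmissibleBinomial_blockBinomial {B : ℕ} (hB : B + 3 * d ≤ n) {μ : Nat.Partition d}
    {γ : Multiset ℕ} (hγ : γ < μ.parts) :
    IsAdmissibleBinomial μ γ (blockBinomial k n d B μ.parts γ) := by
  have h1 : γ.toList.length ≤ d := by
    rw [Multiset.length_toList]
    exact card_le_of_le_parts hγ.le
  have h2 : (μ.parts - γ).toList.length ≤ d := by
    rw [Multiset.length_toList]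
    exact card_le_of_le_parts (Multiset.sub_le_self _ _)
  have hpos : ∀ δ ≤ μ.parts, ∀ p ∈ δ.toList, p ≠ 0 := fun δ hδ p hp =>
    (μ.parts_pos (Multiset.mem_of_le hδ (Multiset.mem_toList.1 hp))).ne'
  set g := place n B γ.toList with hg
  set a := place n (B + d) (μ.parts - γ).toList with ha
  set a' := place n (B + 2 * d) (μ.parts - γ).toList with ha'
  have tg : monType g = γ := by
    rw [hg, monType_place (by omega) (hpos γ hγ.le), Multiset.coe_toList]
  have ta : monType a = μ.parts - γ := by
    rw [ha, monType_place (by omega) (hpos _ (Multiset.sub_le_self _ _)), Multiset.coe_toList]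
  have ta' : monType a' = μ.parts - γ := by
    rw [ha', monType_place (by omega) (hpos _ (Multiset.sub_le_self _ _)), Multiset.coe_toList]
  have dga : Disjoint g.support a.support := Finset.disjoint_left.2 fun i hi hi' => by
    have h3 := bounds_of_place_ne_zero (Finsupp.mem_support_iff.1 hi)
    have h4 := bounds_of_place_ne_zero (Finsupp.mem_support_iff.1 hi')
    omega
  have dga' : Disjoint g.support a'.support := Finset.disjoint_left.2 fun i hi hi' => by
    have h3 := bounds_of_place_ne_zero (Finsupp.mem_support_iff.1 hi)
    have h4 := bounds_of_place_ne_zero (Finsupp.mem_support_iff.1 hi')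
    omega
  have daa' : ∀ i, a i = 0 ∨ a' i = 0 := fun i => by
    by_contra hcon
    push Not at hcon
    have h3 := bounds_of_place_ne_zero hcon.1
    have h4 := bounds_of_place_ne_zero hcon.2
    omega
  have hinf : (g + a) ⊓ (g + a') = g := by
    ext i
    rw [Finsupp.inf_apply, Finsupp.add_apply, Finsupp.add_apply]
    rcases daa' i with h | h <;> simp [h]
  have hsum : γ + (μ.parts - γ) = μ.parts := add_tsub_cancel_of_le hγ.le
  refine ⟨g + a, g + a', rfl, fun h => ?_, by rw [monType_add dga, tg, ta, hsum],
    by rw [monType_add dga', tg, ta', hsum], by rw [hinf, tg], ?_, ?_⟩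
  -- If the two monomials agreed, `a = a'` with disjoint supports would vanish, giving `γ = μ`
  -- against properness.
  · have haa := add_left_cancel h
    have ha0 : a = 0 := by
      ext i
      rcases daa' i with h | h
      · exact h
      · rw [haa]
        exact h
    rw [ha0] at ta
    rw [← ta] at hsum
    refine hγ.ne ?_
    rw [← hsum]
    simp [monType]
  · rwa [hinf, add_tsub_cancel_left]
  · rwa [hinf, add_tsub_cancel_left]

theorem bounds_of_mem_vars_blockBinomial {B : ℕ} {μ : Nat.Partition d} {γ : Multiset ℕ}
    (hγ : γ < μ.parts) {i : Fin n} (hi : i ∈ (blockBinomial k n d B μ.parts γ).vars) :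
    B ≤ i ∧ (i : ℕ) < B + 3 * d := by
  classical
  have h1 : γ.toList.length ≤ d := by
    rw [Multiset.length_toList]
    exact card_le_of_le_parts hγ.le
  have h2 : (μ.parts - γ).toList.length ≤ d := by
    rw [Multiset.length_toList]
    exact card_le_of_le_parts (Multiset.sub_le_self _ _)
  have key : ∀ o, B ≤ o → o + d ≤ B + 3 * d →
      (place n B γ.toList + place n o (μ.parts - γ).toList) i ≠ 0 →
      B ≤ i ∧ (i : ℕ) < B + 3 * d := by
    intro o ho ho' h
    by_cases h3 : place n B γ.toList i = 0
    · rw [Finsupp.add_apply, h3, zero_add] at h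
      have := bounds_of_place_ne_zero h
      omega
    · have := bounds_of_place_ne_zero h3
      omega
  have h3 := vars_sub_subset _ hi
  rw [Finset.mem_union, vars_monomial one_ne_zero, vars_monomial one_ne_zero,
    Finsupp.mem_support_iff, Finsupp.mem_support_iff] at h3
  rcases h3 with h3 | h3
  · exact key _ (by omega) (by omega) h3
  · exact key _ (by omega) (by omega) h3

theorem rename_castLE_blockBinomial {N B : ℕ} (hB : B + 3 * d ≤ N) (hN : N ≤ n)
    {μ : Nat.Partition d} {γ : Multiset ℕ} (hγ : γ < μ.parts) :
    rename (Fin.castLE hN) (blockBinomial k N d B μ.parts γ) = blockBinomial k n d B μ.parts γ := by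
  have h1 : γ.toList.length ≤ d := by
    rw [Multiset.length_toList]
    exact card_le_of_le_parts hγ.le
  have h2 : (μ.parts - γ).toList.length ≤ d := by
    rw [Multiset.length_toList]
    exact card_le_of_le_parts (Multiset.sub_le_self _ _)
  rw [blockBinomial, map_sub, rename_monomial, rename_monomial, Finsupp.mapDomain_add,
    Finsupp.mapDomain_add, mapDomain_castLE_place (by omega), mapDomain_castLE_place (by omega),
    mapDomain_castLE_place (by omega)]
  rfl

theorem lt_of_mem_vars_hForm {α : Nat.Partition d → k} {i : Fin n} (hi : i ∈ (hForm n α).vars) :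
    (i : ℕ) < d := by
  classical
  obtain ⟨μ, -, hμ⟩ := Finset.mem_biUnion.1 (vars_sum_subset _ _ hi)
  obtain ⟨e, he, hie⟩ := (mem_vars_iff_mem_support i).1 hμ
  rw [Finset.mem_singleton.1 (support_monomial_subset he), Finsupp.mem_support_iff] at hie
  by_contra h
  refine hie (List.getD_eq_default _ _ ?_)
  exact (length_sort_parts_le μ).trans (not_lt.1 h)

theorem rename_castLE_hForm {N : ℕ} (hdN : d ≤ N) (hN : N ≤ n) (α : Nat.Partition d → k) :
    rename (Fin.castLE hN) (hForm N α) = hForm n α := by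
  rw [hForm, hForm, map_sum]
  refine Finset.sum_congr rfl fun μ _ => ?_
  rw [rename_monomial, partExponent_eq μ hdN, partExponent_eq μ (hdN.trans hN),
    ← Finsupp.mapDomain_comp]
  rfl

/-- The pairs of a partition of `d` and a proper subpartition. -/
def subpartitionPairs (d : ℕ) : Finset (Σ _ : Nat.Partition d, Multiset ℕ) :=
  Finset.univ.sigma fun μ => Finset.Iio μ.parts

/-- The first index of the block of variables reserved for `b(μ, γ)`. -/
def blockStart {d : ℕ} (μ : Nat.Partition d) (γ : Multiset ℕ) : ℕ :=
  d + 3 * d * (subpartitionPairs d).toList.idxOf ⟨μ, γ⟩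

/-- A number of variables in which all forms `f_α` of degree `d` can be constructed. -/
def numVars (d : ℕ) : ℕ := d + 3 * d * (subpartitionPairs d).card

theorem mem_toList_subpartitionPairs {μ : Nat.Partition d} {γ : Multiset ℕ} (hγ : γ < μ.parts) :
    (⟨μ, γ⟩ : Σ _ : Nat.Partition d, Multiset ℕ) ∈ (subpartitionPairs d).toList := by
  rw [Finset.mem_toList]
  exact Finset.mem_sigma.2 ⟨Finset.mem_univ _, Finset.mem_Iio.2 hγ⟩

theorem blockStart_add_le {μ : Nat.Partition d} {γ : Multiset ℕ} (hγ : γ < μ.parts) :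
    blockStart μ γ + 3 * d ≤ numVars d := by
  have h := List.idxOf_lt_length_of_mem (mem_toList_subpartitionPairs hγ)
  rw [Finset.length_toList] at h
  rw [blockStart, numVars, add_assoc, ← Nat.mul_succ]
  exact Nat.add_le_add_left (Nat.mul_le_mul_left _ h) _

theorem blockStart_add_le_of_ne {μ μ' : Nat.Partition d} {γ γ' : Multiset ℕ} (hγ : γ < μ.parts)
    (h : (μ, γ) ≠ (μ', γ')) :
    blockStart μ γ + 3 * d ≤ blockStart μ' γ' ∨ blockStart μ' γ' + 3 * d ≤ blockStart μ γ := by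
  have hne : (subpartitionPairs d).toList.idxOf ⟨μ, γ⟩ ≠
      (subpartitionPairs d).toList.idxOf ⟨μ', γ'⟩ := by
    intro heq
    have h1 := (List.idxOf_inj (mem_toList_subpartitionPairs hγ)).1 heq
    refine h ?_
    simpa using h1
  simp only [blockStart, add_assoc, ← Nat.mul_succ]
  rcases Nat.lt_or_gt_of_ne hne with h1 | h1
  · exact Or.inl (Nat.add_le_add_left (Nat.mul_le_mul_left _ h1) _)
  · exact Or.inr (Nat.add_le_add_left (Nat.mul_le_mul_left _ h1) _)

/-- `h_α` occupies the first `d` variables and each pair `(μ, γ)` has its own later block. Blocks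
are reserved for all pairs, including those with `μ = τ`, so the number of variables does not depend
on `α`, the order or the field. -/
theorem exists_isFForm (ord : LinearOrder (Nat.Partition d)) {α : Nat.Partition d → k}
    (hα : α ≠ 0) :
    ∃ f : MvPolynomial (Fin (numVars d)) k, ∀ (n : ℕ) (h : numVars d ≤ n),
      IsFForm ord α (rename (Fin.castLE h) f) := by
  classical
  have hd : d ≤ numVars d := Nat.le_add_right _ _
  obtain ⟨τ, hτ, hmin⟩ : ∃ τ : Nat.Partition d, α τ ≠ 0 ∧ ∀ μ, α μ ≠ 0 → ord.le τ μ := by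
    have hne : (Finset.univ.filter fun μ : Nat.Partition d => α μ ≠ 0).Nonempty := by
      obtain ⟨μ, hμ⟩ := Function.ne_iff.1 hα
      exact ⟨μ, Finset.mem_filter.2 ⟨Finset.mem_univ _, hμ⟩⟩
    refine ⟨@Finset.min' _ ord _ hne,
      (Finset.mem_filter.1 (@Finset.min'_mem _ ord _ hne)).2, fun μ hμ => ?_⟩
    exact @Finset.min'_le _ ord _ μ (Finset.mem_filter.2 ⟨Finset.mem_univ _, hμ⟩)
  refine ⟨hForm (numVars d) α +
    ∑ μ ∈ Finset.univ.filter (fun μ : Nat.Partition d => μ ≠ τ),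
      ∑ γ ∈ Finset.Iio μ.parts, blockBinomial k (numVars d) d (blockStart μ γ) μ.parts γ,
    fun n h => ⟨hd.trans h, τ, hτ, hmin,
      fun μ γ => blockBinomial k n d (blockStart μ γ) μ.parts γ, fun μ _ γ hγ => ⟨?_, ?_⟩,
      fun μ μ' _ _ γ γ' hγ hγ' hne => ?_, ?_⟩⟩
  · exact isAdmissibleBinomial_blockBinomial ((blockStart_add_le hγ).trans h) hγ
  · refine Finset.disjoint_left.2 fun i hi hi' => ?_
    have h1 := (bounds_of_mem_vars_blockBinomial hγ hi).1
    have h2 := lt_of_mem_vars_hForm hi'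
    have h3 : d ≤ blockStart μ γ := Nat.le_add_right _ _
    omega
  · refine Finset.disjoint_left.2 fun i hi hi' => ?_
    have h1 := bounds_of_mem_vars_blockBinomial hγ hi
    have h2 := bounds_of_mem_vars_blockBinomial hγ' hi'
    have h3 := blockStart_add_le_of_ne hγ hne
    omega
  · rw [map_add, rename_castLE_hForm hd, map_sum]
    congr 1
    refine Finset.sum_congr rfl fun μ _ => ?_
    rw [map_sum]
    exact Finset.sum_congr rfl fun γ hγ => rename_castLE_blockBinomial
      (blockStart_add_le (Finset.mem_Iio.1 hγ)) h (Finset.mem_Iio.1 hγ)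

end Existence

end SymIdeal

end

theorem mainTheorem7 (d : ℕ) (hd : 0 < d) :
    ∃ N : ℕ, ∀ (k : Type*) [Field k],
      -- the construction is possible in `N` variables, with the same outcome in all `n ≥ N` variables
      (∀ (ord : LinearOrder (Nat.Partition d)) (α : Nat.Partition d → k), α ≠ 0 →
        ∃ f : MvPolynomial (Fin N) k, ∀ (n : ℕ) (h : N ≤ n),
          IsFForm ord α (rename (Fin.castLE h) f)) ∧
      ∀ r : ℕ, 1 ≤ r → r ≤ numPartitions d →
        -- a nonempty open subset of `Gr(r, k^{P(d)})` that does not depend on `n`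
        ∃ G₀ : Set (Submodule k (Nat.Partition d → k)),
          IsZariskiOpen r ⊤ G₀ ∧ G₀.Nonempty ∧
          ∀ n : ℕ, d ≤ n → (ringChar k = 0 ∨ n < ringChar k) →
            -- a nonempty open subset of `Gr(r, R'_d)`
            ∃ G : Set (Submodule k (MvPolynomial (Fin n) k)),
              IsZariskiOpen r (invR k n d) G ∧ G.Nonempty ∧
              (∀ U ∈ G, HasNarrowProperties d r U) ∧
              ∀ (ord : LinearOrder (Nat.Partition d)) (α : Fin r → Nat.Partition d → k)
                (f : Fin r → MvPolynomial (Fin n) k)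
                (U V : Submodule k (MvPolynomial (Fin n) k)),
                (∀ i, IsFForm ord (α i) (f i)) →
                U = Submodule.span k (Set.range fun i => ∑ μ, α i μ • symM k n μ) →
                U ∈ Gr r (invR k n d) →
                V = Submodule.span k (Set.range f) →
                V ∈ Gr r (formsR k n d) ∧
                U = Submodule.span k (reynolds k n '' V) ∧
                (U ∈ G → annR (perp d U ⊔ lowS k n d) = symIdeal V) ∧
                (Submodule.span k (Set.range α) ∈ G₀ →
                  annR (perp d U ⊔ lowS k n d) = symIdeal V) := by
  refine ⟨numVars d, fun k _ => ⟨fun ord α hα => exists_isFForm ord hα, fun r hr hrP =>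
    ⟨sumOpen k (Nat.Partition d) r, isZariskiOpen_sepOpen _ _, sumOpen_nonempty hr hrP,
      fun n hdn hchar => ?_⟩⟩⟩
  have hF : (n.factorial : k) ≠ 0 := factorial_cast_ne_zero hchar
  have hn : 0 < n := hd.trans_le hdn
  refine ⟨genericOpen k n r d, isZariskiOpen_genericOpen, ?_, fun U hU => ?_,
    fun ord α f U V hf hU hGr hV => ?_⟩
  · obtain ⟨e, rfl⟩ : ∃ e, d = e + 1 := ⟨d - 1, by omega⟩
    exact genericOpen_nonempty hF (natCast_ne_zero_of_factorial hF hn le_rfl) hr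
      (by rwa [finrank_invS hdn])
  · obtain ⟨e, rfl⟩ : ∃ e, d = e + 1 := ⟨d - 1, by omega⟩
    exact hasNarrowProperties_of_mem_genericOpen hF hdn hr hU
  -- The extra condition needed in two variables is vacuous here: if `r < P(d)` there are at least
  -- two partitions, and the existence of a form f_α then forces `n ≥ 3`. So avoiding `allOnes`
  -- suffices, both for `G` and for `G₀`.
  · have key : allOnes k n d ∉ perp d U → psi d U = symIdeal V := fun hones =>
      psi_eq_symIdeal hd hF hr hf hU hGr hV fun F hFd h =>
        eq_zero_of_derivatives_mem_perp hd hF hdn hr hGr hones (fun h2 hrlt => by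
          have := (hf ⟨0, hr⟩).three_le hd (by omega)
          omega) hFd h
    refine ⟨span_fForms_mem_Gr hf hU hGr hV, ?_, fun hUG => key (allOnes_notMem_perp hn hr hUG),
      fun hW => ?_⟩
    · rw [Submodule.span_image, Submodule.span_eq, map_reynolds_span hf hU hV]
    · obtain ⟨i, hi⟩ := exists_sum_ne_zero_of_mem_sumOpen hW
      exact key (allOnes_notMem_perp_of_sum_ne_zero hF hdn hU hGr hi)
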